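/- **Setting.** For $N\ge 1$ let $S_N=\{-1,1\}^N$ and $R(\sigma,\tau)=\frac1N\sum_{i=1}^N\sigma_i\tau_i$ for $\sigma,\tau\in S_N$. Let $M=M(N)$ be real numbers with $2^{M(N)}\le 2^N$ and $\log N=o(2^{M(N)})$ as $N\to\infty$. On a probability space with measure $\mathrm P$ let, for every $N$, $(X_\sigma)_{\sigma\in S_N}$ be i.i.d. Bernoulli variables with $\mathrm P(X_\sigma=1)=2^{M}/2^{N}$ (no assumption is made on the joint law for different $N$), and let $X=\{\sigma\in S_N: X_\sigma=1\}$ be the random cloud. On another probability space, with measure $\mathbb P$, let, for every $N$, $(H_N(\sigma))_{\sigma\in S_N}$ be a centered Gaussian family with covariance $\mathrm{cov}(H_N(\sigma),H_N(\tau))=\nu(R(\sigma,\tau))$. Put $$b_N=\sqrt{1/M},\qquad a_N=\sqrt{2M\log 2+2\log b_N-\log 2},\qquad \mathcal P_N=\sum_{\sigma\in X}\delta_{(H_N(\sigma)-a_N)/b_N}.$$ For a fixed realization of the clouds $X$, $\mathcal P_N$ is a point process on $\mathbb R$ under $\mathbb P$; convergence of its distribution means weak convergence of its law under $\mathbb P$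 on the space of locally finite measures on $\mathbb R$ with the vague topology. Let $\mu(dt)=\frac1{\sqrt\pi}e^{-t\sqrt{2\log 2}}\,dt$. **Theorem (Breakdown of universality).** (i) (Number partitioning.) Let $\nu(r)=r$ and suppose that $\limsup_{N\to\infty} M(N)/\sqrt N<\infty$. Then $\mathrm P$-almost surely the distribution of $\mathcal P_N$ converges weakly to the distribution of a Poisson point process if and only if $M=o(\sqrt N)$. (ii) (Sherrington–Kirkpatrick model.) Let $\nu(r)=r^2$ and suppose that $\limsup_{N\to\infty} M(N)/N<\frac1{8\log 2}$. Then $\mathrm P$-almost surely the distribution of $\mathcal P_N$ converges weakly to the distribution of a Poisson point process if and only if $M=o(N)$. In both parts the equivalence holds both when "a Poisson point process" is read as "the Poisson point process with intensity measure $\mu$" and when it is read as "a Poisson point process with some locally finite intensity measure". -/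

import Mathlib

open MeasureTheory ProbabilityTheory Filter Asymptotics
open scoped Topology ENNReal

noncomputable section

namespace RandomCloud

/-! ### Random measures on the line: vague topology, Poisson processes, weak convergence -/

/-- The space of locally finite Borel measures on `ℝ`, the state space of point processes. -/
structure LocFinMeasure where
  /-- The underlying measure. -/
  toMeasure : Measure ℝ
  /-- It is finite on bounded sets. -/
  locallyFinite : IsLocallyFiniteMeasure toMeasure

/-- The vague topology: the coarsest topology for which `m ↦ ∫ f dm` is continuous for every
continuous compactly supported `f`. -/
instance : TopologicalSpace LocFinMeasure :=
  ⨅ f : CompactlySupportedContinuousMap ℝ ℝ,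
    TopologicalSpace.induced (fun m : LocFinMeasure => ∫ x, f x ∂m.toMeasure) inferInstance

/-- The Borel σ-algebra of the vague topology. -/
instance : MeasurableSpace LocFinMeasure := borel LocFinMeasure

instance : BorelSpace LocFinMeasure := ⟨rfl⟩

/-- `Q` is the distribution of a Poisson point process on `ℝ` with (locally finite) intensity
measure `Λ`: the number of points in a bounded Borel set `A` is Poisson with parameter `Λ A`, and
the numbers of points in pairwise disjoint bounded Borel sets are independent. -/
structure IsPoissonProcessLaw (Λ : Measure ℝ) (Q : ProbabilityMeasure LocFinMeasure) : Prop where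
  locallyFinite : IsLocallyFiniteMeasure Λ
  map_count : ∀ A : Set ℝ, MeasurableSet A → Bornology.IsBounded A →
    (Q : Measure LocFinMeasure).map (fun m => m.toMeasure A) =
      (poissonMeasure (Λ A).toNNReal).map (fun n : ℕ => (n : ℝ≥0∞))
  indep_count : ∀ (k : ℕ) (A : Fin k → Set ℝ), (∀ i, MeasurableSet (A i)) →
    (∀ i, Bornology.IsBounded (A i)) → Pairwise (fun i j => Disjoint (A i) (A j)) →
    iIndepFun (fun i (m : LocFinMeasure) => m.toMeasure (A i)) (Q : Measure LocFinMeasure)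

/-- The distributions of the point processes `ξ N` converge weakly to the distribution of a Poisson
point process with intensity measure `Λ`. -/
def ConvergesToPoisson {Ω : Type*} [MeasurableSpace Ω] (Pg : Measure Ω) [IsProbabilityMeasure Pg]
    (ξ : ℕ → Ω → LocFinMeasure) (Λ : Measure ℝ) : Prop :=
  ∃ Q : ProbabilityMeasure LocFinMeasure, IsPoissonProcessLaw Λ Q ∧
    TendstoInDistribution ξ atTop (id : LocFinMeasure → LocFinMeasure) (fun _ => Pg)
      (Q : Measure LocFinMeasure)

/-! ### The hypercube, the random cloud and the Gaussian Hamiltonian -/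

/-- The hypercube `{-1, 1}^N`. -/
abbrev Spin (N : ℕ) : Type := Fin N → ℤˣ

/-- The overlap `R(σ, τ) = (1/N) ∑ σᵢ τᵢ`. -/
def overlap {N : ℕ} (σ τ : Spin N) : ℝ :=
  (1 / (N : ℝ)) * ∑ i, (((σ i : ℤ) : ℝ) * ((τ i : ℤ) : ℝ))

/-- For every `N ≥ 1`, the indicators `X N σ`, `σ ∈ {-1, 1}^N`, are i.i.d. Bernoulli with success
probability `2^(M N) / 2^N`. Nothing is assumed about the joint law for different `N`. -/
structure IsRandomCloud {Ω : Type*} [MeasurableSpace Ω] (P : Measure Ω) (M : ℕ → ℝ)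
    (X : (N : ℕ) → Spin N → Ω → Bool) : Prop where
  measurable : ∀ N σ, Measurable (X N σ)
  indep : ∀ N, iIndepFun (X N) P
  prob : ∀ N, 0 < N → ∀ σ, P {ω | X N σ ω = true} = ENNReal.ofReal ((2 : ℝ) ^ (M N) / (2 : ℝ) ^ N)

/-- For every `N`, `(H N σ)_σ` is a centered Gaussian family with covariance `ν (R(σ, τ))`. -/
structure IsGaussianHamiltonian {Ω : Type*} [MeasurableSpace Ω] (Pg : Measure Ω) (ν : ℝ → ℝ)
    (H : (N : ℕ) → Spin N → Ω → ℝ) : Prop where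
  gaussian : ∀ N, IsGaussianProcess (H N) Pg
  centered : ∀ N σ, ∫ ω, H N σ ω ∂Pg = 0
  cov_eq : ∀ N σ τ, cov[H N σ, H N τ; Pg] = ν (overlap σ τ)

/-! ### The normalized point process -/

/-- The scale `b = √(1 / M)`. -/
def scale (M : ℝ) : ℝ := √(1 / M)

/-- The centering `a = √(2 M log 2 + 2 log b - log 2)`. -/
def center (M : ℝ) : ℝ := √(2 * M * Real.log 2 + 2 * Real.log (scale M) - Real.log 2)

/-- The point process `∑_{σ ∈ X} δ_{(H(σ) - a) / b}`, where the cloud is `X = {σ | x σ = true}`. -/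
def pointProcess {N : ℕ} {Ω : Type*} (M : ℝ) (x : Spin N → Bool) (H : Spin N → Ω → ℝ) (ω : Ω) :
    LocFinMeasure where
  toMeasure := ∑ σ with x σ = true, Measure.dirac ((H σ ω - center M) / scale M)
  locallyFinite := inferInstance

/-- The intensity `μ(dt) = π^(-1/2) exp(-t √(2 log 2)) dt`. -/
def intensity : Measure ℝ :=
  volume.withDensity fun t =>
    ENNReal.ofReal (1 / √Real.pi * Real.exp (-t * √(2 * Real.log 2)))

end RandomCloud

end

/-! The scaling is tuned so that `2^M * b * exp(-a²/2) = √2` (`two_rpow_mul_scale_mul_exp`). For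
clouds with about `2^M` points the mean measure of the process therefore converges to μ whatever the
correlations are, and only the dependence between points decides the limit. Two standard Gaussians
with correlation r both fall into a bounded window of the process with probability at most a
constant times `2^(-2M) * exp(2 log 2 * M|r|)` (`exists_pair_bound`). In a random cloud a typical
overlap has size `N^(-1/2)`, so `M|ν(R)|` has size `M/√N` for number partitioning and `M/N` for the
SK model. These are the two thresholds.

Sufficiency. Weak convergence follows from convergence of characteristic functionals
(`tendstoInDistribution_of_charFunctional`). Put `L(θ) = E exp(iθ ∑ g(H σ))`. In each term of `L'`
the coordinate `H σ` is separated from the others by replacing it, inside the remaining coordinates,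
with an independent copy. This gives `L' ≈ m' L`, where `m` is the Poisson exponent, and integrating
over `[0,1]` gives `L(1) ≈ exp(m(1))` (`norm_charFunctional_sub_le`). The error is a sum over pairs
of the effect of resampling. Because test functions are uniformly continuous, each effect is at most
`C δ 2^(-2M) exp(K M|r|)`, with δ arbitrarily small at the price of a large K
(`exists_resampleGap_bound`). Below the threshold the normalized pair sums are eventually bounded by
a constant independent of K, so the total error is O(δ) (`convergesToPoisson_of_pairSum`).

Necessity. If M is not below the threshold, a global fluctuation V of the field is visible in the
process (`IsCommonFactor`). For number partitioning `H σ = ⟨G, σ⟩/√N` with G standard Gaussian in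
dimension N, and `V = (|G|² - N)/√N`; for the SK model `V = √N 2^(-N) ∑ H τ`. In both cases `V = q(H
σ) + W σ` with `W σ` independent of `H σ`, and on the windows q is of order `M/√N`, respectively
`√(M/N)`, hence at least some κ > 0 for infinitely many N. A nonnegative linear statistic Z of the
process then satisfies `E[Z V] ≥ κ E Z`. Under a Poisson limit, however, Z with a large mean m is
nearly constant relative to m, and `E[Z V] = E[(Z - m) V]` would be a small fraction of m
(`IsCommonFactor.le_of_concentration`, `IsModerateCloud.not_convergesToPoisson`). Bounded second
moments transfer the means and the L¹ concentration between the process and its limit; in particular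
they force a Poisson limit to have intensity μ (`IsModerateCloud.eq_intensity`).

The clouds enter only through almost sure properties (`IsTypicalCloud`), each proved by a summable
bound and Borel–Cantelli, so no joint law over N is needed. If `2^M ≥ N²`, Chebyshev's inequality
for a quadratic form in the indicators controls `∑ exp(a N R²)`; this needs `a < 1/4`, which is
where the constant `1/(8 log 2)` of the SK model comes from. If `2^M < N²`, a union bound shows that
all overlaps are `O(√(log N / N))`. -/

noncomputable section

namespace RandomCloud

/-! ### The vague topology -/

/-- Test functions: continuous functions on the line with compact support. -/
abbrev TestFun : Type := CompactlySupportedContinuousMap ℝ ℝ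

instance (m : LocFinMeasure) : IsLocallyFiniteMeasure m.toMeasure := m.locallyFinite

lemma TestFun.integrable (f : TestFun) (m : Measure ℝ) [IsLocallyFiniteMeasure m] :
    Integrable (fun x => f x) m :=
  f.continuous.integrable_of_hasCompactSupport f.hasCompactSupport

lemma TestFun.exists_tsupport_subset (f : TestFun) :
    ∃ k : ℕ, ∀ x : ℝ, (k : ℝ) < |x| → f x = 0 := by
  obtain ⟨C, hC⟩ := f.hasCompactSupport.isCompact.isBounded.exists_norm_le
  obtain ⟨k, hk⟩ := exists_nat_ge C
  refine ⟨k, fun x hx => ?_⟩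
  by_contra h
  have := hC x (subset_tsupport _ h)
  rw [Real.norm_eq_abs] at this
  linarith

lemma TestFun.exists_bound (f : TestFun) : ∃ C : ℝ, 0 ≤ C ∧ ∀ x, |f x| ≤ C := by
  obtain ⟨C, hC⟩ := f.continuous.bounded_above_of_compact_support f.hasCompactSupport
  exact ⟨C, (norm_nonneg _).trans (hC 0), hC⟩

/-- A continuous function vanishing outside a bounded interval, as a test function. -/
def mkTest (f : ℝ → ℝ) (hf : Continuous f) (s : ℝ) (hs : ∀ x, s < |x| → f x = 0) : TestFun where
  toFun := f
  continuous_toFun := hf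
  hasCompactSupport' := by
    refine HasCompactSupport.intro (isCompact_Icc (a := -s) (b := s)) fun x hx => hs x ?_
    by_contra h
    exact hx (abs_le.1 (not_lt.1 h))

/-- The tent-shaped cut-off which equals `1` on `[-k, k]` and `0` outside `[-k-1, k+1]`. -/
def bump (k : ℕ) : TestFun :=
  mkTest (fun x => max 0 (min 1 (k + 1 - |x|))) (by fun_prop) (k + 1) fun x hx => by
    rw [max_eq_left]; exact (min_le_right _ _).trans (by linarith)

lemma bump_nonneg (k : ℕ) (x : ℝ) : 0 ≤ bump k x := le_max_left _ _

lemma bump_eq_one {k : ℕ} {x : ℝ} (hx : |x| ≤ k) : bump k x = 1 := by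
  change max 0 (min 1 ((k : ℝ) + 1 - |x|)) = 1
  rw [min_eq_left (by linarith), max_eq_right zero_le_one]

lemma continuous_integral_test (f : TestFun) :
    Continuous fun m : LocFinMeasure => ∫ x, f x ∂m.toMeasure :=
  continuous_iff_le_induced.2 (iInf_le _ f)

/-- The space of continuous functions on `[-k, k]` is separable, hence so is the subset of
restrictions of test functions supported there. Taking the dense set inside this subset keeps the
approximants supported in the same interval. -/
lemma exists_countable_approx (k : ℕ) : ∃ C : Set TestFun, C.Countable ∧
    (∀ g ∈ C, ∀ x : ℝ, (k : ℝ) < |x| → g x = 0) ∧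
    ∀ f : TestFun, (∀ x : ℝ, (k : ℝ) < |x| → f x = 0) → ∀ ε > 0, ∃ g ∈ C,
      ∀ x, |f x - g x| ≤ ε := by
  let K : Set ℝ := Set.Icc (-(k : ℝ)) k
  let r : TestFun → C(K, ℝ) := fun f => f.toContinuousMap.restrict K
  let A : Set TestFun := {f | ∀ x : ℝ, (k : ℝ) < |x| → f x = 0}
  have hsep : TopologicalSpace.IsSeparable (r '' A) := TopologicalSpace.IsSeparable.of_separableSpace _
  obtain ⟨c, hcA, hc, hcl⟩ := hsep.exists_countable_dense_subset
  have hcA' : ∀ y ∈ c, ∃ p, p ∈ A ∧ r p = y := fun y hy => hcA hy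
  choose! p hpA hp using hcA'
  refine ⟨p '' c, hc.image p, ?_, ?_⟩
  · rintro _ ⟨y, hy, rfl⟩
    exact hpA y hy
  · intro f hf ε hε
    obtain ⟨y, hy, hd⟩ := Metric.mem_closure_iff.1 (hcl ⟨f, hf, rfl⟩) ε hε
    refine ⟨p y, ⟨y, hy, rfl⟩, fun x => ?_⟩
    by_cases hx : |x| ≤ k
    · have h1 := ContinuousMap.dist_apply_le_dist (f := r f) (g := y) ⟨x, abs_le.1 hx⟩
      rw [← hp y hy] at h1 hd
      exact h1.trans hd.le
    · rw [hf x (not_le.1 hx), hpA y hy x (not_le.1 hx)]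
      simpa using hε.le

/-- Uniform approximation of a test function passes to integrals only if the mass of `[-k, k]` is
locally bounded; continuity of the integral of `bump k` supplies that. The topology of `T` is left
arbitrary so that `T` can be the space of measures with the topology induced by `D` alone. -/
lemma continuous_integral_of_approx {D : Set TestFun} (hb : ∀ k, bump k ∈ D)
    (hD : ∀ (k : ℕ) (f : TestFun), (∀ x : ℝ, (k : ℝ) < |x| → f x = 0) → ∀ ε > 0, ∃ g ∈ D,
      (∀ x : ℝ, (k : ℝ) < |x| → g x = 0) ∧ ∀ x, |f x - g x| ≤ ε)
    {T : Type*} [TopologicalSpace T] {g : T → LocFinMeasure}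
    (hg : ∀ d ∈ D, Continuous fun t => ∫ x, d x ∂(g t).toMeasure) (f : TestFun) :
    Continuous fun t => ∫ x, f x ∂(g t).toMeasure := by
  obtain ⟨k, hk⟩ := f.exists_tsupport_subset
  rw [continuous_iff_continuousAt]
  intro t₀
  rw [ContinuousAt, Metric.tendsto_nhds]
  intro ε hε
  set B := ∫ x, bump k x ∂(g t₀).toMeasure with hB
  have hB0 : 0 ≤ B := integral_nonneg fun x => bump_nonneg k x
  obtain ⟨d, hd, hdk, hfd⟩ := hD k f hk (ε / (4 * (B + 1))) (by positivity)
  have key : ∀ t, |∫ x, f x ∂(g t).toMeasure - ∫ x, d x ∂(g t).toMeasure| ≤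
      ε / (4 * (B + 1)) * ∫ x, bump k x ∂(g t).toMeasure := by
    intro t
    rw [← integral_sub (f.integrable _) (d.integrable _), ← integral_const_mul]
    refine norm_integral_le_of_norm_le (f := fun x => f x - d x)
      (((bump k).integrable (g t).toMeasure).const_mul _) (.of_forall fun x => ?_)
    by_cases hx : |x| ≤ k
    · rw [bump_eq_one hx, mul_one]; exact hfd x
    · rw [hk x (not_le.1 hx), hdk x (not_le.1 hx)]
      simpa using mul_nonneg (by positivity) (bump_nonneg k x)
  have h1 := (Metric.tendsto_nhds.1 (continuous_iff_continuousAt.1 (hg _ hd) t₀)) (ε / 4)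
    (by positivity)
  have h2 := (Metric.tendsto_nhds.1 (continuous_iff_continuousAt.1 (hg _ (hb k)) t₀)) 1 one_pos
  filter_upwards [h1, h2] with t ht1 ht2
  rw [Real.dist_eq] at ht1 ht2 ⊢
  have e0 := key t₀
  have e1 := key t
  have l1 : ε / (4 * (B + 1)) * ∫ x, bump k x ∂(g t).toMeasure ≤ ε / 4 := by
    have : ∫ x, bump k x ∂(g t).toMeasure ≤ B + 1 := by linarith [(abs_lt.1 ht2).2]
    calc _ ≤ ε / (4 * (B + 1)) * (B + 1) := by gcongr
      _ = ε / 4 := by field_simp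
  have l0 : ε / (4 * (B + 1)) * B ≤ ε / 4 := by
    calc _ ≤ ε / (4 * (B + 1)) * (B + 1) := by gcongr; linarith
      _ = ε / 4 := by field_simp
  rw [abs_le] at e0 e1
  rw [abs_lt] at ht1 ⊢
  constructor <;> linarith [e0.1, e0.2, e1.1, e1.2, ht1.1, ht1.2]

lemma continuous_induced_apply {T : Type*} (F : T → ℕ → ℝ) (n : ℕ) :
    @Continuous T ℝ (TopologicalSpace.induced F inferInstance) _ fun t => F t n := by
  let _ : TopologicalSpace T := TopologicalSpace.induced F inferInstance
  have hF : Continuous F := continuous_induced_dom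
  fun_prop

/-- The vague topology is induced by countably many test functions. -/
lemma exists_isInducing : ∃ d : ℕ → TestFun,
    Topology.IsInducing fun (m : LocFinMeasure) (n : ℕ) => ∫ x, d n x ∂m.toMeasure := by
  choose C hC hCs hCa using exists_countable_approx
  let D : Set TestFun := Set.range bump ∪ ⋃ k, C k
  have hDc : D.Countable := (Set.countable_range _).union (Set.countable_iUnion hC)
  obtain ⟨d, hd⟩ := hDc.exists_eq_range ⟨bump 0, Or.inl ⟨0, rfl⟩⟩
  refine ⟨d, ⟨le_antisymm ?_ ?_⟩⟩
  · exact continuous_iff_le_induced.1 (continuous_pi fun n => continuous_integral_test _)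
  · refine le_iInf fun f => ?_
    rw [← continuous_iff_le_induced]
    refine @continuous_integral_of_approx D (fun k => Or.inl ⟨k, rfl⟩) ?_ LocFinMeasure
      (TopologicalSpace.induced (fun (m : LocFinMeasure) (n : ℕ) => ∫ x, d n x ∂m.toMeasure)
        inferInstance) id ?_ f
    · intro k f hf ε hε
      obtain ⟨g, hg, h⟩ := hCa k f hf ε hε
      exact ⟨g, Or.inr (Set.mem_iUnion.2 ⟨k, hg⟩), hCs k g hg, h⟩
    · intro g hg
      rw [hd] at hg
      obtain ⟨n, rfl⟩ := hg
      exact continuous_induced_apply (fun (m : LocFinMeasure) (n : ℕ) => ∫ x, d n x ∂m.toMeasure) n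

/-- As countably many test functions induce the topology, its Borel σ-algebra is pulled back from
the product σ-algebra of `ℕ → ℝ`. -/
lemma measurable_locFin_iff {T : Type*} [MeasurableSpace T] {g : T → LocFinMeasure} :
    Measurable g ↔ ∀ f : TestFun, Measurable fun t => ∫ x, f x ∂(g t).toMeasure := by
  refine ⟨fun h f => (continuous_integral_test f).measurable.comp h, fun h => ?_⟩
  obtain ⟨d, hd⟩ := exists_isInducing
  have : (borel LocFinMeasure) =
      MeasurableSpace.comap (fun (m : LocFinMeasure) (n : ℕ) => ∫ x, d n x ∂m.toMeasure)
        inferInstance := by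
    rw [BorelSpace.measurable_eq (α := ℕ → ℝ), ← borel_comap, ← hd.eq_induced]
  change @Measurable _ _ _ (borel LocFinMeasure) g
  rw [this, measurable_comap_iff]
  exact measurable_pi_lambda _ fun n => h (d n)

/-! ### Measurability of the counts -/

lemma tendsto_min_infDist {U : Set ℝ} (hU : IsOpen U) (hne : Uᶜ.Nonempty) (x : ℝ) :
    Tendsto (fun n : ℕ => min 1 (n * Metric.infDist x Uᶜ)) atTop (𝓝 (U.indicator 1 x)) := by
  by_cases hx : x ∈ U
  · have hpos : 0 < Metric.infDist x Uᶜ :=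
      (hU.isClosed_compl.notMem_iff_infDist_pos hne).1 (by simpa using hx)
    rw [Set.indicator_of_mem hx, Pi.one_apply]
    refine tendsto_const_nhds.congr' ?_
    have := (tendsto_natCast_atTop_atTop (R := ℝ)).atTop_mul_const hpos
    filter_upwards [this.eventually_ge_atTop 1] with n hn
    rw [min_eq_left hn]
  · rw [Set.indicator_of_notMem hx, Metric.infDist_zero_of_mem (by exact hx)]
    simp

lemma measurable_apply_isOpen {U : Set ℝ} (hU : IsOpen U) (hb : Bornology.IsBounded U) :
    Measurable fun m : LocFinMeasure => m.toMeasure U := by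
  have hne : Uᶜ.Nonempty := by
    rw [Set.nonempty_compl]
    rintro rfl
    exact NormedSpace.unbounded_univ ℝ ℝ hb
  obtain ⟨C, hC⟩ := hb.exists_norm_le
  let f : ℕ → TestFun := fun n => mkTest (fun x => min 1 (n * Metric.infDist x Uᶜ))
    (by fun_prop) C (fun x hx => by
      rw [Metric.infDist_zero_of_mem]
      · simp
      · intro h; exact absurd (hC x h) (not_le.2 hx))
  have hfin : ∀ m : LocFinMeasure, m.toMeasure U ≠ ⊤ := fun m => hb.measure_lt_top.ne
  have key : ∀ m : LocFinMeasure, Tendsto (fun n => ∫ x, f n x ∂m.toMeasure) atTop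
      (𝓝 (m.toMeasure.real U)) := by
    intro m
    rw [← integral_indicator_one hU.measurableSet]
    refine tendsto_integral_of_dominated_convergence (U.indicator 1)
      (fun n => (f n).continuous.aestronglyMeasurable) ?_ (fun n => .of_forall fun x => ?_)
      (.of_forall fun x => tendsto_min_infDist hU hne x)
    · exact (integrable_indicator_iff hU.measurableSet).2
        (integrableOn_const (hfin m))
    · change ‖min 1 ((n : ℝ) * Metric.infDist x Uᶜ)‖ ≤ _
      rw [Real.norm_of_nonneg (le_min zero_le_one (mul_nonneg n.cast_nonneg Metric.infDist_nonneg))]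
      by_cases hx : x ∈ U
      · rw [Set.indicator_of_mem hx]; exact min_le_left _ _
      · rw [Set.indicator_of_notMem hx, Metric.infDist_zero_of_mem (by exact hx)]; simp
  have hr : Measurable fun m : LocFinMeasure => m.toMeasure.real U :=
    measurable_of_tendsto_metrizable (fun n => (continuous_integral_test (f n)).measurable)
      (tendsto_pi_nhds.2 key)
  have : (fun m : LocFinMeasure => m.toMeasure U) =
      fun m => ENNReal.ofReal (m.toMeasure.real U) := by
    funext m
    rw [measureReal_def, ENNReal.ofReal_toReal (hfin m)]
  rw [this]
  exact hr.ennreal_ofReal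

/-- A π-λ argument from open sets. It is run inside a ball, because complements require a finite
total mass; the balls then exhaust the line. -/
lemma measurable_apply {A : Set ℝ} (hA : MeasurableSet A) :
    Measurable fun m : LocFinMeasure => m.toMeasure A := by
  have key : ∀ k : ℕ, ∀ B : Set ℝ, MeasurableSet B →
      Measurable fun m : LocFinMeasure => m.toMeasure (B ∩ Metric.ball 0 k) := by
    intro k B hB
    have hbo : ∀ B : Set ℝ, Bornology.IsBounded (B ∩ Metric.ball (0 : ℝ) k) :=
      fun B => Metric.isBounded_ball.subset Set.inter_subset_right
    induction B, hB using MeasurableSpace.induction_on_inter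
      (BorelSpace.measurable_eq (α := ℝ)) isPiSystem_isOpen with
    | empty => simp
    | basic t ht => exact measurable_apply_isOpen (IsOpen.inter ht Metric.isOpen_ball) (hbo t)
    | compl t ht ih =>
      have : ∀ m : LocFinMeasure, m.toMeasure (tᶜ ∩ Metric.ball 0 k) =
          m.toMeasure (Metric.ball 0 k) - m.toMeasure (t ∩ Metric.ball 0 k) := by
        intro m
        rw [← measure_sdiff Set.inter_subset_right
          (ht.inter measurableSet_ball).nullMeasurableSet (hbo t).measure_lt_top.ne]
        congr 1
        ext x; simp only [Set.mem_inter_iff, Set.mem_compl_iff, Set.mem_sdiff]; tauto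
      simp_rw [this]
      exact (measurable_apply_isOpen Metric.isOpen_ball Metric.isBounded_ball).sub ih
    | iUnion f hd hm ih =>
      have : ∀ m : LocFinMeasure, m.toMeasure ((⋃ i, f i) ∩ Metric.ball 0 k) =
          ∑' i, m.toMeasure (f i ∩ Metric.ball 0 k) := by
        intro m
        rw [Set.iUnion_inter, measure_iUnion]
        · exact fun i j hij => (hd hij).mono Set.inter_subset_left Set.inter_subset_left
        · exact fun i => (hm i).inter measurableSet_ball
      simp_rw [this]
      exact Measurable.tsum ih
  have : ∀ m : LocFinMeasure, m.toMeasure A = ⨆ k : ℕ, m.toMeasure (A ∩ Metric.ball 0 k) := by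
    intro m
    rw [← Monotone.measure_iUnion, ← Set.inter_iUnion, Metric.iUnion_ball_nat, Set.inter_univ]
    exact fun i j hij => Set.inter_subset_inter_right _
      (Metric.ball_subset_ball (by exact_mod_cast hij))
  simp_rw [this]
  exact Measurable.iSup fun k => key k A hA

lemma measurable_toMeasure : Measurable LocFinMeasure.toMeasure :=
  Measure.measurable_of_measurable_coe _ fun _ hA => measurable_apply hA

/-! ### Weak convergence from convergence of characteristic functionals -/

/-- The vector of the integrals of the first `k` test functions of a sequence. -/
def testVec (d : ℕ → TestFun) (k : ℕ) (m : LocFinMeasure) : EuclideanSpace ℝ (Fin k) :=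
  WithLp.toLp 2 fun i : Fin k => ∫ x, d i x ∂m.toMeasure

lemma continuous_testVec (d : ℕ → TestFun) (k : ℕ) : Continuous (testVec d k) :=
  (PiLp.continuous_toLp 2 _).comp (continuous_pi fun i => continuous_integral_test (d i))

lemma charFun_map_testVec (d : ℕ → TestFun) (k : ℕ) (t : EuclideanSpace ℝ (Fin k))
    (μ : Measure LocFinMeasure) :
    charFun (μ.map (testVec d k)) t =
      ∫ m, Complex.exp (((∫ x, (∑ i : Fin k, t i • d i) x ∂m.toMeasure : ℝ) : ℂ) * Complex.I) ∂μ := by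
  rw [charFun_apply, integral_map (continuous_testVec d k).aemeasurable (by fun_prop)]
  refine integral_congr_ae (.of_forall fun m => ?_)
  have : ∫ x, (∑ i : Fin k, t i • d i) x ∂m.toMeasure = inner ℝ (testVec d k m) t := by
    simp only [PiLp.inner_apply, testVec, RCLike.inner_apply, conj_trivial]
    have : ∀ x, (∑ i : Fin k, t i • d i) x = ∑ i : Fin k, t i * d i x := by
      intro x; simp
    simp_rw [this]
    rw [integral_finsetSum (f := fun (i : Fin k) x => t i * d i x) _
      fun i _ => ((d i).integrable m.toMeasure).const_mul _]
    simp_rw [integral_const_mul]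
  simp only [this]

/-- The part of a set of measures which depends on the first `k` test functions only. -/
def cylinderPart (d : ℕ → TestFun) (G : Set LocFinMeasure) (k : ℕ) :
    Set (EuclideanSpace ℝ (Fin k)) :=
  ⋃₀ {V | IsOpen V ∧ testVec d k ⁻¹' V ⊆ G}

lemma isOpen_cylinderPart (d : ℕ → TestFun) (G : Set LocFinMeasure) (k : ℕ) :
    IsOpen (cylinderPart d G k) := isOpen_sUnion fun _ h => h.1

lemma preimage_cylinderPart_subset (d : ℕ → TestFun) (G : Set LocFinMeasure) (k : ℕ) :
    testVec d k ⁻¹' cylinderPart d G k ⊆ G := by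
  rintro m ⟨V, hV, hm⟩
  exact hV.2 hm

lemma monotone_preimage_cylinderPart (d : ℕ → TestFun) (G : Set LocFinMeasure) :
    Monotone fun k => testVec d k ⁻¹' cylinderPart d G k := by
  refine fun k l hkl m => ?_
  rintro ⟨V, hV, hm⟩
  let p : EuclideanSpace ℝ (Fin l) → EuclideanSpace ℝ (Fin k) :=
    fun v => WithLp.toLp 2 fun i => v (Fin.castLE hkl i)
  have hp : Continuous p := by
    refine (PiLp.continuous_toLp 2 _).comp (continuous_pi fun i => ?_)
    fun_prop
  have hpt : ∀ m, p (testVec d l m) = testVec d k m := fun m => rfl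
  refine ⟨p ⁻¹' V, ⟨hV.1.preimage hp, fun m' hm' => hV.2 ?_⟩, ?_⟩
  · simpa [hpt] using hm'
  · simpa [hpt] using hm

lemma iUnion_preimage_cylinderPart {d : ℕ → TestFun}
    (hd : Topology.IsInducing fun (m : LocFinMeasure) (n : ℕ) => ∫ x, d n x ∂m.toMeasure)
    {G : Set LocFinMeasure} (hG : IsOpen G) :
    ⋃ k, testVec d k ⁻¹' cylinderPart d G k = G := by
  refine Set.Subset.antisymm (Set.iUnion_subset fun k => preimage_cylinderPart_subset d G k) ?_
  intro m hm
  obtain ⟨U, hU, rfl⟩ := hd.isOpen_iff.1 hG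
  obtain ⟨I, u, hu, hsub⟩ := isOpen_pi_iff.1 hU _ hm
  -- A basic neighbourhood in the product constrains the finitely many indices in `I`; all of them
  -- are below `I.sup id + 1`.
  refine Set.mem_iUnion.2 ⟨I.sup id + 1, ?_⟩
  refine ⟨⋂ i ∈ (Finset.univ.filter fun i : Fin (I.sup id + 1) => (i : ℕ) ∈ I),
    (fun v : EuclideanSpace ℝ (Fin (I.sup id + 1)) => v i) ⁻¹' u i, ⟨?_, ?_⟩, ?_⟩
  · refine isOpen_biInter_finset fun i hi => ?_
    exact (hu i (Finset.mem_filter.1 hi).2).1.preimage (by fun_prop)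
  · intro m' hm'
    refine hsub fun i hi => ?_
    have := Set.mem_iInter₂.1 hm' ⟨i, Nat.lt_succ_of_le (Finset.le_sup (f := id) hi)⟩
      (Finset.mem_filter.2 ⟨Finset.mem_univ _, hi⟩)
    exact this
  · exact Set.mem_iInter₂.2 fun i hi => (hu i (Finset.mem_filter.1 hi).2).2

/-- Convergence of the characteristic functionals implies convergence in distribution. -/
theorem tendstoInDistribution_of_charFunctional {Ω : Type*} [MeasurableSpace Ω] {Pg : Measure Ω}
    [IsProbabilityMeasure Pg] {ξ : ℕ → Ω → LocFinMeasure} (hξ : ∀ n, AEMeasurable (ξ n) Pg)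
    (Q : ProbabilityMeasure LocFinMeasure)
    (h : ∀ f : TestFun, Tendsto
      (fun n => ∫ ω, Complex.exp (((∫ x, f x ∂(ξ n ω).toMeasure : ℝ) : ℂ) * Complex.I) ∂Pg) atTop
      (𝓝 (∫ m, Complex.exp (((∫ x, f x ∂m.toMeasure : ℝ) : ℂ) * Complex.I)
        ∂(Q : Measure LocFinMeasure)))) :
    TendstoInDistribution ξ atTop (id : LocFinMeasure → LocFinMeasure) (fun _ => Pg)
      (Q : Measure LocFinMeasure) := by
  obtain ⟨d, hd⟩ := exists_isInducing
  refine ⟨hξ, aemeasurable_id, ?_⟩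
  -- Portmanteau criterion on open sets. Since `G` is an increasing union of finite-dimensional
  -- cylinders, Lévy's theorem in each finite dimension is enough and no tightness argument is
  -- needed.
  refine tendsto_of_forall_isOpen_le_liminf' fun G hG => ?_
  simp only [ProbabilityMeasure.coe_mk, Measure.map_id]
  have hmono := monotone_preimage_cylinderPart d G
  rw [← iUnion_preimage_cylinderPart hd hG, hmono.measure_iUnion]
  refine iSup_le fun k => ?_
  let ν : ℕ → ProbabilityMeasure (EuclideanSpace ℝ (Fin k)) := fun n =>
    ⟨(Pg.map (ξ n)).map (testVec d k), by
      have := Measure.isProbabilityMeasure_map (μ := Pg) (hξ n)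
      exact Measure.isProbabilityMeasure_map (continuous_testVec d k).aemeasurable⟩
  let ν₀ : ProbabilityMeasure (EuclideanSpace ℝ (Fin k)) :=
    ⟨(Q : Measure LocFinMeasure).map (testVec d k),
      Measure.isProbabilityMeasure_map (continuous_testVec d k).aemeasurable⟩
  have hν : Tendsto ν atTop (𝓝 ν₀) := by
    refine ProbabilityMeasure.tendsto_of_tendsto_charFun fun t => ?_
    simp only [ν, ν₀, ProbabilityMeasure.coe_mk, charFun_map_testVec]
    have := h (∑ i : Fin k, t i • d i)
    refine this.congr fun n => ?_
    rw [integral_map (hξ n)]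
    exact (Complex.continuous_exp.comp ((Complex.continuous_ofReal.comp
      (continuous_integral_test _)).mul continuous_const)).aestronglyMeasurable
  have hle := ProbabilityMeasure.le_liminf_measure_open_of_tendsto hν (isOpen_cylinderPart d G k)
  simp only [ν, ν₀, ProbabilityMeasure.coe_mk] at hle
  have hm := (continuous_testVec d k).measurable
  have hV := (isOpen_cylinderPart d G k).measurableSet
  rw [Measure.map_apply hm hV] at hle
  simp_rw [Measure.map_apply hm hV] at hle
  refine hle.trans (liminf_le_liminf (.of_forall fun n => measure_mono ?_))
  exact Set.subset_iUnion (fun k => testVec d k ⁻¹' cylinderPart d G k) k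

/-! ### Construction of Poisson point processes on the line -/

section Construction

variable (Λ : Measure ℝ) [IsLocallyFiniteMeasure Λ]

/-- The unit cell `[k, k + 1)`. -/
abbrev cell (k : ℤ) : Set ℝ := Set.Ico (k : ℝ) (k + 1)

/-- The mass of a cell. -/
def cellMass (k : ℤ) : NNReal := (Λ (cell k)).toNNReal

/-- The law of a single point in a cell. -/
def cellLaw (k : ℤ) : Measure ℝ :=
  if cellMass Λ k = 0 then Measure.dirac (k : ℝ) else (cellMass Λ k)⁻¹ • Λ.restrict (cell k)

instance (k : ℤ) : IsFiniteMeasure (Λ.restrict (cell k)) :=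
  ⟨by rw [Measure.restrict_apply_univ]; exact (Metric.isBounded_Ico _ _).measure_lt_top⟩

lemma coe_cellMass (k : ℤ) : (cellMass Λ k : ℝ≥0∞) = Λ (cell k) :=
  ENNReal.coe_toNNReal (Metric.isBounded_Ico _ _).measure_lt_top.ne

instance (k : ℤ) : IsProbabilityMeasure (cellLaw Λ k) := by
  unfold cellLaw
  split_ifs with h
  · infer_instance
  · refine ⟨?_⟩
    rw [Measure.smul_apply, Measure.restrict_apply_univ, ← coe_cellMass, ENNReal.smul_def,
      smul_eq_mul, ← ENNReal.coe_mul, inv_mul_cancel₀ h, ENNReal.coe_one]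

lemma cellMass_smul_cellLaw (k : ℤ) :
    cellMass Λ k • cellLaw Λ k = Λ.restrict (cell k) := by
  unfold cellLaw
  split_ifs with h
  · rw [h, zero_smul, eq_comm, Measure.restrict_eq_zero, ← coe_cellMass, h, ENNReal.coe_zero]
  · rw [smul_smul, mul_inv_cancel₀ h, one_smul]

/-- The number of points and the points in a cell. -/
abbrev CellConfig : Type := ℕ × (ℕ → ℝ)

/-- The law of the number of points and of the points in a cell. -/
def cellConfigLaw (k : ℤ) : Measure CellConfig :=
  (poissonMeasure (cellMass Λ k)).prod (Measure.infinitePi fun _ : ℕ => cellLaw Λ k)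

instance (k : ℤ) : IsProbabilityMeasure (cellConfigLaw Λ k) := by
  unfold cellConfigLaw; infer_instance

/-- The law of a configuration. -/
def configLaw : Measure (ℤ → CellConfig) := Measure.infinitePi (cellConfigLaw Λ)

instance : IsProbabilityMeasure (configLaw Λ) := by
  unfold configLaw; infer_instance

end Construction

/-- The `j`-th point of the cell `[k, k + 1)`. -/
def cellPoint (k : ℤ) (u : ℕ → ℝ) (j : ℕ) : ℝ := k + Int.fract (u j)

/-- Passing through the fractional part keeps the point in its cell for every realization, not just
almost surely, so the process is locally finite everywhere; a value already in the cell is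
unchanged. -/
lemma cellPoint_mem (k : ℤ) (u : ℕ → ℝ) (j : ℕ) : cellPoint k u j ∈ cell k :=
  ⟨by simp [cellPoint], by simp [cellPoint, Int.fract_lt_one]⟩

lemma measurable_cellPoint (k : ℤ) (j : ℕ) : Measurable fun u : ℕ → ℝ => cellPoint k u j := by
  unfold cellPoint
  exact (measurable_fract.comp (measurable_pi_apply j)).const_add _

/-- The counting measure of the points in a cell. -/
def cellMeasure (k : ℤ) (c : CellConfig) : Measure ℝ :=
  ∑ j ∈ Finset.range c.1, Measure.dirac (cellPoint k c.2 j)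

instance (k : ℤ) (c : CellConfig) : IsFiniteMeasure (cellMeasure k c) := by
  unfold cellMeasure; infer_instance

lemma cellMeasure_apply (k : ℤ) (c : CellConfig) {A : Set ℝ} (hA : MeasurableSet A) :
    cellMeasure k c A = ∑ j ∈ Finset.range c.1, A.indicator 1 (cellPoint k c.2 j) := by
  simp [cellMeasure, Measure.finsetSum_apply, hA]

/-- The union of the cells `[k, k+1)`, `|k| ≤ L`. -/
abbrev window (L : ℤ) : Set ℝ := Set.Ico (-L : ℝ) (L + 1)

lemma restrict_sum_cellMeasure (L : ℤ) (c : ℤ → CellConfig) :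
    (Measure.sum fun k => cellMeasure k (c k)).restrict (window L) =
      ∑ k ∈ Finset.Icc (-L) L, cellMeasure k (c k) := by
  ext A hA
  rw [Measure.restrict_apply hA, Measure.sum_apply _ (hA.inter measurableSet_Ico),
    tsum_eq_sum (s := Finset.Icc (-L) L), Measure.finsetSum_apply]
  · refine Finset.sum_congr rfl fun k hk => ?_
    rw [cellMeasure_apply _ _ hA, cellMeasure_apply _ _ (hA.inter measurableSet_Ico)]
    refine Finset.sum_congr rfl fun j _ => ?_
    have h := cellPoint_mem k (c k).2 j
    have hw : cellPoint k (c k).2 j ∈ window L := by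
      rw [Finset.mem_Icc] at hk
      have h1 : (-L : ℝ) ≤ k := by exact_mod_cast hk.1
      have h2 : (k : ℝ) ≤ L := by exact_mod_cast hk.2
      exact ⟨h1.trans h.1, h.2.trans_le (by linarith)⟩
    by_cases hx : cellPoint k (c k).2 j ∈ A
    · rw [Set.indicator_of_mem hx, Set.indicator_of_mem (show _ ∈ A ∩ window L from ⟨hx, hw⟩)]
    · rw [Set.indicator_of_notMem hx, Set.indicator_of_notMem fun h => hx h.1]
  · intro k hk
    rw [cellMeasure_apply _ _ (hA.inter measurableSet_Ico)]
    refine Finset.sum_eq_zero fun j _ => Set.indicator_of_notMem (fun h' => hk ?_) _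
    have h := cellPoint_mem k (c k).2 j
    have hw := h'.2
    rw [Finset.mem_Icc]
    have h1 : (-L : ℝ) < k + 1 := hw.1.trans_lt h.2
    have h2 : (k : ℝ) < L + 1 := h.1.trans_lt hw.2
    have h1' : -L < k + 1 := by exact_mod_cast h1
    have h2' : k < L + 1 := by exact_mod_cast h2
    omega

/-- The point process of a configuration. -/
def configProcess (c : ℤ → CellConfig) : LocFinMeasure where
  toMeasure := Measure.sum fun k => cellMeasure k (c k)
  locallyFinite := by
    refine ⟨fun x => ?_⟩
    obtain ⟨n, hn⟩ := exists_nat_gt (|x| + 1)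
    refine ⟨window n, Ico_mem_nhds ?_ ?_, ?_⟩
    · have := neg_abs_le x; push_cast; linarith
    · have := le_abs_self x; push_cast; linarith
    · have h := restrict_sum_cellMeasure n c
      rw [← Measure.restrict_apply_univ, h, Measure.finsetSum_apply]
      exact ENNReal.sum_lt_top.2 fun k _ => measure_lt_top _ _

lemma exists_window (s : ℝ) : ∃ L : ℤ, ∀ x ∉ window L, s < |x| := by
  obtain ⟨n, hn⟩ := exists_nat_gt s
  refine ⟨n, fun x hx => ?_⟩
  by_contra h
  have h' := abs_le.1 (not_lt.1 h)
  exact hx ⟨by push_cast; linarith, by push_cast; linarith⟩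

lemma integral_configProcess {f : ℝ → ℝ} {L : ℤ}
    (hL : ∀ x ∉ window L, f x = 0) (c : ℤ → CellConfig) :
    ∫ x, f x ∂(configProcess c).toMeasure =
      ∑ k ∈ Finset.Icc (-L) L, ∑ j ∈ Finset.range (c k).1, f (cellPoint k (c k).2 j) := by
  rw [← setIntegral_eq_integral_of_forall_compl_eq_zero hL]
  change ∫ x in window L, f x ∂(Measure.sum fun k => cellMeasure k (c k)) = _
  have hd : ∀ k j, Integrable f (Measure.dirac (cellPoint k (c k).2 j)) := fun k j =>
    integrable_dirac (by simp)
  rw [restrict_sum_cellMeasure, integral_finsetSum_measure]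
  · refine Finset.sum_congr rfl fun k _ => ?_
    rw [cellMeasure, integral_finsetSum_measure fun j _ => hd k j]
    simp_rw [integral_dirac]
  · intro k _
    rw [cellMeasure, integrable_finsetSum_measure]
    exact fun j _ => hd k j

lemma measurable_cellSum {f : ℝ → ℝ} (hf : Measurable f) (k : ℤ) :
    Measurable fun c : CellConfig => ∑ j ∈ Finset.range c.1, f (cellPoint k c.2 j) := by
  refine measurable_from_prod_countable_right fun n => ?_
  exact Finset.measurable_fun_sum (Finset.range n) fun j _ => hf.comp (measurable_cellPoint k j)

lemma measurable_configProcess : Measurable configProcess := by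
  refine measurable_locFin_iff.2 fun f => ?_
  obtain ⟨s, hs⟩ := f.exists_tsupport_subset
  obtain ⟨L, hL⟩ := exists_window s
  rw [show (fun c => ∫ x, f x ∂(configProcess c).toMeasure) = _ from
    funext (integral_configProcess fun x hx => hs x (hL x hx))]
  exact Finset.measurable_fun_sum _ fun k _ =>
    (measurable_cellSum f.continuous.measurable k).comp (measurable_pi_apply k)

/-! ### Characteristic functional of the constructed Poisson process -/

section CharFunctional

variable (Λ : Measure ℝ) [IsLocallyFiniteMeasure Λ]

lemma integral_cellLaw_prod (k : ℤ) (n : ℕ) {g : ℝ → ℂ} (hg : Measurable g) :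
    ∫ u, ∏ j ∈ Finset.range n, g (cellPoint k u j) ∂(Measure.infinitePi fun _ : ℕ => cellLaw Λ k) =
      (∫ x, g (k + Int.fract x) ∂cellLaw Λ k) ^ n := by
  have hm : Measurable fun x : ℝ => g (k + Int.fract x) := hg.comp (measurable_fract.const_add _)
  have hi := (iIndepFun_infinitePi (P := fun _ : ℕ => cellLaw Λ k)
    (X := fun _ x => g (k + Int.fract x)) (fun _ => hm)).precomp
      (g := fun i : Fin n => (i : ℕ)) Fin.val_injective
  have h := hi.integral_fun_prod_eq_prod_integral
    (fun i => (hm.comp (measurable_pi_apply _)).aestronglyMeasurable)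
  simp_rw [Finset.prod_range]
  refine h.trans ?_
  have : ∀ i : Fin n, ∫ u : ℕ → ℝ, g (k + Int.fract (u i))
      ∂(Measure.infinitePi fun _ : ℕ => cellLaw Λ k) = ∫ x, g (k + Int.fract x) ∂cellLaw Λ k := by
    intro i
    have e := Measure.infinitePi_map_eval (fun _ : ℕ => cellLaw Λ k) (i : ℕ)
    conv_rhs => rw [← e]
    rw [integral_map (measurable_pi_apply _).aemeasurable hm.aestronglyMeasurable]
  refine (Finset.prod_congr rfl fun i _ => this i).trans ?_
  simp

lemma integral_pow_poissonMeasure (r : NNReal) (z : ℂ) :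
    ∫ n, z ^ n ∂(poissonMeasure r) = Complex.exp (r * (z - 1)) := by
  rw [integral_poissonMeasure r]
  calc ∑' a : ℕ, (Real.exp (-r) * r ^ a / a.factorial : ℝ) • z ^ a
  _ = ∑' a : ℕ, (Complex.exp (-r)) * ((r * z) ^ a / a.factorial) := by
      congr with a
      rw [Complex.real_smul]
      push_cast
      rw [mul_pow]
      ring
  _ = Complex.exp (-r) * ∑' a : ℕ, ((r * z) ^ a / a.factorial) := tsum_mul_left
  _ = Complex.exp (-r) * Complex.exp (r * z) := by
      rw [(NormedSpace.expSeries_div_hasSum_exp ((r : ℂ) * z)).tsum_eq, Complex.exp_eq_exp_ℂ]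
  _ = Complex.exp (r * (z - 1)) := by
      rw [← Complex.exp_add]
      ring_nf

lemma cellMass_mul_integral_cellLaw (k : ℤ) {g : ℝ → ℂ} :
    (cellMass Λ k : ℂ) * (∫ x, g (k + Int.fract x) ∂cellLaw Λ k) = ∫ x in cell k, g x ∂Λ := by
  have h : ∫ x in cell k, g (k + Int.fract x) ∂Λ = ∫ x in cell k, g x ∂Λ := by
    refine setIntegral_congr_fun measurableSet_Ico fun x hx => ?_
    have : ⌊x⌋ = k := Int.floor_eq_iff.2 hx
    rw [← this, Int.floor_add_fract]
  rw [← h, ← cellMass_smul_cellLaw, integral_smul_nnreal_measure, NNReal.smul_def,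
    Complex.real_smul]

lemma norm_cexp_ofReal_mul_I (x : ℝ) : ‖Complex.exp ((x : ℂ) * Complex.I)‖ = 1 :=
  Complex.norm_exp_ofReal_mul_I x

/-- Given that the cell has n points, independence makes the conditional expectation an n-th power;
the Poisson generating function then sums these powers. -/
lemma integral_cellConfigLaw (k : ℤ) {f : ℝ → ℝ} (hf : Measurable f) :
    ∫ c, Complex.exp (((∑ j ∈ Finset.range c.1, f (cellPoint k c.2 j) : ℝ) : ℂ) * Complex.I)
      ∂(cellConfigLaw Λ k) =
      Complex.exp (∫ x in cell k, (Complex.exp ((f x : ℂ) * Complex.I) - 1) ∂Λ) := by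
  have hg : Measurable fun x : ℝ => Complex.exp ((f x : ℂ) * Complex.I) := by fun_prop
  rw [cellConfigLaw, integral_prod]
  · have h1 : ∀ n : ℕ, ∫ u, Complex.exp (((∑ j ∈ Finset.range n, f (cellPoint k u j) : ℝ) : ℂ) *
        Complex.I) ∂(Measure.infinitePi fun _ : ℕ => cellLaw Λ k) =
        (∫ x, Complex.exp ((f (k + Int.fract x) : ℂ) * Complex.I) ∂cellLaw Λ k) ^ n := by
      intro n
      rw [← integral_cellLaw_prod Λ k n hg]
      congr with u
      rw [← Complex.exp_sum]
      push_cast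
      rw [Finset.sum_mul]
    simp_rw [h1]
    rw [integral_pow_poissonMeasure, mul_sub, cellMass_mul_integral_cellLaw Λ k
      (g := fun x => Complex.exp ((f x : ℂ) * Complex.I)), integral_sub]
    · congr 2
      rw [integral_const, measureReal_restrict_apply_univ, mul_one, Complex.real_smul, mul_one]
      rfl
    · exact Integrable.of_bound hg.aestronglyMeasurable 1
        (.of_forall fun x => (norm_cexp_ofReal_mul_I _).le)
    · exact integrable_const _
  · refine Integrable.of_bound ?_ 1 (.of_forall fun x => (norm_cexp_ofReal_mul_I _).le)
    exact ((Complex.measurable_ofReal.comp (measurable_cellSum hf k)).mul_const _).cexp.aestronglyMeasurable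

/-- The characteristic functional of the Poisson process. -/
lemma integral_cexp_configProcess {f : ℝ → ℝ} (hf : Measurable f) {s : ℝ}
    (hs : ∀ x, s < |x| → f x = 0) :
    ∫ c, Complex.exp (((∫ x, f x ∂(configProcess c).toMeasure : ℝ) : ℂ) * Complex.I) ∂configLaw Λ =
      Complex.exp (∫ x, (Complex.exp ((f x : ℂ) * Complex.I) - 1) ∂Λ) := by
  obtain ⟨L, hL⟩ := exists_window s
  have hL' : ∀ x ∉ window L, f x = 0 := fun x hx => hs x (hL x hx)
  simp_rw [integral_configProcess hL']
  let ψ : ∀ k : ℤ, CellConfig → ℂ := fun k c =>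
    Complex.exp (((∑ j ∈ Finset.range c.1, f (cellPoint k c.2 j) : ℝ) : ℂ) * Complex.I)
  have hψ : ∀ k, Measurable (ψ k) := fun k =>
    ((Complex.measurable_ofReal.comp (measurable_cellSum hf k)).mul_const _).cexp
  have hi := (iIndepFun_infinitePi (P := cellConfigLaw Λ) hψ).precomp
    (g := fun i : Finset.Icc (-L) L => (i : ℤ)) Subtype.val_injective
  have h := hi.integral_fun_prod_eq_prod_integral
    (fun i => ((hψ _).comp (measurable_pi_apply _)).aestronglyMeasurable)
  have h1 : ∀ c : ℤ → CellConfig, Complex.exp (((∑ k ∈ Finset.Icc (-L) L,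
      ∑ j ∈ Finset.range (c k).1, f (cellPoint k (c k).2 j) : ℝ) : ℂ) * Complex.I) =
      ∏ i : Finset.Icc (-L) L, ψ i (c i) := by
    intro c
    rw [Finset.prod_coe_sort (Finset.Icc (-L) L) fun k => ψ k (c k), ← Complex.exp_sum,
      Complex.ofReal_sum, Finset.sum_mul]
  simp_rw [h1]
  refine h.trans ?_
  have h2 : ∀ k : ℤ, ∫ c : ℤ → CellConfig, ψ k (c k) ∂(Measure.infinitePi (cellConfigLaw Λ)) =
      Complex.exp (∫ x in cell k, (Complex.exp ((f x : ℂ) * Complex.I) - 1) ∂Λ) := by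
    intro k
    rw [← integral_cellConfigLaw Λ k hf]
    have e := Measure.infinitePi_map_eval (cellConfigLaw Λ) k
    conv_rhs => rw [← e]
    rw [integral_map (measurable_pi_apply _).aemeasurable (hψ k).aestronglyMeasurable]
  refine (Finset.prod_congr rfl fun (i : Finset.Icc (-L) L) _ => h2 (i : ℤ)).trans ?_
  rw [Finset.prod_coe_sort (Finset.Icc (-L) L) fun k : ℤ =>
    Complex.exp (∫ x in cell k, (Complex.exp ((f x : ℂ) * Complex.I) - 1) ∂Λ), ← Complex.exp_sum]
  congr 1
  rw [← integral_biUnion_finset _ (fun k _ => measurableSet_Ico)]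
  · refine setIntegral_eq_integral_of_forall_compl_eq_zero fun x hx => ?_
    rw [hL' x]
    · simp
    · intro hx'
      refine hx (Set.mem_iUnion₂.2 ⟨⌊x⌋, ?_, Int.floor_le x, Int.lt_floor_add_one x⟩)
      rw [Finset.mem_Icc]
      refine ⟨Int.le_floor.2 (by push_cast; exact hx'.1), ?_⟩
      exact Int.lt_add_one_iff.1 (Int.floor_lt.2 (by push_cast; exact hx'.2))
  · intro k _ l _ hkl
    exact Set.pairwise_disjoint_Ico_intCast ℝ hkl
  · intro k _
    refine Integrable.of_bound (by fun_prop) 2 (.of_forall fun x => ?_)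
    refine (norm_sub_le _ _).trans ?_
    rw [norm_cexp_ofReal_mul_I, norm_one]; norm_num

/-- The law of the Poisson process with intensity `Λ`. -/
def poissonLaw : ProbabilityMeasure LocFinMeasure :=
  ⟨(configLaw Λ).map configProcess,
    Measure.isProbabilityMeasure_map measurable_configProcess.aemeasurable⟩

/-- Stated for measurable functions with bounded support and not only for test functions, so that
step functions yield the joint law of counts. -/
lemma integral_cexp_poissonLaw {f : ℝ → ℝ} (hf : Measurable f) {s : ℝ}
    (hs : ∀ x, s < |x| → f x = 0)
    (hm : Measurable fun m : LocFinMeasure => ∫ x, f x ∂m.toMeasure) :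
    ∫ m, Complex.exp (((∫ x, f x ∂m.toMeasure : ℝ) : ℂ) * Complex.I)
      ∂(poissonLaw Λ : Measure LocFinMeasure) =
      Complex.exp (∫ x, (Complex.exp ((f x : ℂ) * Complex.I) - 1) ∂Λ) := by
  rw [← integral_cexp_configProcess Λ hf hs]
  change ∫ m, _ ∂((configLaw Λ).map configProcess) = _
  rw [integral_map measurable_configProcess.aemeasurable]
  exact ((Complex.measurable_ofReal.comp hm).mul_const _).cexp.aestronglyMeasurable

end CharFunctional

/-! ### Joint law of the counts -/

section Counts

variable (Λ : Measure ℝ) [IsLocallyFiniteMeasure Λ]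

lemma measurable_real_apply {A : Set ℝ} (hA : MeasurableSet A) :
    Measurable fun m : LocFinMeasure => m.toMeasure.real A :=
  (measurable_apply hA).ennreal_toReal

/-- The joint characteristic function of the counts in disjoint bounded sets. -/
lemma integral_cexp_counts {k : ℕ} {A : Fin k → Set ℝ} (hA : ∀ i, MeasurableSet (A i))
    (hb : ∀ i, Bornology.IsBounded (A i)) (hd : Pairwise fun i j => Disjoint (A i) (A j))
    (t : Fin k → ℝ) :
    ∫ m : LocFinMeasure, Complex.exp (((∑ i, t i * m.toMeasure.real (A i) : ℝ) : ℂ) * Complex.I)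
      ∂(poissonLaw Λ : Measure LocFinMeasure) =
      ∏ i, Complex.exp ((Λ (A i)).toNNReal * (Complex.exp (t i * Complex.I) - 1)) := by
  let f : ℝ → ℝ := fun x => ∑ i, (A i).indicator (fun _ => t i) x
  have hf : Measurable f :=
    Finset.measurable_fun_sum _ fun i _ => measurable_const.indicator (hA i)
  obtain ⟨s, hs⟩ : ∃ s : ℝ, ∀ x, s < |x| → f x = 0 := by
    have : Bornology.IsBounded (⋃ i, A i) := (Bornology.isBounded_iUnion).2 hb
    obtain ⟨C, hC⟩ := this.exists_norm_le
    refine ⟨C, fun x hx => Finset.sum_eq_zero fun i _ => Set.indicator_of_notMem (fun h => ?_) _⟩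
    exact absurd (hC x (Set.mem_iUnion.2 ⟨i, h⟩)) (not_le.2 hx)
  have hint : ∀ (m : Measure ℝ) [IsLocallyFiniteMeasure m] (i : Fin k) (c : ℂ),
      Integrable ((A i).indicator fun _ => c) m := fun m _ i c =>
    (integrable_indicator_iff (hA i)).2 (integrableOn_const (hb i).measure_lt_top.ne)
  have hint' : ∀ (m : Measure ℝ) [IsLocallyFiniteMeasure m] (i : Fin k) (c : ℝ),
      Integrable ((A i).indicator fun _ => c) m := fun m _ i c =>
    (integrable_indicator_iff (hA i)).2 (integrableOn_const (hb i).measure_lt_top.ne)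
  have hfm : ∀ m : LocFinMeasure, ∫ x, f x ∂m.toMeasure = ∑ i, t i * m.toMeasure.real (A i) := by
    intro m
    rw [integral_finsetSum _ fun i _ => hint' m.toMeasure i (t i)]
    refine Finset.sum_congr rfl fun i _ => ?_
    rw [integral_indicator_const _ (hA i), smul_eq_mul, mul_comm]
  have h := integral_cexp_poissonLaw Λ hf hs (by
    simp_rw [hfm]
    exact Finset.measurable_fun_sum _ fun i _ => (measurable_real_apply (hA i)).const_mul _)
  simp_rw [hfm] at h
  rw [h, ← Complex.exp_sum]
  congr 1
  -- At most one of the disjoint sets contains `x`, so `exp(i f) - 1` is additive over them, and the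
  -- characteristic function factorizes.
  have hpt : ∀ x, Complex.exp ((f x : ℂ) * Complex.I) - 1 =
      ∑ i, (A i).indicator (fun _ => Complex.exp (t i * Complex.I) - 1) x := by
    intro x
    by_cases hx : ∃ i, x ∈ A i
    · obtain ⟨i, hi⟩ := hx
      have hn : ∀ j, j ≠ i → x ∉ A j := fun j hj hxj =>
        Set.disjoint_left.1 (hd hj) hxj hi
      rw [Finset.sum_eq_single i (fun j _ hj => Set.indicator_of_notMem (hn j hj) _) (by simp),
        Set.indicator_of_mem hi]
      have : f x = t i := by
        simp only [f]
        rw [Finset.sum_eq_single i (fun j _ hj => Set.indicator_of_notMem (hn j hj) _) (by simp),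
          Set.indicator_of_mem hi]
      rw [this]
    · push Not at hx
      have : f x = 0 := Finset.sum_eq_zero fun i _ => Set.indicator_of_notMem (hx i) _
      rw [this, Finset.sum_eq_zero fun i _ => Set.indicator_of_notMem (hx i) _]
      simp
  simp_rw [hpt]
  rw [integral_finsetSum _ fun i _ => hint Λ i _]
  refine Finset.sum_congr rfl fun i _ => ?_
  rw [integral_indicator_const _ (hA i), Complex.real_smul]
  rfl

lemma charFun_map_count {A : Set ℝ} (hA : MeasurableSet A) (hb : Bornology.IsBounded A) (t : ℝ) :
    charFun ((poissonLaw Λ : Measure LocFinMeasure).map fun m => m.toMeasure.real A) t =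
      Complex.exp ((Λ A).toNNReal * (Complex.exp (t * Complex.I) - 1)) := by
  have h := integral_cexp_counts Λ (k := 1) (A := fun _ => A) (fun _ => hA) (fun _ => hb)
    (fun i j hij => absurd (Subsingleton.elim i j) hij) (fun _ => t)
  simp only [Finset.univ_unique, Finset.sum_singleton, Finset.prod_singleton] at h
  rw [← h, charFun_apply_real, integral_map (measurable_real_apply hA).aemeasurable (by fun_prop)]
  push_cast
  rfl

lemma map_real_count {A : Set ℝ} (hA : MeasurableSet A) (hb : Bornology.IsBounded A) :
    (poissonLaw Λ : Measure LocFinMeasure).map (fun m => m.toMeasure.real A) =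
      (poissonMeasure (Λ A).toNNReal).map (fun n : ℕ => (n : ℝ)) := by
  have := Measure.isProbabilityMeasure_map (μ := (poissonLaw Λ : Measure LocFinMeasure))
    (measurable_real_apply hA).aemeasurable
  refine Measure.ext_of_charFun (funext fun t => ?_)
  rw [charFun_map_count Λ hA hb]
  exact (charFun_map_cast_poissonMeasure _ t).symm

/-- The Poisson process exists. -/
theorem isPoissonProcessLaw_poissonLaw : IsPoissonProcessLaw Λ (poissonLaw Λ) := by
  have hcoe : ∀ (A : Set ℝ), Bornology.IsBounded A → ∀ m : LocFinMeasure,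
      m.toMeasure A = ENNReal.ofReal (m.toMeasure.real A) := fun A hb m => by
    rw [measureReal_def, ENNReal.ofReal_toReal hb.measure_lt_top.ne]
  refine ⟨inferInstance, fun A hA hb => ?_, fun k A hA hb hd => ?_⟩
  · simp_rw [hcoe A hb]
    have h := congrArg (Measure.map ENNReal.ofReal) (map_real_count Λ hA hb)
    rw [Measure.map_map ENNReal.measurable_ofReal (measurable_real_apply hA),
      Measure.map_map ENNReal.measurable_ofReal (by fun_prop)] at h
    refine h.trans ?_
    congr 1
    funext n
    simp
  · have hi : iIndepFun (fun i (m : LocFinMeasure) => m.toMeasure.real (A i))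
        (poissonLaw Λ : Measure LocFinMeasure) := by
      rw [iIndepFun_iff_charFun_pi fun i => (measurable_real_apply (hA i)).aemeasurable]
      intro t
      simp_rw [charFun_map_count Λ (hA _) (hb _)]
      rw [← integral_cexp_counts Λ hA hb hd, charFun_apply, integral_map]
      · simp [PiLp.inner_apply, mul_comm]
      · exact ((PiLp.continuous_toLp 2 _).measurable.comp
          (measurable_pi_lambda _ fun i => measurable_real_apply (hA i))).aemeasurable
      · fun_prop
    have := hi.comp (fun _ => ENNReal.ofReal) (fun _ => ENNReal.measurable_ofReal)
    convert this using 2 with i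
    funext m
    exact hcoe (A i) (hb i) m

end Counts

/-! ### Moments of Poisson processes -/

lemma lintegral_poissonMeasure (r : NNReal) (f : ℕ → ℝ≥0∞) :
    ∫⁻ n, f n ∂(poissonMeasure r) = ∑' n, poissonMeasure r {n} * f n := by
  rw [lintegral_countable']
  simp_rw [mul_comm]

/-- The recursion `(n+1) P(n+1) = r P(n)`: shifting the summation index with it computes the first
two moments. -/
lemma poissonMeasure_succ (r : NNReal) (n : ℕ) :
    poissonMeasure r {n + 1} * (n + 1 : ℕ) = r * poissonMeasure r {n} := by
  rw [poissonMeasure_singleton, poissonMeasure_singleton, ← ENNReal.ofReal_natCast,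
    ← ENNReal.ofReal_coe_nnreal, ← ENNReal.ofReal_mul (by positivity),
    ← ENNReal.ofReal_mul (by positivity)]
  congr 1
  rw [Nat.factorial_succ]
  push_cast
  field_simp
  ring

lemma lintegral_natCast_poissonMeasure (r : NNReal) :
    ∫⁻ n, (n : ℝ≥0∞) ∂(poissonMeasure r) = r := by
  rw [lintegral_poissonMeasure, tsum_eq_zero_add' ENNReal.summable]
  simp_rw [poissonMeasure_succ]
  have h := lintegral_poissonMeasure r (fun _ => 1)
  simp only [mul_one] at h
  rw [ENNReal.tsum_mul_left, ← h]
  simp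

lemma lintegral_natCast_sq_poissonMeasure (r : NNReal) :
    ∫⁻ n, (n : ℝ≥0∞) ^ 2 ∂(poissonMeasure r) = r ^ 2 + r := by
  rw [lintegral_poissonMeasure, tsum_eq_zero_add' ENNReal.summable]
  simp_rw [pow_two ((_ : ℕ) : ℝ≥0∞), ← mul_assoc, poissonMeasure_succ]
  have : ∀ n : ℕ, (r : ℝ≥0∞) * poissonMeasure r {n} * ((n + 1 : ℕ) : ℝ≥0∞) =
      r * (poissonMeasure r {n} * n) + r * (poissonMeasure r {n} * 1) := by
    intro n; push_cast; ring
  simp_rw [this]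
  rw [ENNReal.tsum_add, ENNReal.tsum_mul_left, ENNReal.tsum_mul_left,
    ← lintegral_poissonMeasure r (fun n => (n : ℝ≥0∞)), lintegral_natCast_poissonMeasure,
    ← lintegral_poissonMeasure r (fun _ => 1)]
  simp [pow_two]

lemma IsPoissonProcessLaw.lintegral_comp_count {Λ : Measure ℝ}
    {Q : ProbabilityMeasure LocFinMeasure}
    (h : IsPoissonProcessLaw Λ Q) {A : Set ℝ} (hA : MeasurableSet A)
    (hb : Bornology.IsBounded A) {f : ℝ≥0∞ → ℝ≥0∞} (hf : Measurable f) :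
    ∫⁻ m, f (m.toMeasure A) ∂(Q : Measure LocFinMeasure) =
      ∫⁻ n : ℕ, f n ∂(poissonMeasure (Λ A).toNNReal) := by
  rw [← lintegral_map hf (measurable_apply hA), h.map_count A hA hb,
    lintegral_map hf (by fun_prop)]

lemma IsPoissonProcessLaw.lintegral_count {Λ : Measure ℝ} {Q : ProbabilityMeasure LocFinMeasure}
    (h : IsPoissonProcessLaw Λ Q) {A : Set ℝ} (hA : MeasurableSet A)
    (hb : Bornology.IsBounded A) :
    ∫⁻ m, m.toMeasure A ∂(Q : Measure LocFinMeasure) = Λ A := by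
  have := h.locallyFinite
  rw [h.lintegral_comp_count (f := fun x => x) hA hb measurable_id,
    lintegral_natCast_poissonMeasure, ENNReal.coe_toNNReal hb.measure_lt_top.ne]

lemma IsPoissonProcessLaw.lintegral_count_sq {Λ : Measure ℝ}
    {Q : ProbabilityMeasure LocFinMeasure}
    (h : IsPoissonProcessLaw Λ Q) {A : Set ℝ} (hA : MeasurableSet A)
    (hb : Bornology.IsBounded A) :
    ∫⁻ m, m.toMeasure A ^ 2 ∂(Q : Measure LocFinMeasure) = Λ A ^ 2 + Λ A := by
  have := h.locallyFinite
  rw [h.lintegral_comp_count (f := fun x => x ^ 2) hA hb (by fun_prop),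
    lintegral_natCast_sq_poissonMeasure, ENNReal.coe_toNNReal hb.measure_lt_top.ne]

/-- **Campbell's formula**. -/
lemma IsPoissonProcessLaw.lintegral_lintegral {Λ : Measure ℝ}
    {Q : ProbabilityMeasure LocFinMeasure}
    (h : IsPoissonProcessLaw Λ Q) {f : ℝ → ℝ≥0∞} (hf : Measurable f) :
    ∫⁻ m, ∫⁻ x, f x ∂m.toMeasure ∂(Q : Measure LocFinMeasure) = ∫⁻ x, f x ∂Λ := by
  -- The mean measure of the process agrees with `Λ` on bounded sets, hence everywhere; Campbell's
  -- formula is integration against it.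
  have hbind : Measure.bind (Q : Measure LocFinMeasure) LocFinMeasure.toMeasure = Λ := by
    have key : ∀ n : ℕ, ∀ A : Set ℝ, MeasurableSet A →
        (Measure.bind (Q : Measure LocFinMeasure) LocFinMeasure.toMeasure) (A ∩ Metric.ball 0 n) =
          Λ (A ∩ Metric.ball 0 n) := by
      intro n A hA
      have hAn := hA.inter (measurableSet_ball (x := (0 : ℝ)) (ε := n))
      rw [Measure.bind_apply hAn measurable_toMeasure.aemeasurable]
      exact h.lintegral_count hAn (Metric.isBounded_ball.subset Set.inter_subset_right)
    ext A hA
    have hU : ∀ m : Measure ℝ, m A = ⨆ n : ℕ, m (A ∩ Metric.ball 0 n) := by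
      intro m
      rw [← Monotone.measure_iUnion, ← Set.inter_iUnion, Metric.iUnion_ball_nat, Set.inter_univ]
      exact fun i j hij => Set.inter_subset_inter_right _
        (Metric.ball_subset_ball (by exact_mod_cast hij))
    rw [hU, hU Λ]
    exact iSup_congr fun n => key n A hA
  rw [← Measure.lintegral_bind measurable_toMeasure.aemeasurable (by rw [hbind]; exact hf.aemeasurable),
    hbind]

/-! ### The scale, the centering and the density of a single point -/

lemma scale_pos {M : ℝ} (hM : 0 < M) : 0 < scale M := Real.sqrt_pos.2 (by positivity)

lemma scale_sq {M : ℝ} (hM : 0 < M) : scale M ^ 2 = 1 / M := Real.sq_sqrt (by positivity)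

lemma log_scale {M : ℝ} (hM : 0 < M) : Real.log (scale M) = -(Real.log M) / 2 := by
  rw [scale, Real.log_sqrt (by positivity), one_div, Real.log_inv]

lemma center_nonneg (M : ℝ) : 0 ≤ center M := Real.sqrt_nonneg _

/-- Since `log M ≤ M - 1`, the radicand is nonnegative for every positive `M`, so the square root is
never truncated. -/
lemma center_sq {M : ℝ} (hM : 0 < M) :
    center M ^ 2 = 2 * M * Real.log 2 - Real.log M - Real.log 2 := by
  rw [center, Real.sq_sqrt, log_scale hM]
  · ring
  · rw [log_scale hM]
    have h1 := Real.log_le_sub_one_of_pos hM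
    have h2 := Real.log_two_gt_d9
    have h3 := Real.log_two_lt_d9
    nlinarith

lemma center_sq_le {M : ℝ} (hM : 1 ≤ M) : center M ^ 2 ≤ 2 * M * Real.log 2 := by
  rw [center_sq (by linarith)]
  have := Real.log_nonneg hM
  have := Real.log_pos one_lt_two
  linarith

lemma center_mul_scale_le {M : ℝ} (hM : 1 ≤ M) : center M * scale M ≤ 2 := by
  have hM0 : 0 < M := by linarith
  have h : (center M * scale M) ^ 2 ≤ 2 ^ 2 := by
    rw [mul_pow, scale_sq hM0, mul_one_div, div_le_iff₀ hM0]
    have := center_sq_le hM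
    have h3 := Real.log_two_lt_d9
    nlinarith
  exact abs_le_of_sq_le_sq' h (by norm_num) |>.2

/-- The identity behind the choice of the centering: it makes the expected number of points per unit
length of order one, and it later converts `b²` into `2^(-2M) * exp(a²)` for pairs. -/
lemma two_rpow_mul_scale_mul_exp {M : ℝ} (hM : 0 < M) :
    (2 : ℝ) ^ M * scale M * Real.exp (-(center M ^ 2) / 2) = √2 := by
  rw [center_sq hM, Real.rpow_def_of_pos two_pos, ← Real.exp_log (scale_pos hM), log_scale hM,
    ← Real.exp_log (Real.sqrt_pos.2 (two_pos (α := ℝ))), Real.log_sqrt two_pos.le,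
    ← Real.exp_add, ← Real.exp_add]
  congr 1; ring

/-- The expected number of points per unit length in a cloud of `2 ^ M` standard Gaussians. -/
def pointDensity (M y : ℝ) : ℝ :=
  1 / √Real.pi * Real.exp (-(center M * scale M) * y - scale M ^ 2 * y ^ 2 / 2)

lemma pointDensity_nonneg (M y : ℝ) : 0 ≤ pointDensity M y := by unfold pointDensity; positivity

lemma continuous_pointDensity (M : ℝ) : Continuous (pointDensity M) := by
  unfold pointDensity; fun_prop

lemma pointDensity_eq {M : ℝ} (hM : 0 < M) (y : ℝ) :
    (2 : ℝ) ^ M * (scale M * gaussianPDFReal 0 1 (scale M * y + center M)) = pointDensity M y := by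
  rw [gaussianPDFReal, pointDensity]
  have h := two_rpow_mul_scale_mul_exp hM
  have e : -(scale M * y + center M - 0) ^ 2 / (2 * ((1 : NNReal) : ℝ)) =
      -(center M ^ 2) / 2 + (-(center M * scale M) * y - scale M ^ 2 * y ^ 2 / 2) := by
    rw [NNReal.coe_one]; ring
  rw [e, Real.exp_add, NNReal.coe_one, mul_one, Real.sqrt_mul (by norm_num), mul_inv]
  have h2 : √2 * (√2 : ℝ)⁻¹ = 1 := mul_inv_cancel₀ (by positivity)
  calc _ = ((2 : ℝ) ^ M * scale M * Real.exp (-(center M ^ 2) / 2)) * (√2)⁻¹ * (√Real.pi)⁻¹ *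
      Real.exp (-(center M * scale M) * y - scale M ^ 2 * y ^ 2 / 2) := by ring
    _ = _ := by rw [h, h2]; ring

lemma two_rpow_smul_integral_gaussian {E : Type*} [NormedAddCommGroup E] [NormedSpace ℝ E]
    {M : ℝ} (hM : 0 < M) (g : ℝ → E) :
    (2 : ℝ) ^ M • ∫ x, g ((x - center M) / scale M) ∂(gaussianReal 0 1) =
      ∫ y, pointDensity M y • g y := by
  have hb := scale_pos hM
  rw [integral_gaussianReal_eq_integral_smul one_ne_zero]
  have h1 := integral_add_right_eq_self (μ := (volume : Measure ℝ))
    (fun x => gaussianPDFReal 0 1 x • g ((x - center M) / scale M)) (center M)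
  have h2 := Measure.integral_comp_mul_left
    (fun x => gaussianPDFReal 0 1 (x + center M) • g ((x + center M - center M) / scale M)) (scale M)
  rw [h1, abs_of_pos (inv_pos.2 hb)] at h2
  have h3 : ∫ x, gaussianPDFReal 0 1 x • g ((x - center M) / scale M) =
      scale M • ∫ x, gaussianPDFReal 0 1 (scale M * x + center M) •
        g ((scale M * x + center M - center M) / scale M) := by
    rw [h2, smul_smul, mul_inv_cancel₀ hb.ne', one_smul]
  rw [h3, ← integral_smul, ← integral_smul]
  refine integral_congr_ae (.of_forall fun y => ?_)
  simp only [smul_smul, ← pointDensity_eq hM]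
  congr 2
  field_simp
  ring

lemma tendsto_log_add_div_atTop :
    Tendsto (fun M : ℝ => (Real.log M + Real.log 2) / M) atTop (𝓝 0) := by
  have h1 := Real.isLittleO_log_id_atTop.tendsto_div_nhds_zero
  have h2 : Tendsto (fun M : ℝ => Real.log 2 / M) atTop (𝓝 0) := tendsto_const_nhds.div_atTop tendsto_id
  simpa [add_div] using h1.add h2

lemma tendsto_center_mul_scale :
    Tendsto (fun M => center M * scale M) atTop (𝓝 √(2 * Real.log 2)) := by
  have h : Tendsto (fun M : ℝ => √(2 * Real.log 2 - (Real.log M + Real.log 2) / M)) atTop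
      (𝓝 √(2 * Real.log 2)) := by
    have := (tendsto_const_nhds (x := 2 * Real.log 2)).sub tendsto_log_add_div_atTop
    rw [sub_zero] at this
    exact (Real.continuous_sqrt.tendsto _).comp this
  refine h.congr' ?_
  filter_upwards [eventually_gt_atTop 0] with M hM
  rw [← Real.sqrt_sq (mul_nonneg (center_nonneg M) (scale_pos hM).le), mul_pow, scale_sq hM,
    center_sq hM]
  congr 1
  field_simp
  ring

lemma tendsto_scale : Tendsto scale atTop (𝓝 0) := by
  have h : Tendsto (fun M : ℝ => 1 / M) atTop (𝓝 0) := tendsto_const_nhds.div_atTop tendsto_id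
  have := (Real.continuous_sqrt.tendsto 0).comp h
  rwa [Real.sqrt_zero] at this

lemma tendsto_center_atTop : Tendsto center atTop atTop := by
  have h := tendsto_center_mul_scale
  have hpos : 0 < √(2 * Real.log 2) := Real.sqrt_pos.2 (by have := Real.log_pos one_lt_two; linarith)
  have h2 : Tendsto (fun M => (scale M)⁻¹) atTop atTop := by
    refine Tendsto.inv_tendsto_nhdsGT_zero ?_
    exact tendsto_nhdsWithin_iff.2 ⟨tendsto_scale, by
      filter_upwards [eventually_gt_atTop 0] with M hM using scale_pos hM⟩
  refine (h.pos_mul_atTop hpos h2).congr' ?_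
  filter_upwards [eventually_gt_atTop 0] with M hM
  have := (scale_pos hM).ne'
  field_simp

lemma pointDensity_le {M : ℝ} (hM : 1 ≤ M) {s y : ℝ} (hy : |y| ≤ s) :
    pointDensity M y ≤ Real.exp (2 * s) := by
  have h1 : 1 / √Real.pi ≤ 1 := by
    rw [div_le_one (by positivity), Real.one_le_sqrt]
    linarith [Real.pi_gt_three]
  have h2 := center_mul_scale_le hM
  have h3 : 0 ≤ center M * scale M := mul_nonneg (center_nonneg M) (scale_pos (by linarith)).le
  have h4 : -(center M * scale M) * y - scale M ^ 2 * y ^ 2 / 2 ≤ 2 * s := by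
    have : -(center M * scale M) * y ≤ (center M * scale M) * |y| := by
      nlinarith [neg_abs_le y]
    have : (center M * scale M) * |y| ≤ 2 * s := by
      have := abs_nonneg y
      nlinarith
    nlinarith [sq_nonneg (scale M * y)]
  calc pointDensity M y ≤ 1 * Real.exp (2 * s) := by unfold pointDensity; gcongr
    _ = _ := one_mul _

/-- The density of the limiting intensity. -/
def limitDensity (y : ℝ) : ℝ := 1 / √Real.pi * Real.exp (-y * √(2 * Real.log 2))

lemma limitDensity_nonneg (y : ℝ) : 0 ≤ limitDensity y := by unfold limitDensity; positivity

lemma continuous_limitDensity : Continuous limitDensity := by unfold limitDensity; fun_prop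

lemma tendsto_pointDensity (y : ℝ) :
    Tendsto (fun M => pointDensity M y) atTop (𝓝 (limitDensity y)) := by
  have h : Tendsto (fun M => -(center M * scale M) * y - scale M ^ 2 * y ^ 2 / 2) atTop
      (𝓝 (-√(2 * Real.log 2) * y - 0 ^ 2 * y ^ 2 / 2)) :=
    ((tendsto_center_mul_scale.neg).mul_const y).sub
      (((tendsto_scale.pow 2).mul_const _).div_const 2)
  have h2 := ((Real.continuous_exp.tendsto _).comp h).const_mul (1 / √Real.pi)
  have e : limitDensity y =
      1 / √Real.pi * Real.exp (-√(2 * Real.log 2) * y - 0 ^ 2 * y ^ 2 / 2) := by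
    rw [limitDensity]; congr 2; ring
  rw [e]
  exact h2

instance : IsLocallyFiniteMeasure intensity := by
  unfold intensity
  exact IsLocallyFiniteMeasure.withDensity_ofReal continuous_limitDensity

lemma integral_intensity {E : Type*} [NormedAddCommGroup E] [NormedSpace ℝ E] (g : ℝ → E) :
    ∫ y, g y ∂intensity = ∫ y, limitDensity y • g y := by
  have := integral_withDensity_eq_integral_toReal_smul (μ := (volume : Measure ℝ))
    (f := fun y => ENNReal.ofReal (limitDensity y))
    (continuous_limitDensity.measurable.ennreal_ofReal) (.of_forall fun _ => ENNReal.ofReal_lt_top) g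
  simp_rw [ENNReal.toReal_ofReal (limitDensity_nonneg _)] at this
  exact this

/-- Convergence of the expected number of points to the limiting intensity. -/
lemma tendsto_integral_pointDensity {E : Type*} [NormedAddCommGroup E] [NormedSpace ℝ E]
    {g : ℝ → E} (hg : AEStronglyMeasurable g) {C s : ℝ} (hC : ∀ y, ‖g y‖ ≤ C)
    (hs : ∀ y, s < |y| → g y = 0) :
    Tendsto (fun M => ∫ y, pointDensity M y • g y) atTop (𝓝 (∫ y, g y ∂intensity)) := by
  rw [integral_intensity]
  refine tendsto_integral_filter_of_dominated_convergence
    ((Set.Icc (-s) s).indicator fun _ => Real.exp (2 * s) * C) ?_ ?_ ?_ ?_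
  · exact .of_forall fun M => (continuous_pointDensity M).aestronglyMeasurable.smul hg
  · filter_upwards [eventually_ge_atTop 1] with M hM
    refine .of_forall fun y => ?_
    by_cases hy : |y| ≤ s
    · rw [Set.indicator_of_mem (show y ∈ Set.Icc (-s) s from abs_le.1 hy), norm_smul,
        Real.norm_of_nonneg (pointDensity_nonneg M y)]
      exact mul_le_mul (pointDensity_le hM hy) (hC y) (norm_nonneg _) (Real.exp_pos _).le
    · rw [hs y (not_le.1 hy), smul_zero, norm_zero]
      refine Set.indicator_nonneg (fun _ _ => ?_) _
      exact mul_nonneg (Real.exp_pos _).le ((norm_nonneg _).trans (hC y))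
  · exact (integrable_indicator_iff measurableSet_Icc).2
      (integrableOn_const (by rw [Real.volume_Icc]; exact ENNReal.ofReal_ne_top))
  · exact .of_forall fun y => (tendsto_pointDensity y).smul_const _

/-! ### Two correlated Gaussian variables -/

/-- In the variables `x + y` and `x - y` the exponent of the bivariate density is diagonal, with
coefficients `1/(4(1+r))` and `1/(4(1-r))`. Dropping the second square and using `x + y ≥ 2α` leaves
`α²/(1+r)`, which is at least `α²(1-|r|)`. -/
lemma gaussianPDFReal_mul_le {r r₀ α x y : ℝ} (hr : |r| ≤ r₀) (hr₀ : r₀ < 1) (hα : 0 ≤ α)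
    (hx : α ≤ x) (hy : α ≤ y) :
    gaussianPDFReal 0 1 x * gaussianPDFReal (r * x) (1 - r ^ 2).toNNReal y ≤
      1 / √(1 - r₀ ^ 2) * Real.exp (-(α ^ 2 * (1 - |r|))) := by
  have hr1 : |r| < 1 := hr.trans_lt hr₀
  have hv₀ : 0 < 1 - r₀ ^ 2 := by nlinarith [abs_nonneg r]
  have hv : 1 - r₀ ^ 2 ≤ 1 - r ^ 2 := by nlinarith [abs_nonneg r, sq_abs r]
  have hv1 : 0 < 1 - r ^ 2 := by linarith
  obtain ⟨hl, hu⟩ := abs_lt.1 hr1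
  rw [gaussianPDFReal, gaussianPDFReal, Real.coe_toNNReal _ hv1.le, NNReal.coe_one]
  have hexp : -(x - 0) ^ 2 / (2 * 1) + -(y - r * x) ^ 2 / (2 * (1 - r ^ 2)) ≤
      -(α ^ 2 * (1 - |r|)) := by
    have e : -(x - 0) ^ 2 / (2 * 1) + -(y - r * x) ^ 2 / (2 * (1 - r ^ 2)) =
        -((x + y) ^ 2 / (4 * (1 + r)) + (x - y) ^ 2 / (4 * (1 - r))) := by
      have h1 : 1 + r ≠ 0 := by linarith
      have h2 : 1 - r ≠ 0 := by linarith
      have h3 : 1 - r ^ 2 = (1 - r) * (1 + r) := by ring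
      rw [h3]
      field_simp
      ring
    rw [e, neg_le_neg_iff]
    have h1 : 0 ≤ (x - y) ^ 2 / (4 * (1 - r)) := div_nonneg (sq_nonneg _) (by linarith)
    have h2 : α ^ 2 * (1 - |r|) ≤ (x + y) ^ 2 / (4 * (1 + r)) := by
      rw [le_div_iff₀ (by linarith)]
      have h4 : (2 * α) ^ 2 ≤ (x + y) ^ 2 := by gcongr; linarith
      have h5 : (1 - |r|) * (1 + r) ≤ 1 := by nlinarith [le_abs_self r, abs_nonneg r]
      have : α ^ 2 * ((1 - |r|) * (1 + r)) ≤ α ^ 2 * 1 := by gcongr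
      nlinarith
    linarith
  have hpi : 1 ≤ 2 * Real.pi := by linarith [Real.pi_gt_three]
  have hc1 : (√(2 * Real.pi * 1))⁻¹ ≤ 1 := by
    refine inv_le_one_of_one_le₀ ?_
    rw [Real.one_le_sqrt]; linarith
  have hc2 : (√(2 * Real.pi * (1 - r ^ 2)))⁻¹ ≤ 1 / √(1 - r₀ ^ 2) := by
    rw [one_div]
    refine inv_anti₀ (Real.sqrt_pos.2 hv₀) (Real.sqrt_le_sqrt ?_)
    nlinarith
  calc _ = (√(2 * Real.pi * 1))⁻¹ * (√(2 * Real.pi * (1 - r ^ 2)))⁻¹ *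
        Real.exp (-(x - 0) ^ 2 / (2 * 1) + -(y - r * x) ^ 2 / (2 * (1 - r ^ 2))) := by
        rw [Real.exp_add]; ring
    _ ≤ 1 * (1 / √(1 - r₀ ^ 2)) * Real.exp (-(α ^ 2 * (1 - |r|))) := by gcongr
    _ = _ := by rw [one_mul]

lemma measure_pair_le {r r₀ α β : ℝ} (hr : |r| ≤ r₀) (hr₀ : r₀ < 1) (hα : 0 ≤ α) (hαβ : α ≤ β) :
    ((gaussianReal 0 1).prod (gaussianReal 0 (1 - r ^ 2).toNNReal)).real
        {p | p.1 ∈ Set.Icc α β ∧ p.2 + r * p.1 ∈ Set.Icc α β} ≤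
      (β - α) ^ 2 * (1 / √(1 - r₀ ^ 2) * Real.exp (-(α ^ 2 * (1 - |r|)))) := by
  set K := 1 / √(1 - r₀ ^ 2) * Real.exp (-(α ^ 2 * (1 - |r|))) with hK
  have hK0 : 0 ≤ K := by positivity
  have hv : (1 - r ^ 2).toNNReal ≠ 0 := by
    have : 0 < 1 - r ^ 2 := by
      have := hr.trans_lt hr₀
      nlinarith [abs_nonneg r, sq_abs r]
    exact (Real.toNNReal_pos.2 this).ne'
  have hS : MeasurableSet {p : ℝ × ℝ | p.1 ∈ Set.Icc α β ∧ p.2 + r * p.1 ∈ Set.Icc α β} :=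
    (measurable_fst measurableSet_Icc).inter
      ((measurable_snd.add (measurable_fst.const_mul r)) measurableSet_Icc)
  refine ENNReal.toReal_le_of_le_ofReal (by have := sub_nonneg.2 hαβ; positivity) ?_
  rw [Measure.prod_apply hS, gaussianReal_of_var_ne_zero 0 one_ne_zero,
    lintegral_withDensity_eq_lintegral_mul _ (measurable_gaussianPDF 0 1)
      (measurable_measure_prodMk_left hS)]
  have key : ∀ x, (gaussianPDF 0 1 * fun x => (gaussianReal 0 (1 - r ^ 2).toNNReal)
      (Prod.mk x ⁻¹' {p : ℝ × ℝ | p.1 ∈ Set.Icc α β ∧ p.2 + r * p.1 ∈ Set.Icc α β})) x ≤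
      (Set.Icc α β).indicator (fun _ => ENNReal.ofReal K * ENNReal.ofReal (β - α)) x := by
    intro x
    rw [Pi.mul_apply]
    by_cases hx : x ∈ Set.Icc α β
    · rw [Set.indicator_of_mem hx]
      have e : Prod.mk x ⁻¹' {p : ℝ × ℝ | p.1 ∈ Set.Icc α β ∧ p.2 + r * p.1 ∈ Set.Icc α β} =
          (fun g => g + r * x) ⁻¹' Set.Icc α β := by
        ext g
        simp only [Set.mem_preimage, Set.mem_ofPred_eq]
        exact and_iff_right hx
      rw [e, ← Measure.map_apply (measurable_add_const _) measurableSet_Icc,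
        gaussianReal_map_add_const, zero_add, gaussianReal_apply _ hv,
        ← lintegral_const_mul _ (measurable_gaussianPDF _ _)]
      calc ∫⁻ y in Set.Icc α β, gaussianPDF 0 1 x * gaussianPDF (r * x) (1 - r ^ 2).toNNReal y
          ≤ ∫⁻ y in Set.Icc α β, ENNReal.ofReal K := by
            refine setLIntegral_mono measurable_const fun y hy => ?_
            rw [gaussianPDF, gaussianPDF, ← ENNReal.ofReal_mul (gaussianPDFReal_nonneg _ _ _)]
            exact ENNReal.ofReal_le_ofReal (gaussianPDFReal_mul_le hr hr₀ hα hx.1 hy.1)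
        _ = _ := by rw [setLIntegral_const, Real.volume_Icc]
    · have e : Prod.mk x ⁻¹' {p : ℝ × ℝ | p.1 ∈ Set.Icc α β ∧ p.2 + r * p.1 ∈ Set.Icc α β} =
          ∅ := by
        ext g
        simp only [Set.mem_preimage, Set.mem_ofPred_eq, Set.mem_empty_iff_false, iff_false]
        exact fun h => hx h.1
      rw [e, measure_empty, mul_zero]
      exact zero_le
  refine (lintegral_mono key).trans ?_
  rw [lintegral_indicator measurableSet_Icc, setLIntegral_const, Real.volume_Icc, mul_assoc,
    ← ENNReal.ofReal_mul (sub_nonneg.2 hαβ), ← ENNReal.ofReal_mul hK0]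
  refine ENNReal.ofReal_le_ofReal (le_of_eq (by ring))

/-- Independent points would give order `2^(-2M)`. Correlation costs at most about `exp(a²|r|)`, and
`a² ≤ 2M log 2`. The condition `b s ≤ a` keeps the window on the positive half-line, as the density
bound requires. -/
lemma exists_pair_bound {s r₀ : ℝ} (hs : 0 ≤ s) (hr₀ : r₀ < 1) : ∃ C : ℝ, 0 ≤ C ∧
    ∀ M : ℝ, 1 ≤ M → scale M * s ≤ center M → ∀ r : ℝ, |r| ≤ r₀ →
      ((gaussianReal 0 1).prod (gaussianReal 0 (1 - r ^ 2).toNNReal)).real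
        {p | |(p.1 - center M) / scale M| ≤ s ∧ |(p.2 + r * p.1 - center M) / scale M| ≤ s} ≤
      C * ((2 : ℝ) ^ M)⁻¹ ^ 2 * Real.exp (2 * Real.log 2 * (M * |r|)) := by
  refine ⟨8 * s ^ 2 * (1 / √(1 - r₀ ^ 2)) * Real.exp (4 * s), by positivity, ?_⟩
  intro M hM hMs r hr
  have hM0 : 0 < M := by linarith
  have hb := scale_pos hM0
  set a := center M with ha
  set b := scale M with hbdef
  have hset : {p : ℝ × ℝ | |(p.1 - a) / b| ≤ s ∧ |(p.2 + r * p.1 - a) / b| ≤ s} =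
      {p : ℝ × ℝ | p.1 ∈ Set.Icc (a - b * s) (a + b * s) ∧
        p.2 + r * p.1 ∈ Set.Icc (a - b * s) (a + b * s)} := by
    have h : ∀ x : ℝ, |(x - a) / b| ≤ s ↔ x ∈ Set.Icc (a - b * s) (a + b * s) := by
      intro x
      rw [abs_div, abs_of_pos hb, div_le_iff₀ hb, abs_le, Set.mem_Icc]
      constructor <;> rintro ⟨h1, h2⟩ <;> constructor <;> linarith
    ext p
    simp only [Set.mem_ofPred_eq, h]
  rw [hset]
  have hbs : 0 ≤ b * s := by positivity
  refine (measure_pair_le hr hr₀ (by linarith) (by linarith)).trans ?_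
  have h2 := two_rpow_mul_scale_mul_exp hM0
  -- The window square has area `4 s² b²`. Rewriting `b²` this way cancels the leading `exp(-a²)` of
  -- the density bound.
  have hsq : b ^ 2 = 2 * ((2 : ℝ) ^ M)⁻¹ ^ 2 * Real.exp (a ^ 2) := by
    have h3 : ((2 : ℝ) ^ M) ^ 2 * b ^ 2 * Real.exp (-(a ^ 2)) = 2 := by
      have := congrArg (fun x => x ^ 2) h2
      simp only [mul_pow, Real.sq_sqrt two_pos.le, ← Real.exp_nat_mul] at this
      have e : -(a ^ 2) = ((2 : ℕ) : ℝ) * (-(center M ^ 2) / 2) := by rw [ha]; push_cast; ring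
      rw [e]
      exact this
    have h4 : (0 : ℝ) < 2 ^ M := by positivity
    rw [Real.exp_neg] at h3
    field_simp at h3 ⊢
    linarith
  have hab := center_mul_scale_le hM
  have ha2 := center_sq_le hM
  have hr0 := abs_nonneg r
  have hexp : a ^ 2 + -((a - b * s) ^ 2 * (1 - |r|)) ≤ 4 * s + 2 * Real.log 2 * (M * |r|) := by
    have e1 : (a - b * s) ^ 2 * |r| ≤ a ^ 2 * |r| := by
      refine mul_le_mul_of_nonneg_right ?_ hr0
      exact pow_le_pow_left₀ (by linarith) (by linarith) 2
    have e2 : a ^ 2 * |r| ≤ 2 * M * Real.log 2 * |r| := by gcongr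
    have e3 : a * b * s ≤ 2 * s := by gcongr
    nlinarith [sq_nonneg (b * s)]
  calc _ = 8 * s ^ 2 * (1 / √(1 - r₀ ^ 2)) * ((2 : ℝ) ^ M)⁻¹ ^ 2 *
        Real.exp (a ^ 2 + -((a - b * s) ^ 2 * (1 - |r|))) := by
        have e : (a + b * s - (a - b * s)) ^ 2 = 4 * s ^ 2 * b ^ 2 := by ring
        rw [e, hsq, Real.exp_add]; ring
    _ ≤ 8 * s ^ 2 * (1 / √(1 - r₀ ^ 2)) * ((2 : ℝ) ^ M)⁻¹ ^ 2 *
        Real.exp (4 * s + 2 * Real.log 2 * (M * |r|)) := by gcongr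
    _ = _ := by rw [Real.exp_add]; ring

/-! ### Standardized Gaussian fields and regression on one coordinate -/

/-- A centered Gaussian field with unit variances and covariances `c`. -/
structure IsUnitGaussian {ι Ω : Type*} [MeasurableSpace Ω] (P : Measure Ω) (c : ι → ι → ℝ)
    (H : ι → Ω → ℝ) : Prop where
  gaussian : IsGaussianProcess H P
  centered : ∀ i, ∫ ω, H i ω ∂P = 0
  cov_eq : ∀ i j, cov[H i, H j; P] = c i j
  unit : ∀ i, c i i = 1

/-- The part of `H j` which is independent of `H i`. -/
def resid {ι Ω : Type*} (c : ι → ι → ℝ) (H : ι → Ω → ℝ) (i j : ι) (ω : Ω) : ℝ :=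
  H j ω - c j i * H i ω

lemma eq_resid_add {ι Ω : Type*} (c : ι → ι → ℝ) (H : ι → Ω → ℝ) (i j : ι) (ω : Ω) :
    H j ω = resid c H i j ω + c j i * H i ω := by
  unfold resid; ring

/-- The law of the residuals of the regression on `H i`. -/
def residLaw {ι Ω : Type*} [MeasurableSpace Ω] (P : Measure Ω) (c : ι → ι → ℝ) (H : ι → Ω → ℝ)
    (i : ι) : Measure (ι → ℝ) := P.map fun ω j => resid c H i j ω

namespace IsUnitGaussian

variable {ι Ω : Type*} [MeasurableSpace Ω] {P : Measure Ω} {c : ι → ι → ℝ} {H : ι → Ω → ℝ}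

lemma symm (h : IsUnitGaussian P c H) (i j : ι) : c i j = c j i := by
  rw [← h.cov_eq, ← h.cov_eq, covariance_comm]

lemma aemeasurable (h : IsUnitGaussian P c H) (i : ι) : AEMeasurable (H i) P :=
  h.gaussian.aemeasurable i

lemma memLp (h : IsUnitGaussian P c H) (i : ι) : MemLp (H i) 2 P :=
  (h.gaussian.hasGaussianLaw_eval i).memLp_two

lemma map_eq (h : IsUnitGaussian P c H) (i : ι) : P.map (H i) = gaussianReal 0 1 := by
  rw [(h.gaussian.hasGaussianLaw_eval i).map_eq_gaussianReal, h.centered i,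
    ← covariance_self (h.aemeasurable i), h.cov_eq, h.unit, Real.toNNReal_one]

lemma aemeasurable_resid (h : IsUnitGaussian P c H) (i j : ι) :
    AEMeasurable (resid c H i j) P :=
  (h.aemeasurable j).sub ((h.aemeasurable i).const_mul _)

lemma covariance_resid (h : IsUnitGaussian P c H) (i j : ι) :
    cov[resid c H i j, H i; P] = 0 := by
  have := h.gaussian.isProbabilityMeasure
  unfold resid
  rw [covariance_fun_sub_left (h.memLp j) ((h.memLp i).const_mul _) (h.memLp i),
    covariance_const_mul_left, h.cov_eq, h.cov_eq, h.unit]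
  ring

lemma isGaussianProcess_resid (h : IsUnitGaussian P c H) (i : ι) :
    IsGaussianProcess (Sum.elim (fun j => resid c H i j) fun _ : Unit => H i) P := by
  classical
  refine IsGaussianProcess.of_isGaussianProcess h.gaussian fun s => ⟨match s with | .inl j => {j, i} | .inr _ => {i}, ?_⟩
  cases s with
  | inl j =>
    refine ⟨ContinuousLinearMap.proj ⟨j, by simp⟩ -
      c j i • ContinuousLinearMap.proj ⟨i, by simp⟩, fun ω => ?_⟩
    simp [resid]
  | inr u =>
    exact ⟨ContinuousLinearMap.proj ⟨i, by simp⟩, fun ω => by simp⟩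

/-- The residuals and `H i` are jointly Gaussian and uncorrelated, hence independent. This turns
every later computation into an integral over a product measure. -/
lemma indepFun_resid (h : IsUnitGaussian P c H) (i : ι) :
    IndepFun (fun ω j => resid c H i j ω) (H i) P := by
  have := (h.isGaussianProcess_resid i).indepFun_of_covariance_eq_zero
    (h.aemeasurable_resid i) (fun _ => h.aemeasurable i) fun j _ => h.covariance_resid i j
  exact this.comp measurable_id (measurable_pi_apply ())

lemma variance_resid (h : IsUnitGaussian P c H) (i j : ι) :
    Var[resid c H i j; P] = 1 - c j i ^ 2 := by
  have := h.gaussian.isProbabilityMeasure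
  have h1 := h.covariance_resid i j
  rw [← covariance_self (h.aemeasurable_resid i j)]
  have hm : MemLp (resid c H i j) 2 P := (h.memLp j).sub ((h.memLp i).const_mul _)
  have h2 : cov[resid c H i j, resid c H i j; P] =
      cov[H j, resid c H i j; P] - c j i * cov[H i, resid c H i j; P] := by
    conv_lhs => enter [1]; unfold resid
    rw [covariance_fun_sub_left (h.memLp j) ((h.memLp i).const_mul _) hm,
      covariance_const_mul_left]
  rw [h2, covariance_comm (H i), h1, covariance_comm (H j)]
  unfold resid
  rw [covariance_fun_sub_left (h.memLp j) ((h.memLp i).const_mul _) (h.memLp j),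
    covariance_const_mul_left, h.cov_eq, h.cov_eq, h.unit, h.symm i j]
  ring

lemma integral_resid (h : IsUnitGaussian P c H) (i j : ι) :
    ∫ ω, resid c H i j ω ∂P = 0 := by
  have := h.gaussian.isProbabilityMeasure
  unfold resid
  rw [integral_sub ((h.memLp j).integrable one_le_two)
    (((h.memLp i).integrable one_le_two).const_mul _), integral_const_mul, h.centered, h.centered]
  ring

lemma map_resid (h : IsUnitGaussian P c H) (i j : ι) :
    P.map (resid c H i j) = gaussianReal 0 (1 - c j i ^ 2).toNNReal := by
  have h1 : HasGaussianLaw (resid c H i j) P :=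
    (h.isGaussianProcess_resid i).hasGaussianLaw_eval (.inl j)
  rw [h1.map_eq_gaussianReal, h.integral_resid, h.variance_resid]

variable [Countable ι]

lemma aemeasurable_resid_pi (h : IsUnitGaussian P c H) (i : ι) :
    AEMeasurable (fun ω j => resid c H i j ω) P :=
  aemeasurable_pi_lambda _ fun j => h.aemeasurable_resid i j

lemma isProbabilityMeasure_residLaw (h : IsUnitGaussian P c H) (i : ι) :
    IsProbabilityMeasure (residLaw P c H i) := by
  have := h.gaussian.isProbabilityMeasure
  exact Measure.isProbabilityMeasure_map (h.aemeasurable_resid_pi i)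

lemma residLaw_map_eval (h : IsUnitGaussian P c H) (i j : ι) :
    (residLaw P c H i).map (fun x => x j) = gaussianReal 0 (1 - c j i ^ 2).toNNReal := by
  rw [← h.map_resid i j, residLaw, AEMeasurable.map_map_of_aemeasurable
    (measurable_pi_apply j).aemeasurable (h.aemeasurable_resid_pi i)]
  rfl

lemma map_prodMk (h : IsUnitGaussian P c H) (i : ι) :
    P.map (fun ω => (H i ω, fun j => resid c H i j ω)) =
      (gaussianReal 0 1).prod (residLaw P c H i) := by
  have := h.gaussian.isProbabilityMeasure
  have hi := (h.indepFun_resid i).symm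
  rw [indepFun_iff_map_prod_eq_prod_map_map (h.aemeasurable i) (h.aemeasurable_resid_pi i)] at hi
  rw [hi, h.map_eq]
  rfl

/-- Expectations of functions of the field as integrals over a coordinate and the residuals. -/
lemma integral_eq (h : IsUnitGaussian P c H) (i : ι) {E : Type*} [NormedAddCommGroup E]
    [NormedSpace ℝ E] {Φ : ℝ × (ι → ℝ) → E} (hΦ : StronglyMeasurable Φ) :
    ∫ ω, Φ (H i ω, fun j => resid c H i j ω) ∂P =
      ∫ p, Φ p ∂((gaussianReal 0 1).prod (residLaw P c H i)) := by
  rw [← h.map_prodMk i, integral_map ((h.aemeasurable i).prodMk (h.aemeasurable_resid_pi i))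
    hΦ.aestronglyMeasurable]

end IsUnitGaussian

/-! ### Decoupling of one coordinate of a Gaussian field -/

lemma norm_cexp_sub_cexp_le (a b : ℝ) :
    ‖Complex.exp (a * Complex.I) - Complex.exp (b * Complex.I)‖ ≤ |a - b| := by
  have h : Complex.exp (a * Complex.I) - Complex.exp (b * Complex.I) =
      Complex.exp (b * Complex.I) * (Complex.exp (Complex.I * ((a - b : ℝ) : ℂ)) - 1) := by
    rw [mul_sub, ← Complex.exp_add, mul_one]
    congr 2
    push_cast; ring
  rw [h, norm_mul, norm_cexp_ofReal_mul_I, one_mul]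
  exact Real.norm_exp_I_mul_ofReal_sub_one_le

lemma measurable_shift {ι : Type*} (j : ι) (r : ℝ) {g : ℝ → ℝ} (hg : Measurable g) :
    Measurable fun p : ℝ × (ι → ℝ) => g (p.2 j + r * p.1) :=
  hg.comp (((measurable_pi_apply j).comp measurable_snd).add (measurable_fst.const_mul r))

section Decoupling

variable {ι Ω : Type*} [Countable ι] [MeasurableSpace Ω] {P : Measure Ω} {c : ι → ι → ℝ}
  {H : ι → Ω → ℝ}

/-- The joint law of a coordinate, an independent copy of it and the residuals. -/
def copyLaw (P : Measure Ω) (c : ι → ι → ℝ) (H : ι → Ω → ℝ) (i : ι) :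
    Measure (ℝ × ℝ × (ι → ℝ)) :=
  (gaussianReal 0 1).prod ((gaussianReal 0 1).prod (residLaw P c H i))

/-- The mean effect on the coordinate `j` of resampling the coordinate `i`, on the support of
`g (H i)`. -/
def resampleGap (P : Measure Ω) (c : ι → ι → ℝ) (H : ι → Ω → ℝ) (g : ℝ → ℝ) (i j : ι) : ℝ :=
  ∫ p, |g p.1| * |g (p.2.2 j + c j i * p.1) - g (p.2.2 j + c j i * p.2.1)| ∂(copyLaw P c H i)

lemma isProbabilityMeasure_copyLaw (h : IsUnitGaussian P c H) (i : ι) :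
    IsProbabilityMeasure (copyLaw P c H i) := by
  have := h.isProbabilityMeasure_residLaw i
  unfold copyLaw
  infer_instance

lemma measurePreserving_forget (h : IsUnitGaussian P c H) (i : ι) :
    MeasurePreserving (fun p : ℝ × ℝ × (ι → ℝ) => (p.1, p.2.2)) (copyLaw P c H i)
      ((gaussianReal 0 1).prod (residLaw P c H i)) := by
  have := h.isProbabilityMeasure_residLaw i
  exact (MeasurePreserving.id _).prod measurePreserving_snd

/-- On the space of `copyLaw` both quantities become expectations of `k(x)` times a phase: the first
phase uses `x` itself in the other coordinates, the second is the complete phase built on the copy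
`x'`. The phases differ by `g(x')` and by the resampling effects, while `|k(x)| = |g(x)|`; the term
`g(x')` yields the squared mean of `|g|`. -/
lemma norm_decouple_le (h : IsUnitGaussian P c H) (S : Finset ι) [DecidableEq ι] {g : ℝ → ℝ}
    (hg : Measurable g) {B : ℝ} (hB : ∀ x, |g x| ≤ B) {θ : ℝ} (hθ : |θ| ≤ 1) {i : ι} (hi : i ∈ S) :
    ‖∫ ω, (g (H i ω) : ℂ) * Complex.exp ((θ * ∑ j ∈ S, g (H j ω) : ℝ) * Complex.I) ∂P -
      (∫ x, (g x : ℂ) * Complex.exp ((θ * g x : ℝ) * Complex.I) ∂(gaussianReal 0 1)) *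
        ∫ ω, Complex.exp ((θ * ∑ j ∈ S, g (H j ω) : ℝ) * Complex.I) ∂P‖ ≤
      (∫ x, |g x| ∂(gaussianReal 0 1)) ^ 2 + ∑ j ∈ S.erase i, resampleGap P c H g i j := by
  have := h.isProbabilityMeasure_residLaw i
  have := isProbabilityMeasure_copyLaw h i
  set γ := gaussianReal 0 1 with hγ
  set ν := residLaw P c H i with hν
  set ρ := copyLaw P c H i with hρ
  let T : ℝ × (ι → ℝ) → ℝ := fun p => ∑ j ∈ S.erase i, g (p.2 j + c j i * p.1)
  have hT : Measurable T := Finset.measurable_fun_sum _ fun j _ => measurable_shift j (c j i) hg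
  have hsum : ∀ ω, ∑ j ∈ S, g (H j ω) =
      g (H i ω) + T (H i ω, fun j => resid c H i j ω) := by
    intro ω
    rw [← Finset.add_sum_erase S _ hi]
    congr 1
    refine Finset.sum_congr rfl fun j _ => ?_
    rw [← eq_resid_add]
  let k : ℝ → ℂ := fun x => (g x : ℂ) * Complex.exp ((θ * g x : ℝ) * Complex.I)
  have hk : Measurable k := by
    refine (Complex.measurable_ofReal.comp hg).mul ?_
    exact ((Complex.measurable_ofReal.comp (hg.const_mul θ)).mul_const _).cexp
  have hmT : Measurable fun p : ℝ × (ι → ℝ) => Complex.exp ((θ * T p : ℝ) * Complex.I) :=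
    ((Complex.measurable_ofReal.comp (hT.const_mul θ)).mul_const _).cexp
  have hmT' : Measurable fun p : ℝ × (ι → ℝ) =>
      Complex.exp ((θ * (g p.1 + T p) : ℝ) * Complex.I) :=
    ((Complex.measurable_ofReal.comp (((hg.comp measurable_fst).add hT).const_mul θ)).mul_const
      _).cexp
  have e1 : ∫ ω, (g (H i ω) : ℂ) * Complex.exp ((θ * ∑ j ∈ S, g (H j ω) : ℝ) * Complex.I) ∂P =
      ∫ p, k p.1 * Complex.exp ((θ * T (p.1, p.2.2) : ℝ) * Complex.I) ∂ρ := by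
    have hm : StronglyMeasurable fun p : ℝ × (ι → ℝ) =>
        k p.1 * Complex.exp ((θ * T p : ℝ) * Complex.I) :=
      ((hk.comp measurable_fst).mul hmT).stronglyMeasurable
    have hmp := measurePreserving_forget h i
    have e := integral_map (μ := ρ) hmp.measurable.aemeasurable
      (f := fun p : ℝ × (ι → ℝ) => k p.1 * Complex.exp ((θ * T p : ℝ) * Complex.I))
      hm.aestronglyMeasurable
    rw [← e, hmp.map_eq, ← h.integral_eq i hm]
    refine integral_congr_ae (.of_forall fun ω => ?_)
    simp only [hsum, k]
    rw [mul_assoc, ← Complex.exp_add]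
    congr 2
    push_cast; ring
  have e2 : ∫ ω, Complex.exp ((θ * ∑ j ∈ S, g (H j ω) : ℝ) * Complex.I) ∂P =
      ∫ p, Complex.exp ((θ * (g p.1 + T p) : ℝ) * Complex.I) ∂(γ.prod ν) := by
    rw [← h.integral_eq i hmT'.stronglyMeasurable]
    refine integral_congr_ae (.of_forall fun ω => ?_)
    simp only [hsum]
  -- The copy together with the residuals has the law of the original field and is independent of
  -- `x`, so the product of expectations is a single expectation under `copyLaw`.
  have e3 : (∫ x, k x ∂γ) * ∫ ω, Complex.exp ((θ * ∑ j ∈ S, g (H j ω) : ℝ) * Complex.I) ∂P =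
      ∫ p, k p.1 * Complex.exp ((θ * (g p.2.1 + T p.2) : ℝ) * Complex.I) ∂ρ := by
    rw [e2]
    exact (integral_prod_mul k fun p : ℝ × (ι → ℝ) =>
      Complex.exp ((θ * (g p.1 + T p) : ℝ) * Complex.I)).symm
  have hB0 : 0 ≤ B := (abs_nonneg _).trans (hB 0)
  have hkn : ∀ x, ‖k x‖ = |g x| := fun x => by
    simp only [k]
    rw [norm_mul, norm_cexp_ofReal_mul_I, mul_one, Complex.norm_real, Real.norm_eq_abs]
  have hforget : Measurable fun p : ℝ × ℝ × (ι → ℝ) => (p.1, p.2.2) :=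
    (measurePreserving_forget h i).measurable
  have i1 : Integrable (fun p : ℝ × ℝ × (ι → ℝ) =>
      k p.1 * Complex.exp ((θ * T (p.1, p.2.2) : ℝ) * Complex.I)) ρ := by
    refine Integrable.of_bound ((hk.comp measurable_fst).mul
      (hmT.comp hforget)).aestronglyMeasurable B (.of_forall fun p => ?_)
    rw [norm_mul, norm_cexp_ofReal_mul_I, mul_one, hkn]; exact hB _
  have i2 : Integrable (fun p : ℝ × ℝ × (ι → ℝ) =>
      k p.1 * Complex.exp ((θ * (g p.2.1 + T p.2) : ℝ) * Complex.I)) ρ := by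
    refine Integrable.of_bound ((hk.comp measurable_fst).mul
      (hmT'.comp measurable_snd)).aestronglyMeasurable B (.of_forall fun p => ?_)
    rw [norm_mul, norm_cexp_ofReal_mul_I, mul_one, hkn]; exact hB _
  have i3 : Integrable (fun p : ℝ × ℝ × (ι → ℝ) => |g p.1| * |g p.2.1|) ρ := by
    refine Integrable.of_bound (C := B * B) ((hg.comp measurable_fst).abs.mul
      (hg.comp (measurable_fst.comp measurable_snd)).abs).aestronglyMeasurable (.of_forall fun p => ?_)
    rw [norm_mul, Real.norm_eq_abs, Real.norm_eq_abs, abs_abs, abs_abs]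
    exact mul_le_mul (hB _) (hB _) (abs_nonneg _) hB0
  have i4 : ∀ j, Integrable (fun p : ℝ × ℝ × (ι → ℝ) =>
      |g p.1| * |g (p.2.2 j + c j i * p.1) - g (p.2.2 j + c j i * p.2.1)|) ρ := by
    intro j
    refine Integrable.of_bound (C := B * (B + B)) ((hg.comp measurable_fst).abs.mul
      (((measurable_shift j (c j i) hg).comp hforget).sub
        ((measurable_shift j (c j i) hg).comp measurable_snd)).abs).aestronglyMeasurable
      (.of_forall fun p => ?_)
    rw [norm_mul, Real.norm_eq_abs, Real.norm_eq_abs, abs_abs, abs_abs]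
    exact mul_le_mul (hB _) ((abs_sub _ _).trans (add_le_add (hB _) (hB _))) (abs_nonneg _) hB0
  rw [e1, e3, ← integral_sub i1 i2]
  have hbound : ∀ p : ℝ × ℝ × (ι → ℝ),
      ‖k p.1 * Complex.exp ((θ * T (p.1, p.2.2) : ℝ) * Complex.I) -
        k p.1 * Complex.exp ((θ * (g p.2.1 + T p.2) : ℝ) * Complex.I)‖ ≤
      |g p.1| * |g p.2.1| + ∑ j ∈ S.erase i,
        |g p.1| * |g (p.2.2 j + c j i * p.1) - g (p.2.2 j + c j i * p.2.1)| := by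
    intro p
    rw [← mul_sub, norm_mul, hkn, ← Finset.mul_sum, ← mul_add]
    refine mul_le_mul_of_nonneg_left ((norm_cexp_sub_cexp_le _ _).trans ?_) (abs_nonneg _)
    rw [← mul_sub, abs_mul]
    refine (mul_le_of_le_one_left (abs_nonneg _) hθ).trans ?_
    have : T (p.1, p.2.2) - (g p.2.1 + T p.2) = -g p.2.1 + ∑ j ∈ S.erase i,
        (g (p.2.2 j + c j i * p.1) - g (p.2.2 j + c j i * p.2.1)) := by
      simp only [T, Finset.sum_sub_distrib]; ring
    rw [this]
    refine (abs_add_le _ _).trans ?_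
    rw [abs_neg]
    exact add_le_add_right (Finset.abs_sum_le_sum_abs _ _) _
  refine (norm_integral_le_of_norm_le (i3.add (integrable_finsetSum _ fun j _ => i4 j))
    (.of_forall hbound)).trans (le_of_eq ?_)
  simp only [Pi.add_apply]
  rw [integral_add i3 (integrable_finsetSum _ fun j _ => i4 j), integral_finsetSum _ fun j _ => i4 j]
  congr 1
  have e5 : ∫ p, |g p.1| * |g p.2.1| ∂ρ =
      (∫ x, |g x| ∂γ) * ∫ p : ℝ × (ι → ℝ), |g p.1| ∂(γ.prod ν) :=
    integral_prod_mul (fun x => |g x|) fun p : ℝ × (ι → ℝ) => |g p.1|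
  rw [e5, pow_two]
  congr 1
  have := integral_prod_mul (μ := γ) (ν := ν) (fun x => |g x|) fun _ => (1 : ℝ)
  simpa using this

end Decoupling

/-! ### The characteristic functional of a Gaussian field -/

lemma hasDerivAt_integral_cexp {Ω : Type*} [MeasurableSpace Ω] {P : Measure Ω} [IsFiniteMeasure P]
    {X : Ω → ℝ} (hX : AEMeasurable X P) {B : ℝ} (hB : ∀ ω, |X ω| ≤ B) (θ : ℝ) :
    HasDerivAt (fun θ : ℝ => ∫ ω, Complex.exp ((θ * X ω : ℝ) * Complex.I) ∂P)
      (Complex.I * ∫ ω, (X ω : ℂ) * Complex.exp ((θ * X ω : ℝ) * Complex.I) ∂P) θ := by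
  have hm : ∀ θ : ℝ, AEStronglyMeasurable
      (fun ω => Complex.exp ((θ * X ω : ℝ) * Complex.I)) P := fun θ =>
    ((Complex.measurable_ofReal.comp_aemeasurable (hX.const_mul θ)).mul_const _).cexp.aestronglyMeasurable
  have h := hasDerivAt_integral_of_dominated_loc_of_deriv_le (μ := P)
    (F := fun (θ : ℝ) ω => Complex.exp ((θ * X ω : ℝ) * Complex.I))
    (F' := fun (θ : ℝ) ω => Complex.I * ((X ω : ℂ) * Complex.exp ((θ * X ω : ℝ) * Complex.I)))
    (x₀ := θ) (s := Set.univ) (bound := fun _ => B) univ_mem (.of_forall hm)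
    (Integrable.of_bound (hm θ) 1 (.of_forall fun ω => (norm_cexp_ofReal_mul_I _).le))
    (((Complex.measurable_ofReal.comp_aemeasurable hX).aestronglyMeasurable.mul (hm θ)).const_mul _)
    (.of_forall fun ω θ _ => ?_) (integrable_const _) (.of_forall fun ω θ _ => ?_)
  · rw [integral_const_mul] at h
    exact h.2
  · rw [norm_mul, norm_mul, norm_cexp_ofReal_mul_I, Complex.norm_I, one_mul, mul_one,
      Complex.norm_real]
    exact hB ω
  · have h1 : HasDerivAt (fun θ : ℝ => ((θ * X ω : ℝ) : ℂ) * Complex.I) ((X ω : ℂ) * Complex.I) θ := by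
      have := ((hasDerivAt_id θ).mul_const (X ω)).ofReal_comp.mul_const Complex.I
      simpa using this
    refine h1.cexp.congr_deriv ?_
    ring

section CharFunctional

variable {ι Ω : Type*} [Countable ι] [MeasurableSpace Ω] {P : Measure Ω} {c : ι → ι → ℝ}
  {H : ι → Ω → ℝ}

/-- The total error in the Poisson approximation of the point process of a Gaussian field. -/
def couplingError [DecidableEq ι] (P : Measure Ω) (c : ι → ι → ℝ) (H : ι → Ω → ℝ) (g : ℝ → ℝ)
    (S : Finset ι) : ℝ :=
  ∑ i ∈ S, ((∫ x, |g x| ∂(gaussianReal 0 1)) ^ 2 + ∑ j ∈ S.erase i, resampleGap P c H g i j)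

/-- Decoupling every summand shows that the characteristic function along `θ * g` nearly solves `L'
= m' L`, whose solution with `L(0) = 1` is the Poisson expression `exp(m)`. Duhamel's formula on
`[0,1]` turns the defect into the final error, with a factor `exp(κ)` from each of `exp(m)` and
`exp(-m)`. -/
lemma norm_charFunctional_sub_le (h : IsUnitGaussian P c H) (S : Finset ι) [DecidableEq ι]
    {g : ℝ → ℝ} (hg : Measurable g) {B : ℝ} (hB : ∀ x, |g x| ≤ B) :
    ‖∫ ω, Complex.exp ((∑ j ∈ S, g (H j ω) : ℝ) * Complex.I) ∂P -
      Complex.exp (S.card * ∫ x, (Complex.exp (g x * Complex.I) - 1) ∂(gaussianReal 0 1))‖ ≤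
      Real.exp (2 * (S.card * ∫ x, |g x| ∂(gaussianReal 0 1))) * couplingError P c H g S := by
  have := h.gaussian.isProbabilityMeasure
  set γ := gaussianReal 0 1 with hγ
  set ε := couplingError P c H g S with hε
  have hB0 : 0 ≤ B := (abs_nonneg _).trans (hB 0)
  have hgi : Integrable (fun x => |g x|) γ := Integrable.of_bound (C := B) hg.abs.aestronglyMeasurable
    (.of_forall fun x => by rw [Real.norm_eq_abs, abs_abs]; exact hB x)
  have hmeas : AEMeasurable (fun ω => ∑ j ∈ S, g (H j ω)) P :=
    Finset.aemeasurable_fun_sum _ fun j _ => hg.comp_aemeasurable (h.aemeasurable j)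
  have hbd : ∀ ω, |∑ j ∈ S, g (H j ω)| ≤ S.card * B := fun ω => by
    refine (Finset.abs_sum_le_sum_abs _ _).trans ((Finset.sum_le_card_nsmul _ _ B fun j _ => hB _).trans ?_)
    rw [nsmul_eq_mul]
  let L : ℝ → ℂ := fun θ => ∫ ω, Complex.exp ((θ * ∑ j ∈ S, g (H j ω) : ℝ) * Complex.I) ∂P
  let m : ℝ → ℂ := fun θ => S.card * (∫ x, Complex.exp ((θ * g x : ℝ) * Complex.I) ∂γ - 1)
  let m' : ℝ → ℂ := fun θ =>
    S.card * (Complex.I * ∫ x, (g x : ℂ) * Complex.exp ((θ * g x : ℝ) * Complex.I) ∂γ)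
  let L' : ℝ → ℂ := fun θ => Complex.I * ∫ ω, ((∑ j ∈ S, g (H j ω) : ℝ) : ℂ) *
    Complex.exp ((θ * ∑ j ∈ S, g (H j ω) : ℝ) * Complex.I) ∂P
  have hL : ∀ θ, HasDerivAt L (L' θ) θ := fun θ => hasDerivAt_integral_cexp hmeas hbd θ
  have hm : ∀ θ, HasDerivAt m (m' θ) θ := fun θ =>
    ((hasDerivAt_integral_cexp hg.aemeasurable hB θ).sub_const 1).const_mul _
  have hcexp : ∀ (θ : ℝ), AEStronglyMeasurable
      (fun ω => Complex.exp ((θ * ∑ j ∈ S, g (H j ω) : ℝ) * Complex.I)) P := fun θ =>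
    ((Complex.measurable_ofReal.comp_aemeasurable (hmeas.const_mul θ)).mul_const
      _).cexp.aestronglyMeasurable
  have hdiff : ∀ θ : ℝ, |θ| ≤ 1 → ‖L' θ - m' θ * L θ‖ ≤ ε := by
    intro θ hθ
    have e : L' θ - m' θ * L θ = Complex.I * ∑ i ∈ S,
        (∫ ω, (g (H i ω) : ℂ) * Complex.exp ((θ * ∑ j ∈ S, g (H j ω) : ℝ) * Complex.I) ∂P -
        (∫ x, (g x : ℂ) * Complex.exp ((θ * g x : ℝ) * Complex.I) ∂γ) * L θ) := by
      rw [Finset.sum_sub_distrib, Finset.sum_const, ← integral_finsetSum, mul_sub, nsmul_eq_mul]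
      · simp only [L', m']
        congr 1
        · congr 2
          funext ω
          rw [Complex.ofReal_sum, Finset.sum_mul]
        · ring
      · intro i _
        refine Integrable.of_bound (C := B) (((Complex.measurable_ofReal.comp_aemeasurable
          (hg.comp_aemeasurable (h.aemeasurable i))).aestronglyMeasurable).mul (hcexp θ))
          (.of_forall fun ω => ?_)
        rw [norm_mul, norm_cexp_ofReal_mul_I, mul_one, Complex.norm_real]
        exact hB _
    rw [e, norm_mul, Complex.norm_I, one_mul]
    exact (norm_sum_le _ _).trans (Finset.sum_le_sum fun i hi => norm_decouple_le h S hg hB hθ hi)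
  have hε0 : 0 ≤ ε := (norm_nonneg _).trans (hdiff 0 (by simp))
  set κ := S.card * ∫ x, |g x| ∂γ with hκ
  have hmint : ∀ θ : ℝ, m θ = S.card * ∫ x, (Complex.exp ((θ * g x : ℝ) * Complex.I) - 1) ∂γ := by
    intro θ
    rw [integral_sub _ (integrable_const _)]
    · simp [m]
    · refine Integrable.of_bound (C := 1) ?_ (.of_forall fun x => (norm_cexp_ofReal_mul_I _).le)
      exact ((Complex.measurable_ofReal.comp (hg.const_mul θ)).mul_const _).cexp.aestronglyMeasurable
  have hmb : ∀ θ : ℝ, |θ| ≤ 1 → ‖m θ‖ ≤ κ := by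
    intro θ hθ
    rw [hmint, norm_mul, Complex.norm_natCast]
    refine mul_le_mul_of_nonneg_left (norm_integral_le_of_norm_le hgi (.of_forall fun x => ?_))
      (Nat.cast_nonneg _)
    have := norm_cexp_sub_cexp_le (θ * g x) 0
    rw [Complex.ofReal_zero, zero_mul, Complex.exp_zero, sub_zero, abs_mul] at this
    exact this.trans (mul_le_of_le_one_left (abs_nonneg _) hθ)
  -- The integrating factor: the derivative of `G` is `exp(-m)` times the defect `L' - m' L`, so the
  -- mean value inequality bounds `G 1 - G 0`.
  let G : ℝ → ℂ := fun θ => Complex.exp (-m θ) * L θ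
  have hG : ∀ θ, HasDerivAt G (Complex.exp (-m θ) * (L' θ - m' θ * L θ)) θ := by
    intro θ
    refine ((hm θ).neg.cexp.mul (hL θ)).congr_deriv ?_
    simp only [Pi.neg_apply]
    ring
  have hexp : ∀ z : ℂ, ‖z‖ ≤ κ → ‖Complex.exp z‖ ≤ Real.exp κ := fun z hz => by
    rw [Complex.norm_exp]
    exact Real.exp_le_exp.2 ((Complex.re_le_norm z).trans hz)
  have hGd : ∀ θ ∈ Set.Ico (0 : ℝ) 1, ‖Complex.exp (-m θ) * (L' θ - m' θ * L θ)‖ ≤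
      Real.exp κ * ε := by
    intro θ hθ
    have hθ1 : |θ| ≤ 1 := by rw [abs_of_nonneg hθ.1]; exact hθ.2.le
    rw [norm_mul]
    exact mul_le_mul (hexp _ (by rw [norm_neg]; exact hmb θ hθ1)) (hdiff θ hθ1) (norm_nonneg _)
      (Real.exp_pos _).le
  have hmv := norm_image_sub_le_of_norm_deriv_le_segment_01'
    (fun θ _ => (hG θ).hasDerivWithinAt) hGd
  have hG0 : G 0 = 1 := by simp [G, L, m]
  have hfin : L 1 - Complex.exp (m 1) = Complex.exp (m 1) * (G 1 - G 0) := by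
    rw [hG0, mul_sub, mul_one]
    simp only [G]
    rw [← mul_assoc, ← Complex.exp_add, add_neg_cancel, Complex.exp_zero, one_mul]
  have hL1 : L 1 = ∫ ω, Complex.exp ((∑ j ∈ S, g (H j ω) : ℝ) * Complex.I) ∂P := by
    simp only [L, one_mul]
  have hm1 : m 1 = S.card * ∫ x, (Complex.exp (g x * Complex.I) - 1) ∂γ := by
    rw [hmint]; simp only [one_mul]
  rw [← hL1, ← hm1, hfin, norm_mul]
  calc _ ≤ Real.exp κ * (Real.exp κ * ε) :=
        mul_le_mul (hexp _ (hmb 1 (by simp))) hmv (norm_nonneg _) (Real.exp_pos _).le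
    _ = _ := by rw [← mul_assoc, ← Real.exp_add]; ring_nf

end CharFunctional

/-! ### The effect of resampling one coordinate -/

lemma integrable_abs_gaussian : Integrable (fun x : ℝ => |x|) (gaussianReal 0 1) :=
  (memLp_id_gaussianReal 1 |>.integrable le_rfl).abs

lemma integral_abs_le_one {Ω : Type*} [MeasurableSpace Ω] {P : Measure Ω} [IsProbabilityMeasure P]
    {X : Ω → ℝ} (hX : MemLp X 2 P) (h0 : ∫ ω, X ω ∂P = 0) (h1 : Var[X; P] ≤ 1) :
    ∫ ω, |X ω| ∂P ≤ 1 := by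
  have h2 : ∫ ω, X ω ^ 2 ∂P ≤ 1 := by
    rwa [← variance_of_integral_eq_zero hX.1.aemeasurable h0]
  have h3 : ∫ ω, |X ω| ∂P ≤ ∫ ω, (1 + X ω ^ 2) / 2 ∂P := by
    refine integral_mono (hX.integrable one_le_two).abs
      (((integrable_const _).add hX.integrable_sq).div_const 2) fun ω => ?_
    have := sq_nonneg (|X ω| - 1)
    simp only
    nlinarith [sq_abs (X ω)]
  rw [integral_div, integral_add (integrable_const _) hX.integrable_sq] at h3
  simp only [integral_const, probReal_univ, one_smul] at h3
  linarith

lemma integral_abs_gaussian_le : ∫ x, |x| ∂(gaussianReal 0 1) ≤ 1 := by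
  refine integral_abs_le_one (X := id) (memLp_id_gaussianReal 2) ?_ ?_
  · simp
  · simp

section Resample

variable {ι Ω : Type*} [MeasurableSpace Ω] {P : Measure Ω} {c : ι → ι → ℝ} {H : ι → Ω → ℝ}

/-- Regress `H i` on `H j`: on the window of `j` the regression part is at most `A`, and the
residual is independent of the window with first absolute moment at most one. -/
lemma integral_window_mul_abs_le (h : IsUnitGaussian P c H) (i j : ι) {w : ℝ → ℝ}
    (hw : Measurable w) (hw0 : ∀ x, 0 ≤ w x) (hw1 : ∀ x, w x ≤ 1) {A : ℝ}
    (hwA : ∀ x, w x * |x| ≤ A * w x) (hc : |c j i| ≤ 1) :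
    Integrable (fun ω => w (H j ω) * |H i ω|) P ∧
    ∫ ω, w (H j ω) * |H i ω| ∂P ≤ (A + 1) * ∫ x, w x ∂(gaussianReal 0 1) := by
  have := h.gaussian.isProbabilityMeasure
  have hmw : AEMeasurable (fun ω => w (H j ω)) P := hw.comp_aemeasurable (h.aemeasurable j)
  have hnw : ∀ ω, ‖w (H j ω)‖ ≤ 1 := fun ω => by
    rw [Real.norm_of_nonneg (hw0 _)]; exact hw1 _
  have hint : ∀ {Y : Ω → ℝ}, MemLp Y 2 P → Integrable (fun ω => w (H j ω) * |Y ω|) P :=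
    fun hY => (hY.integrable one_le_two).abs.bdd_mul hmw.aestronglyMeasurable (.of_forall hnw)
  have hR : MemLp (resid c H j i) 2 P := (h.memLp i).sub ((h.memLp j).const_mul _)
  refine ⟨hint (h.memLp i), ?_⟩
  have hwi : ∫ ω, w (H j ω) ∂P = ∫ x, w x ∂(gaussianReal 0 1) := by
    rw [← h.map_eq j, integral_map (h.aemeasurable j) hw.aestronglyMeasurable]
  have hwint : Integrable (fun ω => w (H j ω)) P :=
    Integrable.of_bound hmw.aestronglyMeasurable 1 (.of_forall hnw)
  have hA : 0 ≤ A * ∫ x, w x ∂(gaussianReal 0 1) := by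
    rw [← integral_const_mul]
    exact integral_nonneg fun x => (mul_nonneg (hw0 x) (abs_nonneg x)).trans (hwA x)
  have e1 : ∫ ω, w (H j ω) * |resid c H j i ω| ∂P ≤ ∫ x, w x ∂(gaussianReal 0 1) := by
    have hind : IndepFun (fun ω => w (H j ω)) (fun ω => |resid c H j i ω|) P :=
      (h.indepFun_resid j).symm.comp hw (measurable_pi_apply i).abs
    rw [hind.integral_fun_mul_eq_mul_integral hmw.aestronglyMeasurable
      (h.aemeasurable_resid j i).abs.aestronglyMeasurable, hwi]
    refine mul_le_of_le_one_right (integral_nonneg hw0) (integral_abs_le_one hR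
      (h.integral_resid j i) ?_)
    rw [h.variance_resid]
    nlinarith [sq_nonneg (c i j)]
  have e2 : ∫ ω, w (H j ω) * |H i ω| ∂P ≤
      ∫ ω, (w (H j ω) * |resid c H j i ω| + A * w (H j ω)) ∂P := by
    refine integral_mono (hint (h.memLp i)) ((hint hR).add (hwint.const_mul A)) fun ω => ?_
    have h1 : |H i ω| ≤ |resid c H j i ω| + |H j ω| := by
      rw [eq_resid_add c H j i ω]
      refine (abs_add_le _ _).trans (add_le_add_right ?_ _)
      rw [abs_mul, h.symm i j]
      exact mul_le_of_le_one_left (abs_nonneg _) hc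
    have h2 := mul_le_mul_of_nonneg_left h1 (hw0 (H j ω))
    have h3 := hwA (H j ω)
    simp only
    linarith
  rw [integral_add (hint hR) (hwint.const_mul A), integral_const_mul, hwi] at e2
  linarith

variable [Countable ι]

/-- Resampling moves the coordinate `j` by `|r| |x - x'|`, and on the window of `i` this is at most
`|r|(A + |x'|)`. The integrand vanishes unless `x` is in the window and the coordinate `j` is in it
either before or after resampling; the two cases give the pair probability and the squared single
probability. -/
lemma resampleGap_le (h : IsUnitGaussian P c H) (i j : ι) {g w : ℝ → ℝ}
    (hw : Measurable w) (hw0 : ∀ x, 0 ≤ w x) (hw1 : ∀ x, w x ≤ 1) {A B δ L : ℝ}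
    (hA : 0 ≤ A) (hB : 0 ≤ B) (hδ : 0 ≤ δ) (hL : 0 ≤ L)
    (hwA : ∀ x, w x * |x| ≤ A * w x) (hgB : ∀ x, |g x| ≤ B * w x)
    (hg : ∀ x y, |g x - g y| ≤ (w x + w y) * (δ + L * |x - y|)) (hc : |c j i| ≤ 1) :
    resampleGap P c H g i j ≤ B * (δ + L * |c j i| * (2 * A + 1)) *
      (∫ p, w p.1 * w (p.2 + c j i * p.1)
        ∂((gaussianReal 0 1).prod (gaussianReal 0 (1 - c j i ^ 2).toNNReal)) +
        (∫ x, w x ∂(gaussianReal 0 1)) ^ 2) := by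
  have := h.gaussian.isProbabilityMeasure
  have := h.isProbabilityMeasure_residLaw i
  have := isProbabilityMeasure_copyLaw h i
  set r := c j i with hr
  set γ := gaussianReal 0 1 with hγ
  set ν := residLaw P c H i with hν
  set ρ := copyLaw P c H i with hρ
  set p1 := ∫ x, w x ∂γ with hp1
  have hp10 : 0 ≤ p1 := integral_nonneg hw0
  have hnw : ∀ x, ‖w x‖ ≤ 1 := fun x => by rw [Real.norm_of_nonneg (hw0 _)]; exact hw1 _
  set K := L * |r| with hK
  have hK0 : 0 ≤ K := by positivity
  let G : ℝ → ℝ := fun u => δ + K * (A + |u|)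
  have hGi : Integrable G γ :=
    (integrable_const _).add (((integrable_const _).add integrable_abs_gaussian).const_mul K)
  have hG0 : ∀ u, 0 ≤ G u := fun u => by positivity
  have hGle : ∫ u, G u ∂γ ≤ δ + K * (2 * A + 1) := by
    have e : ∀ u, G u = (δ + K * A) + K * |u| := fun u => by simp only [G]; ring
    simp only [e]
    rw [integral_add (integrable_const _) (integrable_abs_gaussian.const_mul K),
      integral_const_mul]
    simp only [integral_const, probReal_univ, one_smul]
    have := mul_le_mul_of_nonneg_left integral_abs_gaussian_le hK0
    nlinarith [mul_nonneg hK0 hA]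
  -- `F1` is the case where the original value of the coordinate `j` lies in the window, and the
  -- copy enters only through `G`; `F2` is the case of the resampled value.
  let F1 : ℝ × ℝ × (ι → ℝ) → ℝ := fun p => w p.1 * (G p.2.1 * w (p.2.2 j + r * p.1))
  let F2 : ℝ × ℝ × (ι → ℝ) → ℝ := fun p => w p.1 * (w (p.2.2 j + r * p.2.1) * G p.2.1)
  have hsh1 : Measurable fun p : ℝ × ℝ × (ι → ℝ) => w (p.2.2 j + r * p.1) := by fun_prop
  have hsh2 : Measurable fun p : ℝ × ℝ × (ι → ℝ) => w (p.2.2 j + r * p.2.1) := by fun_prop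
  have hGρ : Integrable (fun p : ℝ × ℝ × (ι → ℝ) => G p.2.1) ρ :=
    (hGi.comp_fst ν).comp_snd γ
  have hwfst : AEStronglyMeasurable (fun p : ℝ × ℝ × (ι → ℝ) => w p.1) ρ :=
    (hw.comp measurable_fst).aestronglyMeasurable
  have i1 : Integrable F1 ρ :=
    (hGρ.mul_bdd (c := 1) hsh1.aestronglyMeasurable (.of_forall fun _ => hnw _)).bdd_mul (c := 1)
      hwfst (.of_forall fun _ => hnw _)
  have i2 : Integrable F2 ρ :=
    (hGρ.bdd_mul (c := 1) hsh2.aestronglyMeasurable (.of_forall fun _ => hnw _)).bdd_mul (c := 1)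
      hwfst (.of_forall fun _ => hnw _)
  have hle : resampleGap P c H g i j ≤ ∫ p, B * (F1 p + F2 p) ∂ρ := by
    refine integral_mono_of_nonneg (.of_forall fun p => by positivity) ((i1.add i2).const_mul B)
      (.of_forall fun p => ?_)
    simp only [F1, F2]
    have h1 := hg (p.2.2 j + r * p.1) (p.2.2 j + r * p.2.1)
    have h2 : |p.2.2 j + r * p.1 - (p.2.2 j + r * p.2.1)| ≤ |r| * (|p.1| + |p.2.1|) := by
      rw [show p.2.2 j + r * p.1 - (p.2.2 j + r * p.2.1) = r * (p.1 - p.2.1) by ring, abs_mul]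
      exact mul_le_mul_of_nonneg_left (abs_sub _ _) (abs_nonneg _)
    have h3 : w p.1 * (δ + L * |p.2.2 j + r * p.1 - (p.2.2 j + r * p.2.1)|) ≤
        w p.1 * G p.2.1 := by
      have e1 := mul_le_mul_of_nonneg_left h2 hL
      have e2 := mul_le_mul_of_nonneg_left e1 (hw0 p.1)
      have e3 := mul_le_mul_of_nonneg_left (hwA p.1) hK0
      simp only [G, hK] at e3 ⊢
      linarith
    have hww : 0 ≤ w (p.2.2 j + r * p.1) + w (p.2.2 j + r * p.2.1) := add_nonneg (hw0 _) (hw0 _)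
    calc |g p.1| * |g (p.2.2 j + r * p.1) - g (p.2.2 j + r * p.2.1)|
        ≤ (B * w p.1) * ((w (p.2.2 j + r * p.1) + w (p.2.2 j + r * p.2.1)) *
          (δ + L * |p.2.2 j + r * p.1 - (p.2.2 j + r * p.2.1)|)) :=
          mul_le_mul (hgB _) h1 (abs_nonneg _) (mul_nonneg hB (hw0 _))
      _ = B * ((w (p.2.2 j + r * p.1) + w (p.2.2 j + r * p.2.1)) *
          (w p.1 * (δ + L * |p.2.2 j + r * p.1 - (p.2.2 j + r * p.2.1)|))) := by ring
      _ ≤ B * ((w (p.2.2 j + r * p.1) + w (p.2.2 j + r * p.2.1)) * (w p.1 * G p.2.1)) :=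
          mul_le_mul_of_nonneg_left (mul_le_mul_of_nonneg_left h3 hww) hB
      _ = _ := by ring
  have E1 : ∫ p, F1 p ∂ρ = (∫ u, G u ∂γ) * ∫ p, w p.1 * w (p.2 + r * p.1)
        ∂(γ.prod (gaussianReal 0 (1 - r ^ 2).toNNReal)) := by
    have ea : ∫ p, F1 p ∂ρ = ∫ x, ∫ q : ℝ × (ι → ℝ), F1 (x, q) ∂(γ.prod ν) ∂γ :=
      integral_prod F1 i1
    have eb : ∀ x, ∫ q : ℝ × (ι → ℝ), F1 (x, q) ∂(γ.prod ν) =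
        (∫ u, G u ∂γ) * ∫ y, w x * w (y + r * x) ∂(gaussianReal 0 (1 - r ^ 2).toNNReal) := by
      intro x
      simp only [F1]
      rw [integral_const_mul, integral_prod_mul G fun y : ι → ℝ => w (y j + r * x),
        integral_const_mul, ← h.residLaw_map_eval i j, integral_map
        (measurable_pi_apply j).aemeasurable
        (by fun_prop : Measurable fun y : ℝ => w (y + r * x)).aestronglyMeasurable]
      ring
    rw [ea]
    simp only [eb]
    rw [integral_const_mul, integral_prod]
    refine Integrable.of_bound (C := 1) (by fun_prop : Measurable fun p : ℝ × ℝ =>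
      w p.1 * w (p.2 + r * p.1)).aestronglyMeasurable (.of_forall fun p => ?_)
    rw [norm_mul]
    exact mul_le_one₀ (hnw _) (norm_nonneg _) (hnw _)
  -- Here `x` separates, and the copy with the residuals reassembles the field. The weight `|H i|`
  -- on the window of `H j` contributes the second `A` in `2A + 1`.
  have E2 : ∫ p, F2 p ∂ρ ≤ p1 * ((δ + K * (2 * A + 1)) * p1) := by
    have ea : ∫ p, F2 p ∂ρ = p1 * ∫ q : ℝ × (ι → ℝ), w (q.2 j + r * q.1) * G q.1 ∂(γ.prod ν) :=
      integral_prod_mul w fun q : ℝ × (ι → ℝ) => w (q.2 j + r * q.1) * G q.1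
    have hm : Measurable fun q : ℝ × (ι → ℝ) => w (q.2 j + r * q.1) * G q.1 := by
      simp only [G]; fun_prop
    rw [ea, ← h.integral_eq i hm.stronglyMeasurable]
    simp only [hr, ← eq_resid_add]
    refine mul_le_mul_of_nonneg_left ?_ hp10
    obtain ⟨hi, hle'⟩ := integral_window_mul_abs_le h i j hw hw0 hw1 hwA hc
    have hwint : Integrable (fun ω => w (H j ω)) P :=
      Integrable.of_bound (hw.comp_aemeasurable (h.aemeasurable j)).aestronglyMeasurable 1
        (.of_forall fun _ => hnw _)
    have hwi : ∫ ω, w (H j ω) ∂P = p1 := by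
      rw [hp1, hγ, ← h.map_eq j, integral_map (h.aemeasurable j) hw.aestronglyMeasurable]
    have e : ∀ ω, w (H j ω) * G (H i ω) =
        (δ + K * A) * w (H j ω) + K * (w (H j ω) * |H i ω|) := fun ω => by
      simp only [G]; ring
    simp only [e]
    rw [integral_add (hwint.const_mul _) (hi.const_mul _), integral_const_mul, integral_const_mul,
      hwi]
    have := mul_le_mul_of_nonneg_left hle' hK0
    rw [← hγ, ← hp1] at this
    linarith
  refine hle.trans ?_
  rw [integral_const_mul, integral_add i1 i2, E1, mul_assoc]
  refine mul_le_mul_of_nonneg_left ?_ hB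
  have hp2 : 0 ≤ ∫ p, w p.1 * w (p.2 + r * p.1)
        ∂(γ.prod (gaussianReal 0 (1 - r ^ 2).toNNReal)) :=
    integral_nonneg fun p => mul_nonneg (hw0 _) (hw0 _)
  have := mul_le_mul_of_nonneg_right hGle hp2
  linarith

end Resample

/-- Within the uniform-continuity radius the increment is below `δ`; beyond it the linear term
exceeds twice the supremum. The error at distance zero is thus as small as desired, at the price of
a steep slope. -/
lemma TestFun.exists_modulus (f : TestFun) {δ : ℝ} (hδ : 0 < δ) :
    ∃ L, 0 ≤ L ∧ ∀ x y, |f x - f y| ≤ δ + L * |x - y| := by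
  obtain ⟨B, hB0, hB⟩ := TestFun.exists_bound f
  have huc : UniformContinuous f := f.hasCompactSupport.uniformContinuous_of_continuous f.continuous
  obtain ⟨η, hη, h⟩ := Metric.uniformContinuous_iff.1 huc δ hδ
  refine ⟨2 * B / η, by positivity, fun x y => ?_⟩
  by_cases hxy : |x - y| < η
  · have := h (a := x) (b := y) (by rwa [Real.dist_eq])
    rw [Real.dist_eq] at this
    have : 0 ≤ 2 * B / η * |x - y| := by positivity
    linarith
  · have h1 : |f x - f y| ≤ 2 * B := (abs_sub _ _).trans (by linarith [hB x, hB y])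
    have h2 : 2 * B ≤ 2 * B / η * |x - y| := by
      rw [div_mul_eq_mul_div, le_div_iff₀ hη]
      exact mul_le_mul_of_nonneg_left (not_lt.1 hxy) (by linarith)
    linarith

/-- The indicator of a window of half-width `s` around the centering, on the scale of the
extremes. -/
def edgeWindow (M s : ℝ) : ℝ → ℝ := {x | |(x - center M) / scale M| ≤ s}.indicator fun _ => 1

lemma measurableSet_edgeWindow (M s : ℝ) : MeasurableSet {x | |(x - center M) / scale M| ≤ s} :=
  measurableSet_le (by fun_prop) measurable_const

lemma measurable_edgeWindow (M s : ℝ) : Measurable (edgeWindow M s) :=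
  measurable_const.indicator (measurableSet_edgeWindow M s)

lemma edgeWindow_nonneg (M s x : ℝ) : 0 ≤ edgeWindow M s x :=
  Set.indicator_nonneg (fun _ _ => zero_le_one) x

lemma edgeWindow_le_one (M s x : ℝ) : edgeWindow M s x ≤ 1 :=
  Set.indicator_le_self' (f := fun _ => (1 : ℝ)) (fun _ _ => zero_le_one) x

lemma edgeWindow_of_le {M s x : ℝ} (h : |(x - center M) / scale M| ≤ s) : edgeWindow M s x = 1 :=
  Set.indicator_of_mem (s := {x | |(x - center M) / scale M| ≤ s}) h _

lemma edgeWindow_of_lt {M s x : ℝ} (h : s < |(x - center M) / scale M|) : edgeWindow M s x = 0 :=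
  Set.indicator_of_notMem (s := {x | |(x - center M) / scale M| ≤ s}) (not_le.2 h) _

lemma abs_le_edgeWindow {f : ℝ → ℝ} {B : ℝ} (hB0 : 0 ≤ B) (hB : ∀ y, |f y| ≤ B) {s M x : ℝ}
    (hs : ∀ y, s < |y| → f y = 0) : |f ((x - center M) / scale M)| ≤ B * edgeWindow M s x := by
  by_cases hx : |(x - center M) / scale M| ≤ s
  · rw [edgeWindow_of_le hx, mul_one]; exact hB _
  · rw [hs _ (not_le.1 hx)]; simpa using mul_nonneg hB0 (edgeWindow_nonneg _ _ _)

lemma integral_edgeWindow_le {M s : ℝ} (hM : 1 ≤ M) (hs : 0 ≤ s) :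
    ∫ x, edgeWindow M s x ∂(gaussianReal 0 1) ≤ 2 * s * Real.exp (2 * s) * ((2 : ℝ) ^ M)⁻¹ := by
  have hM0 : 0 < M := by linarith
  have h := two_rpow_smul_integral_gaussian hM0 fun y => (Set.Icc (-s) s).indicator (fun _ => (1 : ℝ)) y
  have e1 : ∀ x, (Set.Icc (-s) s).indicator (fun _ => (1 : ℝ)) ((x - center M) / scale M) =
      edgeWindow M s x := fun x => by
    unfold edgeWindow
    by_cases hx : |(x - center M) / scale M| ≤ s
    · rw [Set.indicator_of_mem (Set.mem_Icc.2 (abs_le.1 hx)), Set.indicator_of_mem (by exact hx)]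
    · rw [Set.indicator_of_notMem (fun h => hx (abs_le.2 (Set.mem_Icc.1 h))), Set.indicator_of_notMem (by exact hx)]
  have e2 : ∀ y, pointDensity M y • (Set.Icc (-s) s).indicator (fun _ => (1 : ℝ)) y =
      (Set.Icc (-s) s).indicator (pointDensity M) y := fun y => by
    by_cases hy : y ∈ Set.Icc (-s) s <;> simp [hy]
  simp only [e1, e2] at h
  rw [integral_indicator measurableSet_Icc, smul_eq_mul] at h
  have h2 : ∫ y in Set.Icc (-s) s, pointDensity M y ≤ ∫ y in Set.Icc (-s) s, Real.exp (2 * s) := by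
    refine setIntegral_mono_on ((continuous_pointDensity M).integrableOn_Icc)
      (integrableOn_const (by simp)) measurableSet_Icc fun y hy =>
      pointDensity_le hM (abs_le.2 hy)
  rw [setIntegral_const, measureReal_def, Real.volume_Icc, ENNReal.toReal_ofReal (by linarith),
    ← h, smul_eq_mul] at h2
  rw [← div_eq_mul_inv, le_div_iff₀ (by positivity)]
  linarith

lemma integral_edgeWindow_pair (M s r : ℝ) (μ : Measure (ℝ × ℝ)) :
    ∫ p, edgeWindow M s p.1 * edgeWindow M s (p.2 + r * p.1) ∂μ =
      μ.real {p | |(p.1 - center M) / scale M| ≤ s ∧ |(p.2 + r * p.1 - center M) / scale M| ≤ s} := by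
  rw [← integral_indicator_one]
  · refine integral_congr_ae (.of_forall fun p => ?_)
    simp only [edgeWindow, Set.indicator_apply, Set.mem_ofPred_eq, Pi.one_apply]
    split_ifs <;> simp_all
  · exact ((measurableSet_edgeWindow M s).preimage measurable_fst).inter
      ((measurableSet_edgeWindow M s).preimage
        (by fun_prop : Measurable fun p : ℝ × ℝ => p.2 + r * p.1))

/-- Levels of order `a`, measured in units of `b`, are of order `M`, because `a b ≤ 2` and `b² =
1/M`. This is why resampling is governed by `M|r|`. -/
lemma edge_div_scale_le {M s : ℝ} (hM : 1 ≤ M) (hs : 0 ≤ s) :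
    (2 * (center M + scale M * s) + 1) / scale M ≤ (5 + 2 * s) * M := by
  have hM0 : 0 < M := by linarith
  have hb := scale_pos hM0
  rw [div_le_iff₀ hb]
  have e1 : M * scale M ^ 2 = 1 := by rw [scale_sq hM0]; field_simp
  have e2 := center_mul_scale_le hM
  have e3 : scale M ≤ 1 := by
    rw [scale, Real.sqrt_le_iff]; exact ⟨zero_le_one, by rw [one_pow, div_le_one hM0]; exact hM⟩
  have e4 : center M ≤ 2 * (M * scale M) := by
    calc center M = M * scale M * (center M * scale M) := by linear_combination -center M * e1
      _ ≤ M * scale M * 2 := mul_le_mul_of_nonneg_left e2 (mul_pos hM0 hb).le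
      _ = _ := by ring
  have e5 : 1 ≤ M * scale M := by
    calc 1 = M * scale M * scale M := by linear_combination -e1
      _ ≤ M * scale M * 1 := mul_le_mul_of_nonneg_left e3 (mul_pos hM0 hb).le
      _ = _ := mul_one _
  have e6 : scale M * s ≤ M * scale M * s := mul_le_mul_of_nonneg_right (e3.trans e5) hs
  linarith

lemma eventually_scale_mul_le_center (s : ℝ) : ∀ᶠ M : ℝ in atTop, scale M * s ≤ center M := by
  have h1 : Tendsto (fun M => scale M * s) atTop (𝓝 (0 * s)) := tendsto_scale.mul_const _
  rw [zero_mul] at h1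
  filter_upwards [h1.eventually_le_const one_pos, tendsto_center_atTop.eventually_ge_atTop 1]
    with M h1 h2 using h1.trans h2

/-- The order of the quantifiers is essential: `C` is fixed before `δ`, and only the exponent `K`
depends on `δ`. The additive bound `δ + const * M|r|` is put into the multiplicative form `δ *
exp(const/δ * M|r|)`, so that a factor `δ` stands in front of the whole pair sum. -/
lemma exists_resampleGap_bound (f : TestFun) {r₀ : ℝ} (hr₀ : r₀ < 1) : ∃ C : ℝ, 0 ≤ C ∧
    ∀ δ : ℝ, 0 < δ → ∃ K : ℕ, ∀ᶠ M : ℝ in atTop, ∀ {ι Ω : Type*} [Countable ι] [MeasurableSpace Ω]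
      {P : Measure Ω} {c : ι → ι → ℝ} {H : ι → Ω → ℝ} (_ : IsUnitGaussian P c H) (i j : ι),
      |c j i| ≤ r₀ → resampleGap P c H (fun x => f ((x - center M) / scale M)) i j ≤
        C * δ * ((2 : ℝ) ^ M)⁻¹ ^ 2 * Real.exp (K * (M * |c j i|)) := by
  obtain ⟨B, hB0, hB⟩ := TestFun.exists_bound f
  obtain ⟨s, hs⟩ := TestFun.exists_tsupport_subset f
  have hs0 : (0 : ℝ) ≤ s := Nat.cast_nonneg s
  obtain ⟨C, hC0, hC⟩ := exists_pair_bound hs0 hr₀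
  refine ⟨B * (C + (2 * s * Real.exp (2 * s)) ^ 2), by positivity, fun δ hδ => ?_⟩
  obtain ⟨L, hL0, hL⟩ := f.exists_modulus hδ
  -- The first summand is the cost of the pair probability, the second comes from absorbing the
  -- displacement into an exponential.
  obtain ⟨K, hK⟩ := exists_nat_ge (2 * Real.log 2 + L * (5 + 2 * s) / δ)
  have hev := eventually_scale_mul_le_center s
  refine ⟨K, ?_⟩
  filter_upwards [hev, eventually_ge_atTop 1] with M hMs hM ι Ω _ _ P c H h i j hc
  have hM0 : 0 < M := by linarith
  have hb := scale_pos hM0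
  set A := center M + scale M * s with hA
  have hA0 : 0 ≤ A := add_nonneg (center_nonneg M) (by positivity)
  have hwA : ∀ x, edgeWindow M s x * |x| ≤ A * edgeWindow M s x := by
    intro x
    by_cases hx : |(x - center M) / scale M| ≤ s
    · rw [edgeWindow_of_le hx, one_mul, mul_one, hA]
      rw [abs_div, abs_of_pos hb, div_le_iff₀ hb] at hx
      have := abs_sub_abs_le_abs_sub x (center M)
      rw [abs_of_nonneg (center_nonneg M)] at this
      linarith
    · rw [edgeWindow_of_lt (not_le.1 hx)]; simp
  have hgB : ∀ x, |f ((x - center M) / scale M)| ≤ B * edgeWindow M s x := fun x =>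
    abs_le_edgeWindow hB0 hB hs
  have hg : ∀ x y, |f ((x - center M) / scale M) - f ((y - center M) / scale M)| ≤
      (edgeWindow M s x + edgeWindow M s y) * (δ + L / scale M * |x - y|) := by
    intro x y
    have h1 := hL ((x - center M) / scale M) ((y - center M) / scale M)
    have e : L * |(x - center M) / scale M - (y - center M) / scale M| =
        L / scale M * |x - y| := by
      rw [← sub_div, abs_div, abs_of_pos hb]
      rw [show x - center M - (y - center M) = x - y by ring]
      ring
    rw [e] at h1
    have h2 : 0 ≤ δ + L / scale M * |x - y| := by positivity
    by_cases hx : |(x - center M) / scale M| ≤ s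
    · rw [edgeWindow_of_le hx]
      nlinarith [edgeWindow_nonneg M s y]
    by_cases hy : |(y - center M) / scale M| ≤ s
    · rw [edgeWindow_of_le hy]
      nlinarith [edgeWindow_nonneg M s x]
    rw [hs _ (not_le.1 hx), hs _ (not_le.1 hy)]
    simpa using mul_nonneg (add_nonneg (edgeWindow_nonneg M s x) (edgeWindow_nonneg M s y)) h2
  have hmain := resampleGap_le h i j (measurable_edgeWindow M s) (edgeWindow_nonneg M s)
    (edgeWindow_le_one M s) hA0 hB0 hδ.le (div_nonneg hL0 hb.le) hwA hgB hg (hc.trans hr₀.le)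
  have hp2 : ∫ p, edgeWindow M s p.1 * edgeWindow M s (p.2 + c j i * p.1)
      ∂((gaussianReal 0 1).prod (gaussianReal 0 (1 - c j i ^ 2).toNNReal)) ≤
      C * ((2 : ℝ) ^ M)⁻¹ ^ 2 * Real.exp (2 * Real.log 2 * (M * |c j i|)) := by
    rw [integral_edgeWindow_pair]; exact hC M hM hMs (c j i) hc
  have hp1 := integral_edgeWindow_le hM hs0
  have hp10 : 0 ≤ ∫ x, edgeWindow M s x ∂(gaussianReal 0 1) := integral_nonneg (edgeWindow_nonneg M s)
  set y := M * |c j i| with hy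
  have hy0 : 0 ≤ y := by positivity
  set q := ((2 : ℝ) ^ M)⁻¹ with hq
  have hq0 : 0 < q := by positivity
  have hexp : 1 ≤ Real.exp (2 * Real.log 2 * y) :=
    Real.one_le_exp (by have := Real.log_pos one_lt_two; positivity)
  have hsum : ∫ p, edgeWindow M s p.1 * edgeWindow M s (p.2 + c j i * p.1)
      ∂((gaussianReal 0 1).prod (gaussianReal 0 (1 - c j i ^ 2).toNNReal)) +
      (∫ x, edgeWindow M s x ∂(gaussianReal 0 1)) ^ 2 ≤
      (C + (2 * s * Real.exp (2 * s)) ^ 2) * q ^ 2 * Real.exp (2 * Real.log 2 * y) := by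
    rw [show (C + (2 * s * Real.exp (2 * s)) ^ 2) * q ^ 2 * Real.exp (2 * Real.log 2 * y) =
      C * q ^ 2 * Real.exp (2 * Real.log 2 * y) +
      (2 * s * Real.exp (2 * s) * q) ^ 2 * Real.exp (2 * Real.log 2 * y) by ring]
    have h1 : (∫ x, edgeWindow M s x ∂(gaussianReal 0 1)) ^ 2 ≤ (2 * s * Real.exp (2 * s) * q) ^ 2 :=
      pow_le_pow_left₀ hp10 hp1 2
    have h2 : (2 * s * Real.exp (2 * s) * q) ^ 2 ≤
        (2 * s * Real.exp (2 * s) * q) ^ 2 * Real.exp (2 * Real.log 2 * y) :=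
      le_mul_of_one_le_right (sq_nonneg _) hexp
    linarith
  have hfac : δ + L / scale M * |c j i| * (2 * A + 1) ≤ δ * Real.exp (L * (5 + 2 * s) / δ * y) := by
    have h1 : (2 * A + 1) / scale M ≤ (5 + 2 * s) * M := edge_div_scale_le hM hs0
    have h2 : L / scale M * |c j i| * (2 * A + 1) ≤ L * (5 + 2 * s) * y := by
      calc _ = L * |c j i| * ((2 * A + 1) / scale M) := by ring
        _ ≤ L * |c j i| * ((5 + 2 * s) * M) := mul_le_mul_of_nonneg_left h1 (by positivity)
        _ = _ := by rw [hy]; ring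
    have h3 := Real.add_one_le_exp (L * (5 + 2 * s) / δ * y)
    have h4 : δ * (L * (5 + 2 * s) / δ * y + 1) = δ + L * (5 + 2 * s) * y := by
      field_simp; ring
    have h5 := mul_le_mul_of_nonneg_left h3 hδ.le
    linarith
  have hK' : Real.exp (L * (5 + 2 * s) / δ * y) * Real.exp (2 * Real.log 2 * y) ≤
      Real.exp (K * y) := by
    rw [← Real.exp_add, ← add_mul]
    exact Real.exp_le_exp.2 (mul_le_mul_of_nonneg_right (by linarith) hy0)
  have hfac0 : 0 ≤ δ + L / scale M * |c j i| * (2 * A + 1) := by positivity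
  have hsum0 : 0 ≤ (C + (2 * s * Real.exp (2 * s)) ^ 2) * q ^ 2 * Real.exp (2 * Real.log 2 * y) := by
    positivity
  refine hmain.trans ?_
  calc _ ≤ B * (δ * Real.exp (L * (5 + 2 * s) / δ * y)) *
        ((C + (2 * s * Real.exp (2 * s)) ^ 2) * q ^ 2 * Real.exp (2 * Real.log 2 * y)) :=
        mul_le_mul (mul_le_mul_of_nonneg_left hfac hB0) hsum (add_nonneg (integral_nonneg fun p =>
          mul_nonneg (edgeWindow_nonneg _ _ _) (edgeWindow_nonneg _ _ _)) (sq_nonneg _)) (by positivity)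
    _ = B * (C + (2 * s * Real.exp (2 * s)) ^ 2) * δ * q ^ 2 *
        (Real.exp (L * (5 + 2 * s) / δ * y) * Real.exp (2 * Real.log 2 * y)) := by ring
    _ ≤ _ := mul_le_mul_of_nonneg_left hK' (by positivity)

/-! ### The point process of a cloud -/

/-- The cloud as a finite set. -/
def cloudSet {N : ℕ} (x : Spin N → Bool) : Finset (Spin N) := {σ | x σ = true}

section PointProcess

variable {N : ℕ} {Ω : Type*} (M : ℝ) (x : Spin N → Bool) (H : Spin N → Ω → ℝ)

lemma integral_pointProcess (f : ℝ → ℝ) (ω : Ω) :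
    ∫ y, f y ∂(pointProcess M x H ω).toMeasure =
      ∑ σ ∈ cloudSet x, f ((H σ ω - center M) / scale M) := by
  unfold pointProcess cloudSet
  rw [integral_finsetSum_measure fun σ _ => integrable_dirac (by simp)]
  simp only [integral_dirac]

lemma aemeasurable_pointProcess [MeasurableSpace Ω] {P : Measure Ω} {H : Spin N → Ω → ℝ}
    (hH : ∀ σ, AEMeasurable (H σ) P) : AEMeasurable (pointProcess M x H) P := by
  have h1 : Measurable (pointProcess M x fun σ (h : Spin N → ℝ) => h σ) := by
    refine measurable_locFin_iff.2 fun f => ?_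
    simp only [integral_pointProcess]
    exact Finset.measurable_fun_sum _ fun σ _ => f.continuous.measurable.comp
      (((measurable_pi_apply σ).sub_const _).div_const _)
  exact h1.comp_aemeasurable (aemeasurable_pi_lambda _ hH)

end PointProcess

/-- The sum over pairs of distinct points of a cloud which controls their dependence. -/
def pairSum {ι : Type*} [DecidableEq ι] (K M : ℝ) (c : ι → ι → ℝ) (S : Finset ι) : ℝ :=
  ((2 : ℝ) ^ M)⁻¹ ^ 2 * ∑ i ∈ S, ∑ j ∈ S.erase i, Real.exp (K * (M * |c j i|))

lemma pairSum_nonneg {ι : Type*} [DecidableEq ι] (K M : ℝ) (c : ι → ι → ℝ) (S : Finset ι) :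
    0 ≤ pairSum K M c S :=
  mul_nonneg (sq_nonneg _) <| Finset.sum_nonneg fun _ _ => Finset.sum_nonneg fun _ _ =>
    (Real.exp_pos _).le

/-! ### Convergence to the Poisson process under weak correlations -/

lemma tendsto_card_smul_integral {E : Type*} [NormedAddCommGroup E] [NormedSpace ℝ E]
    {M : ℕ → ℝ} (hM : Tendsto M atTop atTop) {m : ℕ → ℕ}
    (hcard : Tendsto (fun N => (m N : ℝ) * ((2 : ℝ) ^ M N)⁻¹) atTop (𝓝 1)) {g : ℝ → E}
    (hg : AEStronglyMeasurable g) {C s : ℝ} (hC : ∀ y, ‖g y‖ ≤ C) (hs : ∀ y, s < |y| → g y = 0) :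
    Tendsto (fun N => (m N : ℝ) • ∫ x, g ((x - center (M N)) / scale (M N)) ∂(gaussianReal 0 1))
      atTop (𝓝 (∫ y, g y ∂intensity)) := by
  have h1 := hcard.smul ((tendsto_integral_pointDensity hg hC hs).comp hM)
  rw [one_smul] at h1
  refine h1.congr' ?_
  filter_upwards [hM.eventually_gt_atTop 0] with N hN
  rw [Function.comp_apply, ← two_rpow_smul_integral_gaussian hN, smul_smul,
    inv_mul_cancel_right₀ (by positivity)]

variable {Ω : Type*} [MeasurableSpace Ω] {Pg : Measure Ω} [IsProbabilityMeasure Pg] {M : ℕ → ℝ}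
  {c : (N : ℕ) → Spin N → Spin N → ℝ} {H : (N : ℕ) → Spin N → Ω → ℝ}
  {x : (N : ℕ) → Spin N → Bool}

lemma couplingError_le {ι Ω : Type*} [DecidableEq ι] [MeasurableSpace Ω] {P : Measure Ω}
    {c : ι → ι → ℝ} {H : ι → Ω → ℝ} {g : ℝ → ℝ} {S : Finset ι} {C M : ℝ} {K : ℕ}
    (h : ∀ i ∈ S, ∀ j ∈ S.erase i, resampleGap P c H g i j ≤
      C * ((2 : ℝ) ^ M)⁻¹ ^ 2 * Real.exp (K * (M * |c j i|))) :
    couplingError P c H g S ≤ (S.card * ∫ x, |g x| ∂(gaussianReal 0 1)) *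
      (∫ x, |g x| ∂(gaussianReal 0 1)) + C * pairSum K M c S := by
  unfold couplingError pairSum
  rw [Finset.sum_add_distrib, Finset.sum_const, nsmul_eq_mul, pow_two, mul_assoc, ← mul_assoc C,
    Finset.mul_sum]
  refine add_le_add_right (Finset.sum_le_sum fun i hi => ?_) _
  rw [Finset.mul_sum]
  exact Finset.sum_le_sum fun j hj => h i hi j hj

/-- Bookkeeping for the next theorem: `a` is the diagonal error, and the middle factor is the `δ`
chosen there, which makes the pair error equally small. -/
lemma mul_le_of_error_bounds {ε E D C p a : ℝ} (hε : 0 < ε) (hE : 0 < E) (hD : 0 ≤ D)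
    (ha : a ≤ ε / (4 * E)) (hp : 0 ≤ p) (hC : p ≤ C) :
    E * (a + D * (ε / (4 * E * (D + 1) * (|C| + 1))) * p) ≤ ε / 2 := by
  have h1 : D * (ε / (4 * E * (D + 1) * (|C| + 1))) * p ≤ ε / (4 * E) := by
    calc _ ≤ (D + 1) * (ε / (4 * E * (D + 1) * (|C| + 1))) * (|C| + 1) := by
          gcongr
          · linarith
          · exact hC.trans ((le_abs_self C).trans (by linarith))
      _ = ε / (4 * E) := by field_simp
  calc _ ≤ E * (ε / (4 * E) + ε / (4 * E)) :=
        mul_le_mul_of_nonneg_left (add_le_add ha h1) hE.le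
    _ = ε / 2 := by field_simp; norm_num

/-- The bound `C` on the pair sums must not depend on `K`: `δ` is chosen from `C`, then `K` from
`δ`, and only then N is taken large. Boundedness of the pair sums for every `K` thus suffices; they
need not tend to zero. -/
theorem convergesToPoisson_of_pairSum (hM : Tendsto M atTop atTop)
    (hH : ∀ᶠ N in atTop, IsUnitGaussian Pg (c N) (H N))
    (hHm : ∀ N σ, AEMeasurable (H N σ) Pg)
    (hcard : Tendsto (fun N => ((cloudSet (x N)).card : ℝ) * ((2 : ℝ) ^ M N)⁻¹) atTop (𝓝 1))
    {r₀ : ℝ} (hr₀ : r₀ < 1)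
    (hoff : ∀ᶠ N in atTop, ∀ σ ∈ cloudSet (x N), ∀ τ ∈ (cloudSet (x N)).erase σ, |c N τ σ| ≤ r₀)
    {C : ℝ} (hpair : ∀ K : ℕ, ∀ᶠ N in atTop, pairSum K (M N) (c N) (cloudSet (x N)) ≤ C) :
    ConvergesToPoisson Pg (fun N => pointProcess (M N) (x N) (H N)) intensity := by
  refine ⟨poissonLaw intensity, isPoissonProcessLaw_poissonLaw intensity,
    tendstoInDistribution_of_charFunctional
      (fun N => aemeasurable_pointProcess (M N) (x N) (hHm N)) _ fun f => ?_⟩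
  obtain ⟨B, hB0, hB⟩ := TestFun.exists_bound f
  obtain ⟨s, hs⟩ := TestFun.exists_tsupport_subset f
  have hfm : Measurable fun y => f y := f.continuous.measurable
  rw [integral_cexp_poissonLaw intensity (f := fun y => f y) hfm hs
    (continuous_integral_test f).measurable]
  simp only [integral_pointProcess]
  let g : ℝ → ℝ → ℝ := fun M x => f ((x - center M) / scale M)
  have hgm : ∀ M, Measurable (g M) := fun M =>
    hfm.comp (by fun_prop : Measurable fun x : ℝ => (x - center M) / scale M)
  have hcexp : Measurable fun y => Complex.exp ((f y : ℂ) * Complex.I) - 1 :=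
    ((Complex.measurable_ofReal.comp hfm).mul_const _).cexp.sub_const 1
  have hlim1 := tendsto_card_smul_integral hM hcard hcexp.aestronglyMeasurable (C := 2) (s := s)
    (fun y => (norm_sub_le _ _).trans (by rw [norm_cexp_ofReal_mul_I, norm_one]; norm_num))
    (fun y hy => by simp [hs y hy])
  have hlim2 := tendsto_card_smul_integral hM hcard hfm.abs.aestronglyMeasurable
    (C := B) (s := s) (fun y => by simpa using hB y) (fun y hy => by simp [hs y hy])
  set I := ∫ y, |f y| ∂intensity with hI
  have hq : Tendsto (fun N => ((2 : ℝ) ^ M N)⁻¹) atTop (𝓝 0) :=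
    ((tendsto_rpow_atTop_of_base_gt_one 2 one_lt_two).comp hM).inv_tendsto_atTop
  have hlim3 : Tendsto (fun N => ∫ x, |g (M N) x| ∂(gaussianReal 0 1)) atTop (𝓝 0) := by
    have h1 := (tendsto_integral_pointDensity hfm.abs.aestronglyMeasurable
      (C := B) (s := s) (fun y => by simpa using hB y) (fun y hy => by simp [hs y hy])).comp hM
    have h2 := hq.mul h1
    rw [zero_mul] at h2
    refine h2.congr' ?_
    filter_upwards [hM.eventually_gt_atTop 0] with N hN
    rw [Function.comp_apply, ← two_rpow_smul_integral_gaussian hN, smul_eq_mul,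
      inv_mul_cancel_left₀ (by positivity)]
  have hmain : Tendsto (fun N =>
      ∫ ω, Complex.exp ((∑ σ ∈ cloudSet (x N), g (M N) (H N σ ω) : ℝ) * Complex.I) ∂Pg -
      Complex.exp ((cloudSet (x N)).card *
        ∫ x, (Complex.exp (g (M N) x * Complex.I) - 1) ∂(gaussianReal 0 1))) atTop (𝓝 0) := by
    rw [tendsto_zero_iff_norm_tendsto_zero, Metric.tendsto_nhds]
    intro ε hε
    obtain ⟨D, hD0, hD⟩ := exists_resampleGap_bound f hr₀
    set E := Real.exp (2 * (I + 1)) with hE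
    have hE0 : 0 < E := Real.exp_pos _
    -- `E` bounds the exponential prefactor, `D` is the resampling constant and `C` bounds the pair
    -- sum; each of the two error terms becomes at most `ε/4`.
    set δ := ε / (4 * E * (D + 1) * (|C| + 1)) with hδ
    have hδ0 : 0 < δ := by positivity
    obtain ⟨K, hK⟩ := hD δ hδ0
    have hlim4 := hlim2.mul hlim3
    rw [mul_zero] at hlim4
    filter_upwards [hM.eventually hK, hH, hoff, hpair K, hlim2.eventually_le_const (lt_add_one I),
      hlim4.eventually_le_const (show 0 < ε / (4 * E) by positivity)] with N h1 h2 h3 h4 h5 h6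
    rw [Real.dist_eq, sub_zero, abs_of_nonneg (norm_nonneg _)]
    have e1 := norm_charFunctional_sub_le h2 (cloudSet (x N)) (hgm (M N)) (fun y => hB _)
    have e2 : couplingError Pg (c N) (H N) (g (M N)) (cloudSet (x N)) ≤ _ :=
      couplingError_le (C := D * δ) (M := M N) (K := K) fun σ hσ τ hτ => h1 h2 σ τ (h3 σ hσ τ hτ)
    rw [smul_eq_mul] at h5 h6
    have e3 := mul_le_of_error_bounds hε hE0 hD0 h6
      (pairSum_nonneg _ _ _ _) h4
    refine lt_of_le_of_lt (e1.trans ?_) (half_lt_self hε)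
    refine le_trans (mul_le_mul (Real.exp_le_exp.2 (by linarith)) e2 ?_ hE0.le) e3
    exact Finset.sum_nonneg fun i _ => add_nonneg (sq_nonneg _) <| Finset.sum_nonneg fun j _ =>
      integral_nonneg fun p => mul_nonneg (abs_nonneg _) (abs_nonneg _)
  have hlim5 := (Complex.continuous_exp.tendsto _).comp hlim1
  refine (hmain.add hlim5).congr' (.of_forall fun N => ?_) |>.trans (le_of_eq (by rw [zero_add]))
  simp only [Function.comp_apply, Complex.real_smul, Complex.ofReal_natCast, g]
  ring

/-! ### Second moments of linear statistics -/

/-- A sequence of unit Gaussian fields on the hypercube together with clouds of about `2 ^ M`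
points, on which the correlations are bounded away from one and moderate in the mean. -/
structure IsModerateCloud {Ω : Type*} [MeasurableSpace Ω] (Pg : Measure Ω) (M : ℕ → ℝ)
    (c : (N : ℕ) → Spin N → Spin N → ℝ) (H : (N : ℕ) → Spin N → Ω → ℝ)
    (x : (N : ℕ) → Spin N → Bool) : Prop where
  tendsto : Tendsto M atTop atTop
  unit : ∀ᶠ N in atTop, IsUnitGaussian Pg (c N) (H N)
  aemeasurable : ∀ N σ, AEMeasurable (H N σ) Pg
  card : Tendsto (fun N => ((cloudSet (x N)).card : ℝ) * ((2 : ℝ) ^ M N)⁻¹) atTop (𝓝 1)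
  offDiag : ∃ r₀ : ℝ, r₀ < 1 ∧
    ∀ᶠ N in atTop, ∀ σ ∈ cloudSet (x N), ∀ τ ∈ (cloudSet (x N)).erase σ, |c N τ σ| ≤ r₀
  pairs : ∃ C : ℝ, ∀ᶠ N in atTop, pairSum (2 * Real.log 2) (M N) (c N) (cloudSet (x N)) ≤ C

lemma IsUnitGaussian.integral_edgeWindow_mul {ι Ω : Type*} [Countable ι] [MeasurableSpace Ω]
    {P : Measure Ω} {c : ι → ι → ℝ} {H : ι → Ω → ℝ} (h : IsUnitGaussian P c H) (M s : ℝ)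
    (i j : ι) :
    ∫ ω, edgeWindow M s (H i ω) * edgeWindow M s (H j ω) ∂P =
      ((gaussianReal 0 1).prod (gaussianReal 0 (1 - c j i ^ 2).toNNReal)).real
        {p | |(p.1 - center M) / scale M| ≤ s ∧
          |(p.2 + c j i * p.1 - center M) / scale M| ≤ s} := by
  have := h.isProbabilityMeasure_residLaw i
  have hw := measurable_edgeWindow M s
  have h1 := h.integral_eq i (Φ := fun p : ℝ × (ι → ℝ) =>
    edgeWindow M s p.1 * edgeWindow M s (p.2 j + c j i * p.1))
    (by fun_prop : Measurable _).stronglyMeasurable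
  simp only [← eq_resid_add] at h1
  rw [h1, ← integral_edgeWindow_pair]
  have h2 : (gaussianReal 0 1).prod (gaussianReal 0 (1 - c j i ^ 2).toNNReal) =
      ((gaussianReal 0 1).prod (residLaw P c H i)).map (Prod.map id fun y => y j) := by
    rw [← h.residLaw_map_eval i j, ← Measure.map_prod_map _ _ measurable_id (measurable_pi_apply j),
      Measure.map_id]
  rw [h2, integral_map (measurable_id.prodMap (measurable_pi_apply j)).aemeasurable
    (by fun_prop : Measurable fun p : ℝ × ℝ =>
      edgeWindow M s p.1 * edgeWindow M s (p.2 + c j i * p.1)).aestronglyMeasurable]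
  rfl

section

variable {Ω : Type*} [MeasurableSpace Ω] {Pg : Measure Ω} [IsProbabilityMeasure Pg] {M : ℕ → ℝ}
  {c : (N : ℕ) → Spin N → Spin N → ℝ} {H : (N : ℕ) → Spin N → Ω → ℝ}
  {x : (N : ℕ) → Spin N → Bool}

lemma IsUnitGaussian.integral_sum_edgeWindow_sq {ι Ω : Type*} [Countable ι] [DecidableEq ι]
    [MeasurableSpace Ω] {P : Measure Ω} {c : ι → ι → ℝ} {H : ι → Ω → ℝ}
    (h : IsUnitGaussian P c H) {M s C : ℝ} (S : Finset ι)
    (hC : ∀ i ∈ S, ∀ j ∈ S.erase i,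
      ((gaussianReal 0 1).prod (gaussianReal 0 (1 - c j i ^ 2).toNNReal)).real
        {p | |(p.1 - center M) / scale M| ≤ s ∧
          |(p.2 + c j i * p.1 - center M) / scale M| ≤ s} ≤
      C * ((2 : ℝ) ^ M)⁻¹ ^ 2 * Real.exp (2 * Real.log 2 * (M * |c j i|))) :
    ∫ ω, (∑ i ∈ S, edgeWindow M s (H i ω)) ^ 2 ∂P ≤
      S.card * ∫ x, edgeWindow M s x ∂(gaussianReal 0 1) +
        C * pairSum (2 * Real.log 2) M c S := by
  have := h.gaussian.isProbabilityMeasure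
  have hm : ∀ i, AEMeasurable (fun ω => edgeWindow M s (H i ω)) P := fun i =>
    (measurable_edgeWindow M s).comp_aemeasurable (h.aemeasurable i)
  have hb : ∀ i ω, ‖edgeWindow M s (H i ω)‖ ≤ 1 := fun i ω => by
    rw [Real.norm_of_nonneg (edgeWindow_nonneg _ _ _)]; exact edgeWindow_le_one _ _ _
  have hi : ∀ i j, Integrable (fun ω => edgeWindow M s (H i ω) * edgeWindow M s (H j ω)) P :=
    fun i j => Integrable.of_bound ((hm i).mul (hm j)).aestronglyMeasurable 1
      (.of_forall fun ω => by
        rw [norm_mul]; exact mul_le_one₀ (hb _ _) (norm_nonneg _) (hb _ _))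
  have e : ∀ ω, (∑ i ∈ S, edgeWindow M s (H i ω)) ^ 2 =
      ∑ i ∈ S, (edgeWindow M s (H i ω) * edgeWindow M s (H i ω) +
        ∑ j ∈ S.erase i, edgeWindow M s (H i ω) * edgeWindow M s (H j ω)) := by
    intro ω
    rw [pow_two, Finset.sum_mul]
    refine Finset.sum_congr rfl fun i hi => ?_
    rw [Finset.mul_sum, Finset.add_sum_erase S (fun j => edgeWindow M s (H i ω) *
      edgeWindow M s (H j ω)) hi]
  simp only [e]
  have hi' : ∀ i ∈ S, Integrable (fun ω => edgeWindow M s (H i ω) * edgeWindow M s (H i ω) +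
        ∑ j ∈ S.erase i, edgeWindow M s (H i ω) * edgeWindow M s (H j ω)) P := fun i _ =>
    (hi i i).add (integrable_finsetSum _ fun j _ => hi i j)
  rw [integral_finsetSum _ hi']
  have h1 : ∀ i ∈ S, ∫ ω, (edgeWindow M s (H i ω) * edgeWindow M s (H i ω) +
        ∑ j ∈ S.erase i, edgeWindow M s (H i ω) * edgeWindow M s (H j ω)) ∂P ≤
      ∫ x, edgeWindow M s x ∂(gaussianReal 0 1) + ∑ j ∈ S.erase i,
        C * ((2 : ℝ) ^ M)⁻¹ ^ 2 * Real.exp (2 * Real.log 2 * (M * |c j i|)) := by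
    intro i his
    rw [integral_add (hi i i) (integrable_finsetSum _ fun j _ => hi i j),
      integral_finsetSum _ fun j _ => hi i j]
    refine add_le_add ?_ (Finset.sum_le_sum fun j hj => ?_)
    · rw [← h.map_eq i, integral_map (h.aemeasurable i)
        (measurable_edgeWindow M s).aestronglyMeasurable]
      refine integral_mono (hi i i) (Integrable.of_bound (hm i).aestronglyMeasurable 1
        (.of_forall (hb i))) fun ω => ?_
      exact mul_le_of_le_one_left (edgeWindow_nonneg _ _ _) (edgeWindow_le_one _ _ _)
    · rw [h.integral_edgeWindow_mul]
      exact hC i his j hj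
  refine (Finset.sum_le_sum h1).trans (le_of_eq ?_)
  rw [Finset.sum_add_distrib, Finset.sum_const, nsmul_eq_mul, pairSum, ← mul_assoc, Finset.mul_sum]
  simp only [Finset.mul_sum]

/-- The statistic is dominated by the number of points in a window. Its second moment splits into a
diagonal, of the order of the mean, and pairs, for which the exponent `2 log 2` in the pair sum is
exactly what `exists_pair_bound` asks for. -/
lemma IsModerateCloud.exists_secondMoment_bound (h : IsModerateCloud Pg M c H x) (f : TestFun) :
    ∃ D : ℝ, 0 ≤ D ∧ ∀ᶠ N in atTop,
      ∫ ω, (∫ y, f y ∂(pointProcess (M N) (x N) (H N) ω).toMeasure) ^ 2 ∂Pg ≤ D := by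
  obtain ⟨B, hB0, hB⟩ := TestFun.exists_bound f
  obtain ⟨s, hs⟩ := TestFun.exists_tsupport_subset f
  have hs0 : (0 : ℝ) ≤ s := Nat.cast_nonneg s
  obtain ⟨r₀, hr₀, hoff⟩ := h.offDiag
  obtain ⟨C, hC0, hC⟩ := exists_pair_bound hs0 hr₀
  obtain ⟨D, hD⟩ := h.pairs
  refine ⟨B ^ 2 * (2 * (2 * s * Real.exp (2 * s)) + C * |D|), by positivity, ?_⟩
  filter_upwards [hoff, hD, h.unit, h.tendsto.eventually (eventually_scale_mul_le_center s),
    h.tendsto.eventually_ge_atTop 1, h.card.eventually_le_const one_lt_two] with N h1 h2 h3 h4 h5 h6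
  simp only [integral_pointProcess]
  have e1 := h3.integral_sum_edgeWindow_sq (s := s) (cloudSet (x N)) fun σ hσ τ hτ =>
    hC (M N) h5 h4 _ (h1 σ hσ τ hτ)
  have hm : ∀ σ, AEMeasurable (fun ω => edgeWindow (M N) s (H N σ ω)) Pg := fun σ =>
    (measurable_edgeWindow (M N) s).comp_aemeasurable (h3.aemeasurable σ)
  have e2 : ∫ ω, (∑ σ ∈ cloudSet (x N), f ((H N σ ω - center (M N)) / scale (M N))) ^ 2 ∂Pg ≤
      ∫ ω, B ^ 2 * (∑ σ ∈ cloudSet (x N), edgeWindow (M N) s (H N σ ω)) ^ 2 ∂Pg := by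
    refine integral_mono_of_nonneg (.of_forall fun ω => sq_nonneg _) ?_ (.of_forall fun ω => ?_)
    · refine (Integrable.of_bound (C := ((cloudSet (x N)).card : ℝ) ^ 2)
        ((Finset.aemeasurable_fun_sum _ fun σ _ => hm σ).pow_const 2).aestronglyMeasurable
        (.of_forall fun ω => ?_)).const_mul _
      have h0 : 0 ≤ ∑ σ ∈ cloudSet (x N), edgeWindow (M N) s (H N σ ω) :=
        Finset.sum_nonneg fun _ _ => edgeWindow_nonneg _ _ _
      rw [norm_pow, Real.norm_of_nonneg h0]
      refine pow_le_pow_left₀ h0 ((Finset.sum_le_card_nsmul _ _ 1 fun σ _ =>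
        edgeWindow_le_one _ _ _).trans (by simp)) 2
    · simp only
      rw [← mul_pow, Finset.mul_sum]
      refine sq_le_sq' ?_ ?_
      · rw [← Finset.sum_neg_distrib]
        refine Finset.sum_le_sum fun σ _ => (abs_le.1 (abs_le_edgeWindow hB0 hB hs)).1
      · exact Finset.sum_le_sum fun σ _ => (abs_le.1 (abs_le_edgeWindow hB0 hB hs)).2
  refine e2.trans ?_
  rw [integral_const_mul]
  refine mul_le_mul_of_nonneg_left (e1.trans (add_le_add ?_ ?_)) (sq_nonneg B)
  · calc _ ≤ ((cloudSet (x N)).card : ℝ) * (2 * s * Real.exp (2 * s) * ((2 : ℝ) ^ M N)⁻¹) :=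
          mul_le_mul_of_nonneg_left (integral_edgeWindow_le h5 hs0) (Nat.cast_nonneg _)
      _ = ((cloudSet (x N)).card * ((2 : ℝ) ^ M N)⁻¹) * (2 * s * Real.exp (2 * s)) := by ring
      _ ≤ _ := mul_le_mul_of_nonneg_right h6 (by positivity)
  · exact mul_le_mul_of_nonneg_left (h2.trans (le_abs_self D)) hC0

lemma integral_pointProcess_eq {N : ℕ} (hu : IsUnitGaussian Pg (c N) (H N)) {g : ℝ → ℝ}
    (hg : Measurable g) {B : ℝ} (hB : ∀ y, |g y| ≤ B) (M : ℝ) (S : Finset (Spin N)) :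
    ∫ ω, ∑ σ ∈ S, g ((H N σ ω - center M) / scale M) ∂Pg =
      S.card * ∫ y, g ((y - center M) / scale M) ∂(gaussianReal 0 1) := by
  have hgm : Measurable fun y => g ((y - center M) / scale M) := by fun_prop
  have hi : ∀ σ ∈ S, Integrable (fun ω => g ((H N σ ω - center M) / scale M)) Pg := fun σ _ =>
    Integrable.of_bound (hgm.comp_aemeasurable (hu.aemeasurable σ)).aestronglyMeasurable B
      (.of_forall fun ω => hB _)
  rw [integral_finsetSum _ hi]
  rw [← nsmul_eq_mul, ← Finset.sum_const]
  refine Finset.sum_congr rfl fun σ _ => ?_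
  rw [← hu.map_eq σ, integral_map (hu.aemeasurable σ) hgm.aestronglyMeasurable]

lemma IsModerateCloud.tendsto_mean (h : IsModerateCloud Pg M c H x) (f : TestFun) :
    Tendsto (fun N => ∫ ω, (∫ y, f y ∂(pointProcess (M N) (x N) (H N) ω).toMeasure) ∂Pg) atTop
      (𝓝 (∫ y, f y ∂intensity)) := by
  obtain ⟨B, hB0, hB⟩ := TestFun.exists_bound f
  obtain ⟨s, hs⟩ := TestFun.exists_tsupport_subset f
  have hfm : Measurable fun y => f y := f.continuous.measurable
  refine (tendsto_card_smul_integral h.tendsto h.card hfm.aestronglyMeasurable (C := B) hB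
    hs).congr' ?_
  filter_upwards [h.unit] with N hu
  simp only [integral_pointProcess]
  rw [integral_pointProcess_eq hu hfm hB, smul_eq_mul]

end

lemma tendsto_integral_of_tendstoInDistribution {Ω E : Type*} [MeasurableSpace Ω]
    {P : Measure Ω} [IsProbabilityMeasure P] [TopologicalSpace E] [MeasurableSpace E]
    [BorelSpace E] {ξ : ℕ → Ω → E} {Q : Measure E} [IsProbabilityMeasure Q]
    (h : TendstoInDistribution ξ atTop (id : E → E) (fun _ => P) Q) {F : E → ℝ}
    (hF : Continuous F) {C : ℝ} (hC : ∀ m, |F m| ≤ C) :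
    Tendsto (fun N => ∫ ω, F (ξ N ω) ∂P) atTop (𝓝 (∫ m, F m ∂Q)) := by
  have h1 := ProbabilityMeasure.tendsto_iff_forall_integral_tendsto.1 h.tendsto
    (BoundedContinuousFunction.ofNormedAddCommGroup F hF C hC)
  simp only [ProbabilityMeasure.coe_mk, Measure.map_id,
    BoundedContinuousFunction.coe_ofNormedAddCommGroup] at h1
  refine h1.congr fun N => ?_
  rw [integral_map (h.forall_aemeasurable N) hF.measurable.aestronglyMeasurable]

/-! ### Identification of a Poisson limit and convergence in mean of linear statistics -/

section Limit

variable {Ω : Type*} [MeasurableSpace Ω] {Pg : Measure Ω} [IsProbabilityMeasure Pg] {M : ℕ → ℝ}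
  {c : (N : ℕ) → Spin N → Spin N → ℝ} {H : (N : ℕ) → Spin N → Ω → ℝ}
  {x : (N : ℕ) → Spin N → Bool}

lemma integrable_comp_integral_pointProcess {N : ℕ} {H : Spin N → Ω → ℝ}
    (hH : ∀ σ, AEMeasurable (H σ) Pg) (f : TestFun) (M : ℝ) (x : Spin N → Bool) {Ψ : ℝ → ℝ}
    (hΨ : Continuous Ψ) :
    Integrable (fun ω => Ψ (∫ y, f y ∂(pointProcess M x H ω).toMeasure)) Pg := by
  obtain ⟨B, hB0, hB⟩ := TestFun.exists_bound f
  simp only [integral_pointProcess]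
  set R := (cloudSet x).card * B with hR
  obtain ⟨C, hC⟩ := (isCompact_Icc (a := -R) (b := R)).exists_bound_of_continuousOn hΨ.continuousOn
  have hm : AEMeasurable (fun ω => ∑ σ ∈ cloudSet x, f ((H σ ω - center M) / scale M)) Pg :=
    Finset.aemeasurable_fun_sum _ fun σ _ => f.continuous.measurable.comp_aemeasurable
      (((hH σ).sub_const _).div_const _)
  refine Integrable.of_bound (hΨ.measurable.comp_aemeasurable hm).aestronglyMeasurable C
    (.of_forall fun ω => hC _ (abs_le.1 ?_))
  refine (Finset.abs_sum_le_sum_abs _ _).trans ((Finset.sum_le_card_nsmul _ _ B fun j _ =>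
    hB _).trans ?_)
  rw [nsmul_eq_mul]

/-- Weak convergence controls bounded functions only. Bounded second moments make the statistic
uniformly integrable, so its mean converges to the mean under the limit, which Campbell's formula
gives as `∫ f dΛ`. -/
lemma IsModerateCloud.integral_test_eq (h : IsModerateCloud Pg M c H x) {Λ : Measure ℝ}
    {Q : ProbabilityMeasure LocFinMeasure} (hQ : IsPoissonProcessLaw Λ Q)
    (hξ : TendstoInDistribution (fun N => pointProcess (M N) (x N) (H N)) atTop
      (id : LocFinMeasure → LocFinMeasure) (fun _ => Pg) (Q : Measure LocFinMeasure))
    (f : TestFun) (hf : ∀ y, 0 ≤ f y) : ∫ y, f y ∂Λ = ∫ y, f y ∂intensity := by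
  have := hQ.locallyFinite
  obtain ⟨D, hD0, hD⟩ := h.exists_secondMoment_bound f
  set m := ∫ y, f y ∂intensity with hm
  let Z : LocFinMeasure → ℝ := fun ξ => ∫ y, f y ∂ξ.toMeasure
  have hZ : Continuous Z := continuous_integral_test f
  have hZ0 : ∀ ξ, 0 ≤ Z ξ := fun ξ => integral_nonneg hf
  -- Clipping at `T` makes the statistic bounded and continuous; since `z ≤ min z T + z²/T`, it
  -- loses at most `D/T` of the mean.
  have hclip : ∀ T : ℝ, 0 < T → (∫ ξ, min (Z ξ) T ∂(Q : Measure LocFinMeasure)) ≤ m ∧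
      m - D / T ≤ ∫ ξ, min (Z ξ) T ∂(Q : Measure LocFinMeasure) := by
    intro T hT
    have h1 := tendsto_integral_of_tendstoInDistribution hξ (F := fun ξ => min (Z ξ) T)
      (hZ.min continuous_const) (C := T) fun ξ => by
        rw [abs_of_nonneg (le_min (hZ0 ξ) hT.le)]; exact min_le_right _ _
    have h2 := h.tendsto_mean f
    have hi : ∀ N, ∀ Ψ : ℝ → ℝ, Continuous Ψ →
        Integrable (fun ω => Ψ (Z (pointProcess (M N) (x N) (H N) ω))) Pg := fun N Ψ hΨ =>
      integrable_comp_integral_pointProcess (h.aemeasurable N) f (M N) (x N) hΨ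
    refine ⟨le_of_tendsto_of_tendsto' h1 h2 fun N => integral_mono
      (hi N (fun z => min z T) (by fun_prop)) (hi N id continuous_id) fun ω => min_le_left _ _, ?_⟩
    refine le_of_tendsto_of_tendsto (h2.sub_const (D / T)) h1 ?_
    filter_upwards [hD] with N hN
    have h3 : ∫ ω, Z (pointProcess (M N) (x N) (H N) ω) ∂Pg ≤
        ∫ ω, (min (Z (pointProcess (M N) (x N) (H N) ω)) T +
          (Z (pointProcess (M N) (x N) (H N) ω)) ^ 2 / T) ∂Pg := by
      refine integral_mono (hi N id continuous_id) (hi N (fun z => min z T + z ^ 2 / T)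
        (by fun_prop)) fun ω => ?_
      simp only
      have hz := hZ0 (pointProcess (M N) (x N) (H N) ω)
      generalize Z (pointProcess (M N) (x N) (H N) ω) = z at hz ⊢
      rcases le_total z T with hzT | hzT
      · rw [min_eq_left hzT]; have : 0 ≤ z ^ 2 / T := by positivity
        linarith
      · have : z ≤ z ^ 2 / T := by rw [le_div_iff₀ hT]; nlinarith
        have : 0 ≤ min z T := le_min hz hT.le
        linarith
    rw [integral_add (hi N (fun z => min z T) (by fun_prop)) (hi N (fun z => z ^ 2 / T)
      (by fun_prop)), integral_div] at h3
    have h4 := div_le_div_of_nonneg_right hN hT.le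
    linarith
  have hfm : Measurable fun y => f y := f.continuous.measurable
  have hmono : Tendsto (fun n : ℕ => ∫⁻ ξ, ENNReal.ofReal (min (Z ξ) ((n : ℝ) + 1))
      ∂(Q : Measure LocFinMeasure)) atTop
      (𝓝 (∫⁻ ξ, ENNReal.ofReal (Z ξ) ∂(Q : Measure LocFinMeasure))) := by
    refine lintegral_tendsto_of_tendsto_of_monotone (fun n =>
      (hZ.measurable.min measurable_const).ennreal_ofReal.aemeasurable)
      (.of_forall fun ξ a b hab => ?_) (.of_forall fun ξ => ?_)
    · refine ENNReal.ofReal_le_ofReal (min_le_min_left _ ?_)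
      have : (a : ℝ) ≤ b := Nat.cast_le.2 hab
      linarith
    · refine (ENNReal.continuous_ofReal.tendsto _).comp (tendsto_const_nhds.congr' ?_)
      obtain ⟨k, hk⟩ := exists_nat_ge (Z ξ)
      filter_upwards [eventually_ge_atTop k] with n hn
      have : (k : ℝ) ≤ n := Nat.cast_le.2 hn
      rw [min_eq_left (by linarith)]
  have hlim : Tendsto (fun n : ℕ => ∫ ξ, min (Z ξ) ((n : ℝ) + 1) ∂(Q : Measure LocFinMeasure))
      atTop (𝓝 m) := by
    refine tendsto_of_tendsto_of_tendsto_of_le_of_le (g := fun n : ℕ => m - D / ((n : ℝ) + 1)) ?_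
      tendsto_const_nhds (fun n => (hclip _ (by positivity)).2) fun n => (hclip _ (by positivity)).1
    have h1 := (tendsto_one_div_add_atTop_nhds_zero_nat (𝕜 := ℝ)).const_mul D
    rw [mul_zero] at h1
    have h2 := h1.const_sub m
    rw [sub_zero] at h2
    exact h2.congr fun n => by rw [mul_one_div]
  have hlim' : Tendsto (fun n : ℕ => ∫⁻ ξ, ENNReal.ofReal (min (Z ξ) ((n : ℝ) + 1))
      ∂(Q : Measure LocFinMeasure)) atTop (𝓝 (ENNReal.ofReal m)) := by
    refine ((ENNReal.continuous_ofReal.tendsto _).comp hlim).congr fun n => ?_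
    rw [Function.comp_apply, ofReal_integral_eq_lintegral_ofReal]
    · refine Integrable.of_bound (hZ.min continuous_const).measurable.aestronglyMeasurable
        ((n : ℝ) + 1) (.of_forall fun ξ => ?_)
      rw [Real.norm_of_nonneg (le_min (hZ0 ξ) (by positivity))]; exact min_le_right _ _
    · exact .of_forall fun ξ => le_min (hZ0 ξ) (by positivity)
  have e1 := tendsto_nhds_unique hmono hlim'
  have e2 : ∫⁻ ξ, ENNReal.ofReal (Z ξ) ∂(Q : Measure LocFinMeasure) =
      ENNReal.ofReal (∫ y, f y ∂Λ) := by
    rw [ofReal_integral_eq_lintegral_ofReal (f.integrable Λ) (.of_forall hf),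
      ← hQ.lintegral_lintegral hfm.ennreal_ofReal]
    refine lintegral_congr fun ξ => ?_
    exact ofReal_integral_eq_lintegral_ofReal (f.integrable ξ.toMeasure) (.of_forall hf)
  rw [e2] at e1
  exact (ENNReal.ofReal_eq_ofReal_iff (integral_nonneg hf) (integral_nonneg hf)).1 e1

lemma IsModerateCloud.eq_intensity (h : IsModerateCloud Pg M c H x) {Λ : Measure ℝ}
    {Q : ProbabilityMeasure LocFinMeasure} (hQ : IsPoissonProcessLaw Λ Q)
    (hξ : TendstoInDistribution (fun N => pointProcess (M N) (x N) (H N)) atTop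
      (id : LocFinMeasure → LocFinMeasure) (fun _ => Pg) (Q : Measure LocFinMeasure)) :
    Λ = intensity := by
  have := hQ.locallyFinite
  refine Measure.ext_of_integral_eq_on_compactlySupported_nnreal fun f => ?_
  let g : TestFun := ⟨⟨fun y => (f y : ℝ), NNReal.continuous_coe.comp f.continuous⟩,
    HasCompactSupport.comp_left (g := ((↑) : NNReal → ℝ)) f.hasCompactSupport rfl⟩
  exact h.integral_test_eq hQ hξ g fun y => (f y).2

/-- The relative variance of a Poisson count is the reciprocal of its mean, and μ gives large mass
to long intervals on the negative side. The function `f` lies between the indicators of such an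
interval and of a slight thickening `B`, so the count in `B`, whose second moment is explicit,
dominates the statistic. -/
lemma exists_intensity_test {ε : ℝ} (hε : 0 < ε) (hε1 : ε ≤ 1) : ∃ (f : TestFun) (B : Set ℝ),
    (∀ y, 0 ≤ f y) ∧ MeasurableSet B ∧ Bornology.IsBounded B ∧
    (∀ y, f y ≤ B.indicator (fun _ => 1) y) ∧ 0 < ∫ y, f y ∂intensity ∧
    intensity.real B ^ 2 + intensity.real B ≤ (1 + ε) * (∫ y, f y ∂intensity) ^ 2 := by
  -- The density is at least `1/√π` on the negative half-line, so `[-s, 0]` has mass at least `4/ε`.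
  set s := √Real.pi * (4 / ε) with hs
  have hπ : 0 < √Real.pi := Real.sqrt_pos.2 Real.pi_pos
  have hs0 : 0 < s := by positivity
  set A := Set.Icc (-s) 0 with hA
  have hAc : IsCompact A := isCompact_Icc
  set a := intensity.real A with ha
  have hind : ∀ {S : Set ℝ}, MeasurableSet S →
      intensity.real S = ∫ y, S.indicator (fun _ => (1 : ℝ)) y ∂intensity := fun hS => by
    rw [integral_indicator hS, setIntegral_const, smul_eq_mul, mul_one]
  have haε : 4 / ε ≤ a := by
    have e1 : a = ∫ y in A, limitDensity y := by
      rw [ha, hind measurableSet_Icc, integral_intensity, ← integral_indicator measurableSet_Icc]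
      refine integral_congr_ae (.of_forall fun y => ?_)
      by_cases hy : y ∈ Set.Icc (-s) 0
      · simp only [Set.indicator_of_mem hy, smul_eq_mul, mul_one]
      · simp only [Set.indicator_of_notMem hy, smul_zero]
    have e2 : ∫ y in A, 1 / √Real.pi ≤ ∫ y in A, limitDensity y := by
      refine setIntegral_mono_on (integrableOn_const (by simp [A]))
        continuous_limitDensity.integrableOn_Icc measurableSet_Icc fun y hy => ?_
      unfold limitDensity
      refine le_mul_of_one_le_right (by positivity) (Real.one_le_exp ?_)
      exact mul_nonneg (by linarith [hy.2]) (Real.sqrt_nonneg _)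
    rw [setIntegral_const, measureReal_def, Real.volume_Icc, ENNReal.toReal_ofReal (by linarith),
      ← e1, hs, smul_eq_mul] at e2
    refine le_trans (le_of_eq ?_) e2
    field_simp
    ring
  have ha0 : 0 < a := lt_of_lt_of_le (by positivity) haε
  have hfin : ∀ {S : Set ℝ}, Bornology.IsBounded S → intensity S ≠ ∞ := fun hS =>
    hS.measure_lt_top.ne
  have hlim : Tendsto (fun r => intensity.real (Metric.cthickening r A)) (𝓝 0) (𝓝 a) :=
    (ENNReal.tendsto_toReal (hfin hAc.isBounded)).comp
      (tendsto_measure_cthickening_of_isCompact hAc)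
  have hev := (hlim.eventually_le_const (show a < (1 + ε / 8) * a by nlinarith)).filter_mono
    (nhdsWithin_le_nhds (s := Set.Ioi 0))
  obtain ⟨η, hη, hη0⟩ := (hev.and self_mem_nhdsWithin).exists
  obtain ⟨g, hg1, hg0, hgc, hgI⟩ := exists_continuous_one_zero_of_isCompact hAc
    (Metric.isOpen_thickening (δ := η) (E := A)).isClosed_compl
    (Set.disjoint_compl_right_iff_subset.2 (Metric.self_subset_thickening hη0 A))
  let f : TestFun := ⟨g, hgc⟩
  have hfB : ∀ y, f y ≤ (Metric.cthickening η A).indicator (fun _ => 1) y := by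
    intro y
    by_cases hy : y ∈ Metric.cthickening η A
    · rw [Set.indicator_of_mem hy]; exact (hgI y).2
    · rw [Set.indicator_of_notMem hy]
      exact (hg0 fun h => hy (Metric.thickening_subset_cthickening _ _ h)).le
  have hm : a ≤ ∫ y, f y ∂intensity := by
    rw [ha, hind measurableSet_Icc]
    refine integral_mono ((integrable_indicator_iff measurableSet_Icc).2
      (integrableOn_const (hfin hAc.isBounded))) (f.integrable _) fun y => ?_
    by_cases hy : y ∈ A
    · rw [Set.indicator_of_mem hy]; exact (hg1 hy).ge
    · rw [Set.indicator_of_notMem hy]; exact (hgI y).1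
  refine ⟨f, Metric.cthickening η A, fun y => (hgI y).1, Metric.isClosed_cthickening.measurableSet,
    hAc.isBounded.cthickening, hfB, ha0.trans_le hm, ?_⟩
  set b := intensity.real (Metric.cthickening η A)
  have hb0 : 0 ≤ b := measureReal_nonneg
  have h1 : b ^ 2 ≤ ((1 + ε / 8) * a) ^ 2 := pow_le_pow_left₀ hb0 hη 2
  have h2 : 4 ≤ a * ε := (div_le_iff₀ hε).1 haε
  have h3 : a ^ 2 ≤ (∫ y, f y ∂intensity) ^ 2 := pow_le_pow_left₀ ha0.le hm 2
  have h4 : b ≤ 2 * a := hη.trans (by nlinarith)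
  have h5 : 4 * a ≤ ε * a ^ 2 := by nlinarith
  have h6 : ((1 + ε / 8) * a) ^ 2 ≤ (1 + ε / 2) * a ^ 2 := by
    rw [mul_pow]; exact mul_le_mul_of_nonneg_right (by nlinarith) (sq_nonneg _)
  have h7 := mul_le_mul_of_nonneg_left h3 (show 0 ≤ 1 + ε by linarith)
  nlinarith

/-- The second moment of the statistic is at most that of the count in `B`, namely `Λ(B)² + Λ(B)`,
so its variance is at most `(η m)²`; an L² bound then gives the L¹ bound. -/
lemma IsPoissonProcessLaw.integral_abs_sub_le {Λ : Measure ℝ}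
    {Q : ProbabilityMeasure LocFinMeasure} (hQ : IsPoissonProcessLaw Λ Q) {f : TestFun}
    (hf : ∀ y, 0 ≤ f y) {B : Set ℝ} (hB : MeasurableSet B) (hBb : Bornology.IsBounded B)
    (hfB : ∀ y, f y ≤ B.indicator (fun _ => 1) y) (hm : 0 < ∫ y, f y ∂Λ) {η : ℝ} (hη : 0 < η)
    (h : Λ.real B ^ 2 + Λ.real B ≤ (1 + η ^ 2) * (∫ y, f y ∂Λ) ^ 2) :
    Integrable (fun ξ : LocFinMeasure => ∫ y, f y ∂ξ.toMeasure) (Q : Measure LocFinMeasure) ∧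
    ∫ ξ : LocFinMeasure, |∫ y, f y ∂ξ.toMeasure - ∫ y, f y ∂Λ| ∂(Q : Measure LocFinMeasure) ≤
      η * ∫ y, f y ∂Λ := by
  have := hQ.locallyFinite
  set m := ∫ y, f y ∂Λ with hmdef
  let Z : LocFinMeasure → ℝ := fun ξ => ∫ y, f y ∂ξ.toMeasure
  have hZ : Measurable Z := (continuous_integral_test f).measurable
  have hZ0 : ∀ ξ, 0 ≤ Z ξ := fun ξ => integral_nonneg hf
  have hfm : Measurable fun y => f y := f.continuous.measurable
  have hfin : Λ B ≠ ∞ := hBb.measure_lt_top.ne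
  have hofZ : ∀ ξ : LocFinMeasure, ENNReal.ofReal (Z ξ) = ∫⁻ y, ENNReal.ofReal (f y) ∂ξ.toMeasure :=
    fun ξ => ofReal_integral_eq_lintegral_ofReal (f.integrable ξ.toMeasure) (.of_forall hf)
  have hZB : ∀ ξ : LocFinMeasure, ENNReal.ofReal (Z ξ) ≤ ξ.toMeasure B := by
    intro ξ
    rw [hofZ, ← lintegral_indicator_one hB]
    refine lintegral_mono fun y => ?_
    by_cases hy : y ∈ B
    · have := hfB y
      rw [Set.indicator_of_mem hy] at this ⊢
      exact ENNReal.ofReal_le_one.2 this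
    · have := hfB y
      rw [Set.indicator_of_notMem hy] at this ⊢
      rw [ENNReal.ofReal_of_nonpos this]
  have hsq : ∫⁻ ξ, ENNReal.ofReal (Z ξ ^ 2) ∂(Q : Measure LocFinMeasure) ≤
      ENNReal.ofReal ((1 + η ^ 2) * m ^ 2) := by
    calc _ ≤ ∫⁻ ξ, ξ.toMeasure B ^ 2 ∂(Q : Measure LocFinMeasure) := by
          refine lintegral_mono fun ξ => ?_
          rw [ENNReal.ofReal_pow (hZ0 ξ)]
          exact pow_le_pow_left₀ zero_le (hZB ξ) 2
      _ = Λ B ^ 2 + Λ B := hQ.lintegral_count_sq hB hBb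
      _ = ENNReal.ofReal (Λ.real B ^ 2 + Λ.real B) := by
          rw [ENNReal.ofReal_add (by positivity) measureReal_nonneg,
            ENNReal.ofReal_pow measureReal_nonneg, ofReal_measureReal hfin]
      _ ≤ _ := ENNReal.ofReal_le_ofReal h
  have hsqi : Integrable (fun ξ => Z ξ ^ 2) (Q : Measure LocFinMeasure) := by
    refine ⟨(hZ.pow_const 2).aestronglyMeasurable, ?_⟩
    rw [hasFiniteIntegral_iff_ofReal (.of_forall fun ξ => sq_nonneg _)]
    exact hsq.trans_lt ENNReal.ofReal_lt_top
  have hL2 : MemLp Z 2 (Q : Measure LocFinMeasure) :=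
    (memLp_two_iff_integrable_sq hZ.aestronglyMeasurable).2 hsqi
  have hZi := hL2.integrable one_le_two
  have hmean : ∫ ξ, Z ξ ∂(Q : Measure LocFinMeasure) = m := by
    have e : ENNReal.ofReal (∫ ξ, Z ξ ∂(Q : Measure LocFinMeasure)) = ENNReal.ofReal m := by
      rw [ofReal_integral_eq_lintegral_ofReal hZi (.of_forall hZ0),
        hmdef, ofReal_integral_eq_lintegral_ofReal (f.integrable Λ) (.of_forall hf),
        ← hQ.lintegral_lintegral hfm.ennreal_ofReal]
      exact lintegral_congr hofZ
    exact (ENNReal.ofReal_eq_ofReal_iff (integral_nonneg hZ0) hm.le).1 e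
  have hsq' : ∫ ξ, Z ξ ^ 2 ∂(Q : Measure LocFinMeasure) ≤ (1 + η ^ 2) * m ^ 2 := by
    rw [← ofReal_integral_eq_lintegral_ofReal hsqi (.of_forall fun ξ => sq_nonneg _)] at hsq
    exact (ENNReal.ofReal_le_ofReal_iff (by positivity)).1 hsq
  refine ⟨hZi, ?_⟩
  -- The bound `|u| ≤ (t + u²/t)/2`, optimized at the standard deviation, replaces Cauchy–Schwarz.
  set t := η * m with ht
  have ht0 : 0 < t := by positivity
  have i3 : Integrable (fun ξ => Z ξ ^ 2 - 2 * m * Z ξ) (Q : Measure LocFinMeasure) :=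
    hsqi.sub (hZi.const_mul (2 * m))
  have i2 : Integrable (fun ξ => (Z ξ ^ 2 - 2 * m * Z ξ + m ^ 2) / t)
      (Q : Measure LocFinMeasure) := (i3.add (integrable_const (m ^ 2))).div_const t
  have i1 : Integrable (fun ξ => (t + (Z ξ ^ 2 - 2 * m * Z ξ + m ^ 2) / t) / 2)
      (Q : Measure LocFinMeasure) :=
    ((integrable_const t).add i2).div_const 2
  have h1 : ∫ ξ, |Z ξ - m| ∂(Q : Measure LocFinMeasure) ≤
      ∫ ξ, (t + (Z ξ ^ 2 - 2 * m * Z ξ + m ^ 2) / t) / 2 ∂(Q : Measure LocFinMeasure) := by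
    refine integral_mono (hZi.sub (integrable_const m)).abs i1 fun ξ => ?_
    simp only
    rw [show Z ξ ^ 2 - 2 * m * Z ξ + m ^ 2 = |Z ξ - m| ^ 2 by rw [sq_abs]; ring,
      le_div_iff₀ two_pos, ← sub_nonneg]
    have : t + |Z ξ - m| ^ 2 / t - |Z ξ - m| * 2 = (|Z ξ - m| - t) ^ 2 / t := by
      field_simp; ring
    rw [this]; positivity
  have hmean2 : ∫ ξ, 2 * m * Z ξ ∂(Q : Measure LocFinMeasure) = 2 * m * m := by
    rw [integral_const_mul, hmean]
  refine h1.trans ?_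
  rw [integral_div, integral_add (integrable_const t) i2, integral_div,
    integral_add i3 (integrable_const (m ^ 2)),
    integral_sub hsqi (hZi.const_mul (2 * m)), hmean2]
  simp only [integral_const, probReal_univ, one_smul]
  have h2 : (∫ ξ, Z ξ ^ 2 ∂(Q : Measure LocFinMeasure) - 2 * m * m + m ^ 2) / t ≤ t := by
    rw [div_le_iff₀ ht0, ht]; nlinarith
  linarith

/-- The L¹ concentration of the limit is carried back to the prelimit by truncation, the tail being
controlled by second moments. -/
lemma IsModerateCloud.eventually_integral_abs_sub_le (h : IsModerateCloud Pg M c H x)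
    {Λ : Measure ℝ} {Q : ProbabilityMeasure LocFinMeasure} (hQ : IsPoissonProcessLaw Λ Q)
    (hξ : TendstoInDistribution (fun N => pointProcess (M N) (x N) (H N)) atTop
      (id : LocFinMeasure → LocFinMeasure) (fun _ => Pg) (Q : Measure LocFinMeasure))
    {η : ℝ} (hη : 0 < η) (hη1 : η ≤ 1) :
    ∃ f : TestFun, (∀ y, 0 ≤ f y) ∧ 0 < ∫ y, f y ∂intensity ∧
      ∀ᶠ N in atTop, ∫ ω, |∫ y, f y ∂(pointProcess (M N) (x N) (H N) ω).toMeasure -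
        ∫ y, f y ∂intensity| ∂Pg ≤ 2 * η * ∫ y, f y ∂intensity := by
  have hΛ := h.eq_intensity hQ hξ
  subst hΛ
  obtain ⟨f, B, hf, hB, hBb, hfB, hm, hfin⟩ := exists_intensity_test (ε := η ^ 2) (by positivity)
    (by nlinarith)
  refine ⟨f, hf, hm, ?_⟩
  obtain ⟨hZi, hQm⟩ := hQ.integral_abs_sub_le hf hB hBb hfB hm hη hfin
  obtain ⟨D, hD0, hD⟩ := h.exists_secondMoment_bound f
  set m := ∫ y, f y ∂intensity with hmdef
  -- With this level the tail contributes at most `ηm/2`; the truncated part is eventually at most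
  -- `3ηm/2`.
  set T := 2 * (2 * D + 2 * m ^ 2) / (η * m) with hT
  have hηm : 0 < η * m := by positivity
  have hT0 : 0 < T := by positivity
  let F : LocFinMeasure → ℝ := fun ξ => min |∫ y, f y ∂ξ.toMeasure - m| T
  have hF : Continuous F :=
    (((continuous_integral_test f).sub continuous_const).abs).min continuous_const
  have hFT : ∀ ξ, |F ξ| ≤ T := fun ξ => by
    rw [abs_of_nonneg (le_min (abs_nonneg _) hT0.le)]; exact min_le_right _ _
  have hlim := tendsto_integral_of_tendstoInDistribution hξ hF hFT
  have hlt : ∫ ξ, F ξ ∂(Q : Measure LocFinMeasure) < 3 / 2 * (η * m) := by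
    refine lt_of_le_of_lt (le_trans (integral_mono (Integrable.of_bound
      hF.measurable.aestronglyMeasurable T (.of_forall hFT)) (hZi.sub (integrable_const m)).abs
      fun ξ => min_le_left _ _) hQm) (by linarith)
  filter_upwards [hlim.eventually_le_const hlt, hD] with N h1 h2
  have hi : ∀ Ψ : ℝ → ℝ, Continuous Ψ → Integrable (fun ω =>
      Ψ (∫ y, f y ∂(pointProcess (M N) (x N) (H N) ω).toMeasure)) Pg := fun Ψ hΨ =>
    integrable_comp_integral_pointProcess (h.aemeasurable N) f (M N) (x N) hΨ
  have h3 : ∫ ω, |∫ y, f y ∂(pointProcess (M N) (x N) (H N) ω).toMeasure - m| ∂Pg ≤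
      ∫ ω, (F (pointProcess (M N) (x N) (H N) ω) +
        (2 * (∫ y, f y ∂(pointProcess (M N) (x N) (H N) ω).toMeasure) ^ 2 + 2 * m ^ 2) / T) ∂Pg := by
    refine integral_mono (hi (fun z => |z - m|) (by fun_prop)) (hi (fun z => min |z - m| T +
      (2 * z ^ 2 + 2 * m ^ 2) / T) (by fun_prop)) fun ω => ?_
    simp only [F]
    generalize ∫ y, f y ∂(pointProcess (M N) (x N) (H N) ω).toMeasure = z
    have h0 : 0 ≤ (2 * z ^ 2 + 2 * m ^ 2) / T := by positivity
    rcases le_total |z - m| T with hz | hz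
    · rw [min_eq_left hz]; linarith
    · have h4 : |z - m| ≤ (2 * z ^ 2 + 2 * m ^ 2) / T := by
        rw [le_div_iff₀ hT0]
        have : |z - m| * T ≤ |z - m| ^ 2 := by nlinarith
        rw [sq_abs] at this
        nlinarith [sq_nonneg (z + m)]
      have : 0 ≤ min |z - m| T := le_min (abs_nonneg _) hT0.le
      linarith
  rw [integral_add (hi (fun z => min |z - m| T) (by fun_prop))
    (hi (fun z => (2 * z ^ 2 + 2 * m ^ 2) / T) (by fun_prop)), integral_div,
    integral_add (hi (fun z => 2 * z ^ 2) (by fun_prop)) (integrable_const _),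
    integral_const_mul] at h3
  simp only [integral_const, probReal_univ, one_smul] at h3
  have h4 : (2 * ∫ ω, (∫ y, f y ∂(pointProcess (M N) (x N) (H N) ω).toMeasure) ^ 2 ∂Pg +
      2 * m ^ 2) / T ≤ η * m / 2 := by
    rw [div_le_iff₀ hT0, hT]
    have : η * m / 2 * (2 * (2 * D + 2 * m ^ 2) / (η * m)) = 2 * D + 2 * m ^ 2 := by
      field_simp
    rw [this]; linarith
  linarith

end Limit

/-! ### A common factor of the field excludes a Poisson limit -/

/-- A centered square integrable variable which, up to a part independent of `H i`, is the
function `q` of `H i`, for every `i`. -/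
structure IsCommonFactor {ι Ω : Type*} [MeasurableSpace Ω] (P : Measure Ω) (H : ι → Ω → ℝ)
    (V : Ω → ℝ) (q : ℝ → ℝ) (W : ι → Ω → ℝ) (C : ℝ) : Prop where
  memLp : MemLp V 2 P
  mean : ∫ ω, V ω ∂P = 0
  sq_le : ∫ ω, V ω ^ 2 ∂P ≤ C
  eq_add : ∀ i, ∀ᵐ ω ∂P, V ω = q (H i ω) + W i ω
  indep : ∀ i, IndepFun (W i) (H i) P
  memLp_rest : ∀ i, MemLp (W i) 2 P
  mean_rest : ∀ i, ∫ ω, W i ω ∂P = 0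
  sq_rest_le : ∀ i, ∫ ω, W i ω ^ 2 ∂P ≤ C

section

variable {ι Ω : Type*} [MeasurableSpace Ω] {P : Measure Ω} {c : ι → ι → ℝ} {H : ι → Ω → ℝ}
  {V : Ω → ℝ} {q g : ℝ → ℝ} {W : ι → Ω → ℝ} {C B κ L : ℝ}

/-- The remainder `W i` is centered and independent of `H i`, so only `q(H i)` correlates with `g(H
i)`. -/
lemma IsCommonFactor.le_integral_mul (hV : IsCommonFactor P H V q W C)
    (h : IsUnitGaussian P c H) (hg : Measurable g) (hg0 : ∀ x, 0 ≤ g x) (hgB : ∀ x, g x ≤ B)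
    (hκ : ∀ x, g x ≠ 0 → κ ≤ q x) (i : ι) :
    Integrable (fun ω => g (H i ω) * V ω) P ∧
    κ * ∫ x, g x ∂(gaussianReal 0 1) ≤ ∫ ω, g (H i ω) * V ω ∂P := by
  have := h.gaussian.isProbabilityMeasure
  have hgm : AEMeasurable (fun ω => g (H i ω)) P := hg.comp_aemeasurable (h.aemeasurable i)
  have hbd : ∀ ω, ‖g (H i ω)‖ ≤ B := fun ω => by rw [Real.norm_of_nonneg (hg0 _)]; exact hgB _
  have i1 : Integrable (fun ω => g (H i ω) * V ω) P :=
    (hV.memLp.integrable one_le_two).bdd_mul hgm.aestronglyMeasurable (.of_forall hbd)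
  have i2 : Integrable (fun ω => g (H i ω) * W i ω) P :=
    ((hV.memLp_rest i).integrable one_le_two).bdd_mul hgm.aestronglyMeasurable (.of_forall hbd)
  have i3 : Integrable (fun ω => g (H i ω)) P :=
    Integrable.of_bound hgm.aestronglyMeasurable B (.of_forall hbd)
  refine ⟨i1, ?_⟩
  have e1 : ∫ ω, g (H i ω) * W i ω ∂P = 0 := by
    have hind : IndepFun (fun ω => g (H i ω)) (W i) P := (hV.indep i).symm.comp hg measurable_id
    rw [hind.integral_fun_mul_eq_mul_integral hgm.aestronglyMeasurable (hV.memLp_rest i).1,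
      hV.mean_rest, mul_zero]
  have e2 : ∫ ω, g (H i ω) ∂P = ∫ x, g x ∂(gaussianReal 0 1) := by
    rw [← h.map_eq i, integral_map (h.aemeasurable i) hg.aestronglyMeasurable]
  have e3 : ∫ ω, (κ * g (H i ω) + g (H i ω) * W i ω) ∂P ≤ ∫ ω, g (H i ω) * V ω ∂P := by
    refine integral_mono_ae ((i3.const_mul κ).add i2) i1 ?_
    filter_upwards [hV.eq_add i] with ω hω
    rw [hω]
    by_cases h0 : g (H i ω) = 0
    · simp [h0]
    · have := mul_le_mul_of_nonneg_left (hκ _ h0) (hg0 (H i ω))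
      linarith
  rwa [integral_add (i3.const_mul κ) i2, integral_const_mul, e1, e2, add_zero] at e3

lemma IsCommonFactor.integral_mul_sq_le (hV : IsCommonFactor P H V q W C)
    (h : IsUnitGaussian P c H) (hg : Measurable g) (hg0 : ∀ x, 0 ≤ g x) (hgB : ∀ x, g x ≤ B)
    (hL : ∀ x, g x ≠ 0 → |q x| ≤ L) (i : ι) :
    Integrable (fun ω => g (H i ω) * V ω ^ 2) P ∧
    ∫ ω, g (H i ω) * V ω ^ 2 ∂P ≤
      (2 * L ^ 2 + 2 * C) * ∫ x, g x ∂(gaussianReal 0 1) := by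
  have := h.gaussian.isProbabilityMeasure
  have hgm : AEMeasurable (fun ω => g (H i ω)) P := hg.comp_aemeasurable (h.aemeasurable i)
  have hbd : ∀ ω, ‖g (H i ω)‖ ≤ B := fun ω => by rw [Real.norm_of_nonneg (hg0 _)]; exact hgB _
  have i1 : Integrable (fun ω => g (H i ω) * V ω ^ 2) P :=
    hV.memLp.integrable_sq.bdd_mul hgm.aestronglyMeasurable (.of_forall hbd)
  have i2 : Integrable (fun ω => g (H i ω) * W i ω ^ 2) P :=
    (hV.memLp_rest i).integrable_sq.bdd_mul hgm.aestronglyMeasurable (.of_forall hbd)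
  have i3 : Integrable (fun ω => g (H i ω)) P :=
    Integrable.of_bound hgm.aestronglyMeasurable B (.of_forall hbd)
  refine ⟨i1, ?_⟩
  have hp : 0 ≤ ∫ x, g x ∂(gaussianReal 0 1) := integral_nonneg hg0
  have e2 : ∫ ω, g (H i ω) ∂P = ∫ x, g x ∂(gaussianReal 0 1) := by
    rw [← h.map_eq i, integral_map (h.aemeasurable i) hg.aestronglyMeasurable]
  have e1 : ∫ ω, g (H i ω) * W i ω ^ 2 ∂P ≤ C * ∫ x, g x ∂(gaussianReal 0 1) := by
    have hind : IndepFun (fun ω => g (H i ω)) (fun ω => W i ω ^ 2) P :=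
      (hV.indep i).symm.comp hg (measurable_id.pow_const 2)
    rw [hind.integral_fun_mul_eq_mul_integral hgm.aestronglyMeasurable
      (hV.memLp_rest i).integrable_sq.1, e2, mul_comm]
    exact mul_le_mul_of_nonneg_right (hV.sq_rest_le i) hp
  have e3 : ∫ ω, g (H i ω) * V ω ^ 2 ∂P ≤
      ∫ ω, (2 * L ^ 2 * g (H i ω) + 2 * (g (H i ω) * W i ω ^ 2)) ∂P := by
    refine integral_mono_ae i1 ((i3.const_mul _).add (i2.const_mul 2)) ?_
    filter_upwards [hV.eq_add i] with ω hω
    rw [hω]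
    by_cases h0 : g (H i ω) = 0
    · simp [h0]
    · have h1 : q (H i ω) ^ 2 ≤ L ^ 2 := sq_le_sq' (abs_le.1 (hL _ h0)).1 (abs_le.1 (hL _ h0)).2
      have h2 : (q (H i ω) + W i ω) ^ 2 ≤ 2 * L ^ 2 + 2 * W i ω ^ 2 := by
        nlinarith [sq_nonneg (q (H i ω) - W i ω)]
      have := mul_le_mul_of_nonneg_left h2 (hg0 (H i ω))
      linarith
  rw [integral_add (i3.const_mul _) (i2.const_mul 2), integral_const_mul, integral_const_mul,
    e2] at e3
  linarith

/-- With `Z = ∑ g(H i)` and `V` centered, `E[Z V] = E[(Z - m) V]`. The left side is at least `κ E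
Z`. On the right, `|V| ≤ K + V²/K` and `|Z - m| ≤ Z + m` give `K E|Z - m| + E[(Z + m) V²]/K`. Only
the second moment of `V`, alone and weighted by each `g(H i)`, is used. -/
lemma IsCommonFactor.le_of_concentration (hV : IsCommonFactor P H V q W C)
    (h : IsUnitGaussian P c H) (S : Finset ι) (hg : Measurable g) (hg0 : ∀ x, 0 ≤ g x)
    (hgB : ∀ x, g x ≤ B) (hκ : ∀ x, g x ≠ 0 → κ ≤ q x) (hL : ∀ x, g x ≠ 0 → |q x| ≤ L)
    {m K : ℝ} (hm : 0 ≤ m) (hK : 0 < K) :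
    κ * (S.card * ∫ x, g x ∂(gaussianReal 0 1)) ≤
      K * ∫ ω, |∑ i ∈ S, g (H i ω) - m| ∂P +
        ((2 * L ^ 2 + 2 * C) * (S.card * ∫ x, g x ∂(gaussianReal 0 1)) + m * C) / K := by
  have := h.gaussian.isProbabilityMeasure
  set p := ∫ x, g x ∂(gaussianReal 0 1)
  have hZi : ∀ i ∈ S, Integrable (fun ω => g (H i ω)) P := fun i _ =>
    Integrable.of_bound (hg.comp_aemeasurable (h.aemeasurable i)).aestronglyMeasurable B
      (.of_forall fun ω => by rw [Real.norm_of_nonneg (hg0 _)]; exact hgB _)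
  have hVi := hV.memLp.integrable one_le_two
  have h1 := fun i => hV.le_integral_mul h hg hg0 hgB hκ i
  have h2 := fun i => hV.integral_mul_sq_le h hg hg0 hgB hL i
  have e1 : ∫ ω, ((∑ i ∈ S, g (H i ω) * V ω) - m * V ω) ∂P = ∑ i ∈ S, ∫ ω, g (H i ω) * V ω ∂P := by
    rw [integral_sub (integrable_finsetSum _ fun i _ => (h1 i).1) (hVi.const_mul m),
      integral_const_mul, hV.mean, mul_zero, sub_zero, integral_finsetSum _ fun i _ => (h1 i).1]
  have iS : Integrable (fun ω => ∑ i ∈ S, g (H i ω) * V ω ^ 2) P :=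
    integrable_finsetSum _ fun i _ => (h2 i).1
  have iA : Integrable (fun ω => |∑ i ∈ S, g (H i ω) - m|) P :=
    ((integrable_finsetSum _ hZi).sub (integrable_const m)).abs
  have iT : Integrable (fun ω => ∑ i ∈ S, g (H i ω) * V ω ^ 2 + m * V ω ^ 2) P :=
    iS.add (hV.memLp.integrable_sq.const_mul m)
  have e2 : ∫ ω, ((∑ i ∈ S, g (H i ω) * V ω) - m * V ω) ∂P ≤
      ∫ ω, (K * |∑ i ∈ S, g (H i ω) - m| +
        (∑ i ∈ S, g (H i ω) * V ω ^ 2 + m * V ω ^ 2) / K) ∂P := by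
    refine integral_mono ((integrable_finsetSum _ fun i _ => (h1 i).1).sub (hVi.const_mul m))
      ((iA.const_mul K).add (iT.div_const K)) fun ω => ?_
    simp only [← Finset.sum_mul]
    have hz : 0 ≤ ∑ i ∈ S, g (H i ω) := Finset.sum_nonneg fun i _ => hg0 _
    generalize ∑ i ∈ S, g (H i ω) = z at hz
    generalize V ω = v
    have a1 : z * v - m * v ≤ |z - m| * |v| := by
      rw [← sub_mul, ← abs_mul]; exact le_abs_self _
    have a2 : |v| ≤ K + v ^ 2 / K := by
      have : K + v ^ 2 / K - |v| = ((K - |v|) ^ 2 + K * |v|) / K := by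
        rw [← sq_abs v]
        generalize |v| = u
        field_simp; ring
      have : 0 ≤ K + v ^ 2 / K - |v| := by rw [this]; positivity
      linarith
    have a3 : |z - m| ≤ z + m := abs_le.2 ⟨by linarith, by linarith⟩
    have a4 := mul_le_mul_of_nonneg_left a2 (abs_nonneg (z - m))
    have a5 := mul_le_mul_of_nonneg_right a3 (show 0 ≤ v ^ 2 / K by positivity)
    calc _ ≤ K * |z - m| + (z + m) * (v ^ 2 / K) := by linarith
      _ = _ := by ring
  rw [e1, integral_add (iA.const_mul K) (iT.div_const K), integral_const_mul, integral_div,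
    integral_add iS (hV.memLp.integrable_sq.const_mul m), integral_const_mul,
    integral_finsetSum _ fun i _ => (h2 i).1] at e2
  have e3 : κ * (S.card * p) ≤ ∑ i ∈ S, ∫ ω, g (H i ω) * V ω ∂P := by
    refine le_trans (le_of_eq ?_) (Finset.sum_le_sum fun i _ => (h1 i).2)
    rw [Finset.sum_const, nsmul_eq_mul]; ring
  have e4 : ∑ i ∈ S, ∫ ω, g (H i ω) * V ω ^ 2 ∂P ≤ (2 * L ^ 2 + 2 * C) * (S.card * p) := by
    refine (Finset.sum_le_sum fun i _ => (h2 i).2).trans (le_of_eq ?_)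
    rw [Finset.sum_const, nsmul_eq_mul]; ring
  have e5 := mul_le_mul_of_nonneg_left hV.sq_le hm
  have e6 := div_le_div_of_nonneg_right (add_le_add e4 e5) hK.le
  linarith

end

section

variable {Ω : Type*} [MeasurableSpace Ω] {Pg : Measure Ω} [IsProbabilityMeasure Pg] {M : ℕ → ℝ}
  {c : (N : ℕ) → Spin N → Spin N → ℝ} {H : (N : ℕ) → Spin N → Ω → ℝ}
  {x : (N : ℕ) → Spin N → Bool}

/-- The upper bound `L` must hold eventually but the lower bound `κ` only frequently, since the
negation of `M = o(·)` speaks only of a subsequence. Both constants are fixed before the window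
half-width `s`, because the test function is chosen after them. -/
theorem IsModerateCloud.not_convergesToPoisson (h : IsModerateCloud Pg M c H x)
    {V : ℕ → Ω → ℝ} {q : ℕ → ℝ → ℝ} {W : (N : ℕ) → Spin N → Ω → ℝ} {C κ L : ℝ}
    (hV : ∀ᶠ N in atTop, IsCommonFactor Pg (H N) (V N) (q N) (W N) C) (hκ : 0 < κ)
    (hL : ∀ s : ℝ, ∀ᶠ N in atTop, ∀ y, |(y - center (M N)) / scale (M N)| ≤ s → |q N y| ≤ L)
    (hq : ∀ s : ℝ, ∃ᶠ N in atTop, ∀ y, |(y - center (M N)) / scale (M N)| ≤ s → κ ≤ q N y)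
    {Λ : Measure ℝ} :
    ¬ ConvergesToPoisson Pg (fun N => pointProcess (M N) (x N) (H N)) Λ := by
  rintro ⟨Q, hQ, hξ⟩
  have hC : 0 ≤ C := by
    obtain ⟨N, hN⟩ := hV.exists
    exact (integral_nonneg fun ω => sq_nonneg _).trans hN.sq_le
  -- `E m` bounds the numerator of the second error term once the mean is at most `2m`. With `K =
  -- 8E/κ` that term is at most `κm/8`, and `η ≤ κ/(16K)` makes the first one at most `κm/8` too,
  -- against a left side of at least `κm/2`.
  set E := 2 * (2 * L ^ 2 + 2 * C) + C + 1 with hE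
  have hE0 : 0 < E := by positivity
  set K := 8 * E / κ with hK
  have hK0 : 0 < K := by positivity
  set η := min 1 (κ / (16 * K)) with hη
  have hη0 : 0 < η := lt_min one_pos (by positivity)
  obtain ⟨f, hf, hm, hev⟩ := h.eventually_integral_abs_sub_le hQ hξ hη0 (min_le_left _ _)
  obtain ⟨B, hB0, hB⟩ := TestFun.exists_bound f
  obtain ⟨s, hs⟩ := TestFun.exists_tsupport_subset f
  set m := ∫ y, f y ∂intensity
  have hfm : Measurable fun y => f y := f.continuous.measurable
  have hlim := tendsto_card_smul_integral h.tendsto h.card hfm.aestronglyMeasurable (C := B) hB hs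
  have hlo := hlim.eventually_const_le (half_lt_self hm)
  have hhi := hlim.eventually_le_const (show m < 2 * m by linarith)
  obtain ⟨N, hqN, hVN, hLN, hu, hevN, hloN, hhiN⟩ := ((hq s).and_eventually
    (hV.and ((hL s).and (h.unit.and (hev.and (hlo.and hhi)))))).exists
  simp only [integral_pointProcess] at hevN
  rw [smul_eq_mul] at hloN hhiN
  have hwin : ∀ y, f ((y - center (M N)) / scale (M N)) ≠ 0 →
      |(y - center (M N)) / scale (M N)| ≤ s := fun y hy => not_lt.1 fun hlt => hy (hs _ hlt)
  have key := hVN.le_of_concentration hu (cloudSet (x N))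
    (g := fun y => f ((y - center (M N)) / scale (M N))) (B := B) (κ := κ) (L := L) (by fun_prop)
    (fun y => hf _) (fun y => (le_abs_self _).trans (hB _)) (fun y hy => hqN y (hwin y hy))
    (fun y hy => hLN y (hwin y hy)) hm.le hK0
  set r := ((cloudSet (x N)).card : ℝ) *
    ∫ y, f ((y - center (M N)) / scale (M N)) ∂(gaussianReal 0 1)
  have k1 := mul_le_mul_of_nonneg_left hloN hκ.le
  have k2 := mul_le_mul_of_nonneg_left hevN hK0.le
  have k3 : K * η ≤ κ / 16 := by
    have := mul_le_mul_of_nonneg_left (min_le_right 1 (κ / (16 * K))) hK0.le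
    refine this.trans (le_of_eq ?_)
    field_simp
  have k4 : ((2 * L ^ 2 + 2 * C) * r + m * C) / K ≤ m * κ / 8 := by
    rw [div_le_iff₀ hK0]
    have e1 : m * κ / 8 * K = m * E := by rw [hK]; field_simp
    rw [e1, hE]
    have := mul_le_mul_of_nonneg_left hhiN (show 0 ≤ 2 * L ^ 2 + 2 * C by positivity)
    nlinarith
  have k5 := mul_le_mul_of_nonneg_right k3 hm.le
  have k6 : 0 < κ * m := by positivity
  nlinarith

end

/-! ### Exponential moments of the overlap -/

section Overlap

variable {N : ℕ}

lemma spin_mul_self (u : ℤˣ) : ((u : ℤ) : ℝ) * ((u : ℤ) : ℝ) = 1 := by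
  rcases Int.units_eq_one_or u with rfl | rfl <;> simp

lemma mul_overlap (hN : 0 < N) (σ τ : Spin N) :
    (N : ℝ) * overlap σ τ = ∑ i, (((σ i : ℤ) : ℝ) * ((τ i : ℤ) : ℝ)) := by
  unfold overlap
  have : (N : ℝ) ≠ 0 := by positivity
  field_simp

lemma overlap_comm (σ τ : Spin N) : overlap σ τ = overlap τ σ := by
  unfold overlap; simp only [mul_comm]

lemma overlap_self (hN : 0 < N) (σ : Spin N) : overlap σ σ = 1 := by
  unfold overlap
  have : (N : ℝ) ≠ 0 := by positivity
  simp only [spin_mul_self, Finset.sum_const, Finset.card_univ, Fintype.card_fin, nsmul_eq_mul,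
    mul_one]
  field_simp

lemma abs_overlap_le_one (σ τ : Spin N) : |overlap σ τ| ≤ 1 := by
  rcases Nat.eq_zero_or_pos N with rfl | hN
  · simp [overlap]
  have h0 : (0 : ℝ) < N := by positivity
  have h1 : |(N : ℝ) * overlap σ τ| ≤ N := by
    rw [mul_overlap hN]
    refine (Finset.abs_sum_le_sum_abs _ _).trans ?_
    have : ∀ i, |((σ i : ℤ) : ℝ) * ((τ i : ℤ) : ℝ)| = 1 := fun i => by
      rcases Int.units_eq_one_or (σ i) with h | h <;> rcases Int.units_eq_one_or (τ i) with h' | h' <;>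
        simp [h, h']
    simp [this]
  rw [abs_mul, abs_of_pos h0] at h1
  exact le_of_mul_le_mul_left (by linarith) h0

lemma card_spin (N : ℕ) : (Fintype.card (Spin N) : ℝ) = (2 : ℝ) ^ N := by
  simp [Spin]

/-- The sum factorizes over the sites into powers of `2 cosh θ`, and `cosh θ ≤ exp(θ²/2)`. -/
lemma sum_exp_overlap_le (hN : 0 < N) (σ : Spin N) (θ : ℝ) :
    ∑ τ, Real.exp (θ * (N * overlap σ τ)) ≤ (2 : ℝ) ^ N * Real.exp (N * (θ ^ 2 / 2)) := by
  have e1 : ∑ τ : Spin N, Real.exp (θ * (N * overlap σ τ)) =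
      ∏ i : Fin N, ∑ u : ℤˣ, Real.exp (θ * (((σ i : ℤ) : ℝ) * ((u : ℤ) : ℝ))) := by
    rw [Finset.prod_univ_sum, Fintype.piFinset_univ]
    refine Finset.sum_congr rfl fun τ _ => ?_
    rw [mul_overlap hN, Finset.mul_sum, Real.exp_sum]
  have e2 : ∀ i : Fin N, ∑ u : ℤˣ, Real.exp (θ * (((σ i : ℤ) : ℝ) * ((u : ℤ) : ℝ))) =
      2 * Real.cosh θ := by
    intro i
    have : (Finset.univ : Finset ℤˣ) = {1, -1} := rfl
    rw [this, Finset.sum_pair (by decide), Real.cosh_eq]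
    rcases Int.units_eq_one_or (σ i) with h | h <;> simp [h] <;> ring
  rw [e1]
  simp only [e2, Finset.prod_const, Finset.card_univ, Fintype.card_fin]
  rw [mul_pow, Real.exp_nat_mul]
  have hc := Real.cosh_le_exp_half_sq θ
  have hc0 := Real.cosh_pos θ
  gcongr

/-- Chernoff bound for both tails with the optimal parameters `t` and `-t`. -/
lemma card_abs_overlap_ge_le (hN : 0 < N) (σ : Spin N) {t : ℝ} (ht : 0 ≤ t) :
    ∑ τ, (if t ≤ |overlap σ τ| then (1 : ℝ) else 0) ≤
      2 * ((2 : ℝ) ^ N * Real.exp (-(N * t ^ 2 / 2))) := by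
  have h1 : ∀ τ : Spin N, (if t ≤ |overlap σ τ| then (1 : ℝ) else 0) ≤
      Real.exp (-(N * t ^ 2)) * (Real.exp (t * (N * overlap σ τ)) +
        Real.exp (-t * (N * overlap σ τ))) := by
    intro τ
    split_ifs with h
    · rw [mul_add, ← Real.exp_add, ← Real.exp_add]
      have hNt : 0 ≤ (N : ℝ) * t := by positivity
      rcases le_abs.1 h with h | h
      · have : 1 ≤ Real.exp (-(N * t ^ 2) + t * (N * overlap σ τ)) := by
          refine Real.one_le_exp ?_
          nlinarith [mul_le_mul_of_nonneg_left h hNt]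
        linarith [Real.exp_pos (-(N * t ^ 2) + -t * (N * overlap σ τ))]
      · have : 1 ≤ Real.exp (-(N * t ^ 2) + -t * (N * overlap σ τ)) := by
          refine Real.one_le_exp ?_
          nlinarith [mul_le_mul_of_nonneg_left h hNt]
        linarith [Real.exp_pos (-(N * t ^ 2) + t * (N * overlap σ τ))]
    · positivity
  refine (Finset.sum_le_sum fun τ _ => h1 τ).trans ?_
  rw [← Finset.mul_sum, Finset.sum_add_distrib]
  have h2 := sum_exp_overlap_le hN σ t
  have h3 := sum_exp_overlap_le hN σ (-t)
  rw [neg_sq] at h3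
  calc _ ≤ Real.exp (-(N * t ^ 2)) * ((2 : ℝ) ^ N * Real.exp (N * (t ^ 2 / 2)) +
        (2 : ℝ) ^ N * Real.exp (N * (t ^ 2 / 2))) :=
        mul_le_mul_of_nonneg_left (add_le_add h2 h3) (Real.exp_pos _).le
    _ = 2 * ((2 : ℝ) ^ N * (Real.exp (-(N * t ^ 2)) * Real.exp (N * (t ^ 2 / 2)))) := by ring
    _ = _ := by rw [← Real.exp_add]; ring_nf

/-- The exponential moment of the square of a standard Gaussian. -/
def gaussSqMoment (a : ℝ) : ℝ := ∫ x, Real.exp (a * x ^ 2) ∂(gaussianReal 0 1)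

lemma gaussSqMoment_nonneg (a : ℝ) : 0 ≤ gaussSqMoment a :=
  integral_nonneg fun _ => (Real.exp_pos _).le

lemma integrable_exp_sq_gaussian {a : ℝ} (ha : a < 1 / 2) :
    Integrable (fun x : ℝ => Real.exp (a * x ^ 2)) (gaussianReal 0 1) := by
  rw [gaussianReal_of_var_ne_zero _ one_ne_zero, gaussianPDF_def,
    integrable_withDensity_iff_integrable_smul₀' (by fun_prop) (by simp)]
  refine ((integrable_exp_neg_mul_sq (show 0 < 1 / 2 - a by linarith)).const_mul
    ((√(2 * Real.pi * (1 : NNReal)))⁻¹)).congr (.of_forall fun x => ?_)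
  change _ = (ENNReal.ofReal (gaussianPDFReal 0 1 x)).toReal * _
  rw [ENNReal.toReal_ofReal (gaussianPDFReal_nonneg _ _ _), gaussianPDFReal,
    mul_assoc (√(2 * Real.pi * (1 : NNReal)))⁻¹, ← Real.exp_add]
  beta_reduce
  congr 2
  push_cast; ring

/-- Hubbard–Stratonovich linearization: the exponential of a square is a Gaussian average of linear
exponentials. With `β² = 2a/N` the linear bound returns `exp(a x²)`, whose Gaussian mean is finite
for `a < 1/2`. -/
lemma sum_exp_overlap_sq_le (hN : 0 < N) (σ : Spin N) {a : ℝ} (ha0 : 0 ≤ a) (ha : a < 1 / 2) :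
    ∑ τ, Real.exp (a * (N * overlap σ τ ^ 2)) ≤ (2 : ℝ) ^ N * gaussSqMoment a := by
  have hN0 : (0 : ℝ) < N := by positivity
  set β := √(2 * a / N) with hβ
  have hβ2 : β ^ 2 = 2 * a / N := Real.sq_sqrt (by positivity)
  have e1 : ∀ τ : Spin N, Real.exp (a * (N * overlap σ τ ^ 2)) =
      ∫ x, Real.exp (β * (N * overlap σ τ) * x) ∂(gaussianReal 0 1) := by
    intro τ
    have := mgf_gaussianReal (p := gaussianReal 0 1) (X := id) (μ := 0) (v := 1) (by simp)
      (β * (N * overlap σ τ))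
    simp only [mgf, id] at this
    rw [this]
    congr 1
    rw [mul_pow, hβ2, NNReal.coe_one]
    field_simp
    ring
  simp only [e1]
  rw [← integral_finsetSum _ fun τ _ => integrable_exp_mul_gaussianReal _, gaussSqMoment,
    ← integral_const_mul]
  refine integral_mono (integrable_finsetSum _ fun τ _ => integrable_exp_mul_gaussianReal _)
    ((integrable_exp_sq_gaussian ha).const_mul _) fun x => ?_
  have := sum_exp_overlap_le hN σ (β * x)
  refine le_trans (le_of_eq (Finset.sum_congr rfl fun τ _ => ?_)) (this.trans (le_of_eq ?_))
  · ring_nf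
  · rw [mul_pow, hβ2]; congr 2; field_simp

end Overlap

/-! ### Independent Bernoulli variables -/

section Bernoulli

/-- The indicator of the event that a point is in the cloud. -/
def ind {ι Ω : Type*} (X : ι → Ω → Bool) (i : ι) (ω : Ω) : ℝ := if X i ω = true then 1 else 0

lemma ind_nonneg {ι Ω : Type*} (X : ι → Ω → Bool) (i : ι) (ω : Ω) : 0 ≤ ind X i ω := by
  unfold ind; split_ifs <;> norm_num

lemma ind_le_one {ι Ω : Type*} (X : ι → Ω → Bool) (i : ι) (ω : Ω) : ind X i ω ≤ 1 := by
  unfold ind; split_ifs <;> norm_num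

lemma prod_ind_eq {ι Ω : Type*} (X : ι → Ω → Bool) (s : Finset ι) (ω : Ω) :
    ∏ i ∈ s, ind X i ω = if ∀ i ∈ s, X i ω = true then 1 else 0 := by
  unfold ind
  rw [Finset.prod_ite_zero]
  simp

lemma prod_ind_mul_prod_ind {ι Ω : Type*} [DecidableEq ι] (X : ι → Ω → Bool) (s t : Finset ι)
    (ω : Ω) : (∏ i ∈ s, ind X i ω) * ∏ i ∈ t, ind X i ω = ∏ i ∈ s ∪ t, ind X i ω := by
  simp only [prod_ind_eq, Finset.mem_union, or_imp, forall_and]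
  split_ifs <;> simp_all

variable {ι Ω : Type*} [MeasurableSpace Ω] {P : Measure Ω} {X : ι → Ω → Bool} {p : ℝ}

lemma measurable_ind (hX : ∀ i, Measurable (X i)) (i : ι) : Measurable (ind X i) :=
  Measurable.ite (hX i (measurableSet_singleton true)) measurable_const measurable_const

lemma integrable_prod_ind [IsFiniteMeasure P] (hX : ∀ i, Measurable (X i)) (s : Finset ι) :
    Integrable (fun ω => ∏ i ∈ s, ind X i ω) P := by
  refine Integrable.of_bound (Finset.measurable_fun_prod s fun i _ =>
    measurable_ind hX i).aestronglyMeasurable 1 (.of_forall fun ω => ?_)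
  rw [Real.norm_of_nonneg (Finset.prod_nonneg fun i _ => ind_nonneg X i ω)]
  exact Finset.prod_le_one (fun i _ => ind_nonneg X i ω) fun i _ => ind_le_one X i ω

lemma integral_prod_ind (hX : ∀ i, Measurable (X i)) (hi : iIndepFun X P) (hp0 : 0 ≤ p)
    (hp : ∀ i, P {ω | X i ω = true} = ENNReal.ofReal p) (s : Finset ι) :
    ∫ ω, ∏ i ∈ s, ind X i ω ∂P = p ^ s.card := by
  have e1 : ∀ ω, ∏ i ∈ s, ind X i ω =
      (⋂ i ∈ s, X i ⁻¹' {true}).indicator (fun _ => (1 : ℝ)) ω := by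
    intro ω
    by_cases h : ω ∈ ⋂ i ∈ s, X i ⁻¹' {true}
    · rw [Set.indicator_of_mem h]
      refine Finset.prod_eq_one fun i hi => ?_
      have : X i ω = true := by simpa using Set.mem_iInter₂.1 h i hi
      simp [ind, this]
    · rw [Set.indicator_of_notMem h]
      rw [Set.mem_iInter₂] at h
      push Not at h
      obtain ⟨i, his, hi⟩ := h
      refine Finset.prod_eq_zero his ?_
      have : ¬ X i ω = true := by simpa using hi
      simp [ind, this]
  have hm : MeasurableSet (⋂ i ∈ s, X i ⁻¹' {true}) :=
    s.measurableSet_biInter fun i _ => hX i (measurableSet_singleton true)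
  simp only [e1]
  rw [integral_indicator hm, setIntegral_const, smul_eq_mul, mul_one, measureReal_def,
    hi.measure_inter_preimage_eq_mul s (sets := fun _ => {true}) fun i _ =>
      measurableSet_singleton true]
  have : ∀ i, P (X i ⁻¹' {true}) = ENNReal.ofReal p := fun i => hp i
  simp only [this, Finset.prod_const]
  rw [ENNReal.toReal_pow, ENNReal.toReal_ofReal hp0]

variable [Fintype ι] [IsProbabilityMeasure P]

lemma mgf_sum_ind_le (hX : ∀ i, Measurable (X i)) (hi : iIndepFun X P) (hp0 : 0 ≤ p)
    (hp : ∀ i, P {ω | X i ω = true} = ENNReal.ofReal p) (t : ℝ) :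
    mgf (∑ i, ind X i) P t ≤ Real.exp (Fintype.card ι * p * (Real.exp t - 1)) := by
  rcases isEmpty_or_nonempty ι with hι | hι
  · simp [mgf]
  have hind : iIndepFun (ind X) P :=
    hi.comp (fun _ b => if b = true then (1 : ℝ) else 0) fun _ => measurable_of_finite _
  rw [hind.mgf_sum (measurable_ind hX)]
  have e : ∀ i, mgf (ind X i) P t = 1 + p * (Real.exp t - 1) := by
    intro i
    have h1 : ∀ ω, Real.exp (t * ind X i ω) = 1 + (Real.exp t - 1) * ∏ j ∈ {i}, ind X j ω := by
      intro ω
      rw [Finset.prod_singleton]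
      unfold ind; split_ifs <;> simp
    simp only [mgf, h1]
    rw [integral_add (integrable_const _) ((integrable_prod_ind hX _).const_mul _),
      integral_const_mul, integral_prod_ind hX hi hp0 hp]
    simp; ring
  simp only [e, Finset.prod_const, Finset.card_univ]
  rw [mul_assoc, Real.exp_nat_mul]
  have h0 : 0 ≤ 1 + p * (Real.exp t - 1) := by rw [← e (Classical.arbitrary ι)]; exact mgf_nonneg
  exact pow_le_pow_left₀ h0 (by linarith [Real.add_one_le_exp (p * (Real.exp t - 1))]) _

lemma measure_abs_sum_ind_sub_ge_le (hX : ∀ i, Measurable (X i)) (hi : iIndepFun X P)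
    (hp0 : 0 ≤ p) (hp : ∀ i, P {ω | X i ω = true} = ENNReal.ofReal p) {ε : ℝ} (hε : 0 < ε)
    (hε1 : ε ≤ 1) :
    P.real {ω | ε * (Fintype.card ι * p) ≤ |∑ i, ind X i ω - Fintype.card ι * p|} ≤
      2 * Real.exp (-(Fintype.card ι * p * (ε ^ 2 / 4))) := by
  set m := Fintype.card ι * p with hm
  have hm0 : 0 ≤ m := by positivity
  have hmeas : Measurable (∑ i, ind X i) := by
    rw [Finset.sum_fn]; exact Finset.measurable_fun_sum _ fun i _ => measurable_ind hX i
  have hint : ∀ t : ℝ, Integrable (fun ω => Real.exp (t * (∑ i, ind X i) ω)) P := by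
    intro t
    refine Integrable.of_bound (hmeas.const_mul t).exp.aestronglyMeasurable
      (Real.exp (|t| * Fintype.card ι)) (.of_forall fun ω => ?_)
    rw [Real.norm_of_nonneg (Real.exp_pos _).le]
    refine Real.exp_le_exp.2 ((le_abs_self _).trans ?_)
    rw [abs_mul]
    refine mul_le_mul_of_nonneg_left ?_ (abs_nonneg t)
    rw [Finset.sum_apply, abs_of_nonneg (Finset.sum_nonneg fun i _ => ind_nonneg X i ω)]
    exact (Finset.sum_le_card_nsmul _ _ 1 fun i _ => ind_le_one X i ω).trans (by simp)
  have hexp : ∀ t : ℝ, |t| ≤ 1 → mgf (∑ i, ind X i) P t ≤ Real.exp (m * (t + t ^ 2)) := by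
    intro t ht
    refine (mgf_sum_ind_le hX hi hp0 hp t).trans (Real.exp_le_exp.2 ?_)
    refine mul_le_mul_of_nonneg_left ?_ hm0
    linarith [(abs_le.1 (Real.abs_exp_sub_one_sub_id_le ht)).2]
  have hup : P.real {ω | (1 + ε) * m ≤ (∑ i, ind X i) ω} ≤ Real.exp (-(m * (ε ^ 2 / 4))) := by
    -- The parameter `ε/2` minimizes `t + t² - (1 + ε) t`, which gives the exponent `-ε²/4`.
    refine (measure_ge_le_exp_mul_mgf _ (half_pos hε).le (hint _)).trans ?_
    refine (mul_le_mul_of_nonneg_left (hexp (ε / 2) ?_) (Real.exp_pos _).le).trans (le_of_eq ?_)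
    · rw [abs_of_pos (half_pos hε)]; linarith
    · rw [← Real.exp_add]; congr 1; ring
  have hlow : P.real {ω | (∑ i, ind X i) ω ≤ (1 - ε) * m} ≤ Real.exp (-(m * (ε ^ 2 / 4))) := by
    refine (measure_le_le_exp_mul_mgf _ (t := -(ε / 2)) (by linarith) (hint _)).trans ?_
    refine (mul_le_mul_of_nonneg_left (hexp (-(ε / 2)) ?_) (Real.exp_pos _).le).trans (le_of_eq ?_)
    · rw [abs_neg, abs_of_pos (half_pos hε)]; linarith
    · rw [← Real.exp_add]; congr 1; ring
  have hsub : {ω | ε * m ≤ |∑ i, ind X i ω - m|} ⊆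
      {ω | (1 + ε) * m ≤ (∑ i, ind X i) ω} ∪ {ω | (∑ i, ind X i) ω ≤ (1 - ε) * m} := by
    intro ω hω
    rw [Set.mem_ofPred_eq] at hω
    simp only [Set.mem_union, Set.mem_ofPred_eq, Finset.sum_apply]
    rcases le_abs.1 hω with h | h
    · left; linarith
    · right; linarith
  refine (measureReal_mono hsub).trans ((measureReal_union_le _ _).trans ?_)
  linarith

variable [DecidableEq ι]

/-- First moment bound: Markov's inequality for the number of bad ordered pairs in the random set.
-/
lemma measure_exists_pair_le (hX : ∀ i, Measurable (X i)) (hi : iIndepFun X P)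
    (hp0 : 0 ≤ p) (hp : ∀ i, P {ω | X i ω = true} = ENNReal.ofReal p) (b : ι → ι → Prop)
    [∀ i j, Decidable (b i j)] :
    P.real {ω | ∃ i j, i ≠ j ∧ X i ω = true ∧ X j ω = true ∧ b i j} ≤
      p ^ 2 * ∑ i, ∑ j, if b i j then 1 else 0 := by
  let F : Ω → ℝ := fun ω => ∑ i, ∑ j, (if i ≠ j ∧ b i j then 1 else 0) * ∏ k ∈ {i, j}, ind X k ω
  have hterm : ∀ i j ω, 0 ≤ (if i ≠ j ∧ b i j then (1 : ℝ) else 0) * ∏ k ∈ {i, j}, ind X k ω :=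
    fun i j ω => mul_nonneg (by split_ifs <;> norm_num)
      (Finset.prod_nonneg fun k _ => ind_nonneg X k ω)
  have hint : ∀ i j, Integrable (fun ω => (if i ≠ j ∧ b i j then (1 : ℝ) else 0) *
      ∏ k ∈ {i, j}, ind X k ω) P := fun i j => (integrable_prod_ind hX _).const_mul _
  have hFi : Integrable F P := integrable_finsetSum _ fun i _ => integrable_finsetSum _ fun j _ =>
    hint i j
  have hmk := mul_meas_ge_le_integral_of_nonneg (μ := P) (f := F)
    (.of_forall fun ω => Finset.sum_nonneg fun i _ => Finset.sum_nonneg fun j _ => hterm i j ω) hFi 1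
  have hsub : {ω | ∃ i j, i ≠ j ∧ X i ω = true ∧ X j ω = true ∧ b i j} ⊆ {ω | 1 ≤ F ω} := by
    rintro ω ⟨i, j, hij, h1, h2, h3⟩
    have e1 : (if i ≠ j ∧ b i j then (1 : ℝ) else 0) * ∏ k ∈ {i, j}, ind X k ω = 1 := by
      rw [if_pos ⟨hij, h3⟩, prod_ind_eq, if_pos, one_mul]
      simp [h1, h2]
    have e2 := Finset.single_le_sum (f := fun j => (if i ≠ j ∧ b i j then (1 : ℝ) else 0) *
      ∏ k ∈ {i, j}, ind X k ω) (fun j _ => hterm i j ω) (Finset.mem_univ j)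
    have e3 := Finset.single_le_sum (f := fun i => ∑ j, (if i ≠ j ∧ b i j then (1 : ℝ) else 0) *
      ∏ k ∈ {i, j}, ind X k ω) (fun i _ => Finset.sum_nonneg fun j _ => hterm i j ω)
      (Finset.mem_univ i)
    exact e1.ge.trans (e2.trans e3)
  refine (measureReal_mono hsub).trans ?_
  rw [one_mul] at hmk
  refine hmk.trans ?_
  rw [integral_finsetSum _ fun i _ => integrable_finsetSum _ fun j _ => hint i j, Finset.mul_sum]
  refine Finset.sum_le_sum fun i _ => ?_
  rw [integral_finsetSum _ fun j _ => hint i j, Finset.mul_sum]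
  refine Finset.sum_le_sum fun j _ => ?_
  rw [integral_const_mul, integral_prod_ind hX hi hp0 hp]
  by_cases hij : i = j
  · simp [hij]; positivity
  · rw [Finset.card_pair hij]
    by_cases hb : b i j <;> simp [hij, hb]

end Bernoulli

/-! ### Concentration of quadratic forms in Bernoulli variables -/

section QuadraticForm

/-- The quadratic form with weights `w` in the indicators of a random set. -/
def quadForm {ι Ω : Type*} [Fintype ι] [DecidableEq ι] (X : ι → Ω → Bool) (w : ι → ι → ℝ) (ω : Ω) : ℝ :=
  ∑ a : ι × ι, w a.1 a.2 * ∏ k ∈ {a.1, a.2}, ind X k ω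

lemma quadForm_sq {ι Ω : Type*} [Fintype ι] [DecidableEq ι] (X : ι → Ω → Bool) (w : ι → ι → ℝ) (ω : Ω) :
    quadForm X w ω ^ 2 = ∑ a : ι × ι, ∑ b : ι × ι, w a.1 a.2 * w b.1 b.2 *
      ∏ k ∈ {a.1, a.2} ∪ {b.1, b.2}, ind X k ω := by
  rw [pow_two, quadForm, Finset.sum_mul_sum]
  refine Finset.sum_congr rfl fun a _ => Finset.sum_congr rfl fun b _ => ?_
  rw [← prod_ind_mul_prod_ind]; ring

variable {ι Ω : Type*} [MeasurableSpace Ω] {P : Measure Ω} [IsProbabilityMeasure P]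
  {X : ι → Ω → Bool} {p : ℝ} [Fintype ι] [DecidableEq ι]

/-- Two pairs are disjoint, share one index (four ways), or coincide (two orders). The three groups
on the right cover these cases. -/
lemma pow_card_pair_union_le {ι : Type*} [DecidableEq ι] {p : ℝ} (hp0 : 0 ≤ p) (hp1 : p ≤ 1)
    {i j k l : ι} (hij : i ≠ j) (hkl : k ≠ l) :
    p ^ (({i, j} : Finset ι) ∪ {k, l}).card ≤ p ^ 4 +
      p ^ 3 * ((if i = k then 1 else 0) + (if i = l then 1 else 0) + (if j = k then 1 else 0) +
        (if j = l then 1 else 0)) +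
      p ^ 2 * ((if i = k ∧ j = l then 1 else 0) + (if i = l ∧ j = k then 1 else 0)) := by
  have h2 : 0 ≤ p ^ 2 := by positivity
  have h3 : 0 ≤ p ^ 3 := by positivity
  have h4 : 0 ≤ p ^ 4 := by positivity
  have hcard2 : 2 ≤ (({i, j} : Finset ι) ∪ {k, l}).card := by
    rw [← Finset.card_pair hij]; exact Finset.card_le_card Finset.subset_union_left
  have hp2 := pow_le_pow_of_le_one hp0 hp1 hcard2
  by_cases a1 : i = k ∧ j = l
  · rw [if_pos a1]
    have e : 0 ≤ p ^ 3 * ((if i = k then (1 : ℝ) else 0) + (if i = l then 1 else 0) +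
      (if j = k then 1 else 0) + (if j = l then 1 else 0)) := by positivity
    have e' : 0 ≤ p ^ 2 * (if i = l ∧ j = k then (1 : ℝ) else 0) := by positivity
    linarith
  by_cases a2 : i = l ∧ j = k
  · rw [if_pos a2]
    have e : 0 ≤ p ^ 3 * ((if i = k then (1 : ℝ) else 0) + (if i = l then 1 else 0) +
      (if j = k then 1 else 0) + (if j = l then 1 else 0)) := by positivity
    have e' : 0 ≤ p ^ 2 * (if i = k ∧ j = l then (1 : ℝ) else 0) := by positivity
    linarith
  rw [if_neg a1, if_neg a2]
  by_cases hi : i ∈ ({k, l} : Finset ι)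
  · by_cases hj : j ∈ ({k, l} : Finset ι)
    · simp only [Finset.mem_insert, Finset.mem_singleton] at hi hj
      grind
    · have hcard : 3 ≤ (({i, j} : Finset ι) ∪ {k, l}).card := by
        have : (insert j ({k, l} : Finset ι)).card = 3 := by
          rw [Finset.card_insert_of_notMem hj, Finset.card_pair hkl]
        rw [← this]
        refine Finset.card_le_card fun a ha => ?_
        simp only [Finset.mem_insert, Finset.mem_singleton, Finset.mem_union] at ha ⊢
        tauto
      refine (pow_le_pow_of_le_one hp0 hp1 hcard).trans ?_
      simp only [Finset.mem_insert, Finset.mem_singleton] at hi hj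
      rcases hi with rfl | rfl <;> push Not at hj <;> simp [hj, hkl, hkl.symm] <;> linarith
  · by_cases hj : j ∈ ({k, l} : Finset ι)
    · have hcard : 3 ≤ (({i, j} : Finset ι) ∪ {k, l}).card := by
        have : (insert i ({k, l} : Finset ι)).card = 3 := by
          rw [Finset.card_insert_of_notMem hi, Finset.card_pair hkl]
        rw [← this]
        refine Finset.card_le_card fun a ha => ?_
        simp only [Finset.mem_insert, Finset.mem_singleton, Finset.mem_union] at ha ⊢
        tauto
      refine (pow_le_pow_of_le_one hp0 hp1 hcard).trans ?_
      simp only [Finset.mem_insert, Finset.mem_singleton] at hi hj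
      rcases hj with rfl | rfl <;> push Not at hi <;> simp [hi, hkl, hkl.symm] <;> linarith
    · have hcard : (({i, j} : Finset ι) ∪ {k, l}).card = 4 := by
        rw [Finset.card_union_of_disjoint, Finset.card_pair hij, Finset.card_pair hkl]
        rw [Finset.disjoint_left]
        intro a ha
        simp only [Finset.mem_insert, Finset.mem_singleton] at ha
        rcases ha with rfl | rfl <;> assumption
      rw [hcard]
      have e : 0 ≤ p ^ 3 * ((if i = k then (1 : ℝ) else 0) + (if i = l then 1 else 0) +
        (if j = k then 1 else 0) + (if j = l then 1 else 0)) := by positivity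
      linarith

lemma integral_quadForm (hX : ∀ i, Measurable (X i)) (hi : iIndepFun X P)
    (hp0 : 0 ≤ p) (hp : ∀ i, P {ω | X i ω = true} = ENNReal.ofReal p) {w : ι → ι → ℝ}
    (hw : ∀ i, w i i = 0) : ∫ ω, quadForm X w ω ∂P = p ^ 2 * ∑ a : ι × ι, w a.1 a.2 := by
  unfold quadForm
  rw [integral_finsetSum _ fun a _ => (integrable_prod_ind hX _).const_mul _, Finset.mul_sum]
  refine Finset.sum_congr rfl fun a _ => ?_
  rw [integral_const_mul, integral_prod_ind hX hi hp0 hp]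
  by_cases h : a.1 = a.2
  · rw [h, hw]; ring
  · rw [Finset.card_pair h]; ring

/-- In the second moment the `p⁴` contribution is exactly the squared mean and cancels. The row
bound `ρ` controls pairs sharing one index; coinciding pairs leave the sum of squared weights. -/
lemma variance_quadForm_le (hX : ∀ i, Measurable (X i)) (hi : iIndepFun X P)
    (hp0 : 0 ≤ p) (hp1 : p ≤ 1) (hp : ∀ i, P {ω | X i ω = true} = ENNReal.ofReal p)
    {w : ι → ι → ℝ} (hw : ∀ i, w i i = 0) (hw0 : ∀ i j, 0 ≤ w i j) (hws : ∀ i j, w i j = w j i)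
    {ρ : ℝ} (hρ : ∀ i, ∑ j, w i j ≤ ρ) :
    Var[quadForm X w; P] ≤ 4 * p ^ 3 * ρ * ∑ a : ι × ι, w a.1 a.2 +
      2 * p ^ 2 * ∑ a : ι × ι, w a.1 a.2 ^ 2 := by
  have hmeas : Measurable (quadForm X w) := Finset.measurable_fun_sum _ fun a _ =>
    (Finset.measurable_fun_prod _ fun i _ => measurable_ind hX i).const_mul _
  have hint : ∀ a b : ι × ι, Integrable (fun ω => w a.1 a.2 * w b.1 b.2 *
      ∏ k ∈ {a.1, a.2} ∪ {b.1, b.2}, ind X k ω) P := fun a b =>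
    (integrable_prod_ind hX _).const_mul _
  have hL2 : MemLp (quadForm X w) 2 P := by
    rw [memLp_two_iff_integrable_sq hmeas.aestronglyMeasurable]
    simp only [quadForm_sq]
    exact integrable_finsetSum _ fun a _ => integrable_finsetSum _ fun b _ => hint a b
  rw [variance_eq_sub hL2]
  have e1 : P[quadForm X w ^ 2] = ∑ a : ι × ι, ∑ b : ι × ι, w a.1 a.2 * w b.1 b.2 *
      p ^ (({a.1, a.2} : Finset ι) ∪ {b.1, b.2}).card := by
    simp only [Pi.pow_apply, quadForm_sq]
    rw [integral_finsetSum _ fun a _ => integrable_finsetSum _ fun b _ => hint a b]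
    refine Finset.sum_congr rfl fun a _ => ?_
    rw [integral_finsetSum _ fun b _ => hint a b]
    refine Finset.sum_congr rfl fun b _ => ?_
    rw [integral_const_mul, integral_prod_ind hX hi hp0 hp]
  set T := ∑ a : ι × ι, w a.1 a.2 with hT
  have key : ∀ a b : ι × ι, w a.1 a.2 * w b.1 b.2 *
      p ^ (({a.1, a.2} : Finset ι) ∪ {b.1, b.2}).card ≤
      p ^ 4 * (w a.1 a.2 * w b.1 b.2) +
      p ^ 3 * (w a.1 a.2 * ((if a.1 = b.1 then w b.1 b.2 else 0) +
        (if a.1 = b.2 then w b.1 b.2 else 0) + (if a.2 = b.1 then w b.1 b.2 else 0) +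
        (if a.2 = b.2 then w b.1 b.2 else 0))) +
      p ^ 2 * (w a.1 a.2 * ((if a = b then w b.1 b.2 else 0) +
        (if a = b.swap then w b.1 b.2 else 0))) := by
    rintro ⟨i, j⟩ ⟨k, l⟩
    by_cases hij : i = j
    · simp [hij, hw]
    by_cases hkl : k = l
    · simp [hkl, hw]
    have := mul_le_mul_of_nonneg_left (pow_card_pair_union_le hp0 hp1 hij hkl)
      (mul_nonneg (hw0 i j) (hw0 k l))
    refine this.trans (le_of_eq ?_)
    simp only [Prod.swap_prod_mk, Prod.mk.injEq]
    split_ifs <;> ring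
  have r1 : ∀ i, ∑ b : ι × ι, (if i = b.1 then w b.1 b.2 else 0) ≤ ρ := by
    intro i
    rw [Fintype.sum_prod_type]
    refine le_trans (le_of_eq ?_) (hρ i)
    rw [Finset.sum_comm]
    refine Finset.sum_congr rfl fun j _ => ?_
    simp
  have r2 : ∀ i, ∑ b : ι × ι, (if i = b.2 then w b.1 b.2 else 0) ≤ ρ := by
    intro i
    rw [Fintype.sum_prod_type]
    refine le_trans (le_of_eq ?_) (hρ i)
    refine Finset.sum_congr rfl fun j _ => ?_
    simp [hws i j]
  have r3 : ∀ a : ι × ι, ∑ b : ι × ι, (if a = b then w b.1 b.2 else 0) = w a.1 a.2 := by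
    intro a; simp
  have r4 : ∀ a : ι × ι, ∑ b : ι × ι, (if a = b.swap then w b.1 b.2 else 0) = w a.1 a.2 := by
    intro a
    rw [← (Equiv.prodComm ι ι).sum_comp]
    simp [hws a.2 a.1]
  have e2 : ∑ a : ι × ι, ∑ b : ι × ι, w a.1 a.2 * w b.1 b.2 *
      p ^ (({a.1, a.2} : Finset ι) ∪ {b.1, b.2}).card ≤
      p ^ 4 * T ^ 2 + p ^ 3 * (4 * ρ * T) + p ^ 2 * (2 * ∑ a : ι × ι, w a.1 a.2 ^ 2) := by
    have h1 : ∀ a : ι × ι, ∑ b : ι × ι, w a.1 a.2 * w b.1 b.2 *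
        p ^ (({a.1, a.2} : Finset ι) ∪ {b.1, b.2}).card ≤
        p ^ 4 * (w a.1 a.2 * T) + p ^ 3 * (w a.1 a.2 * (4 * ρ)) +
          p ^ 2 * (2 * w a.1 a.2 ^ 2) := by
      intro a
      refine (Finset.sum_le_sum fun b _ => key a b).trans ?_
      simp only [Finset.sum_add_distrib, ← Finset.mul_sum]
      rw [r3, r4]
      have h2 : w a.1 a.2 * (∑ b : ι × ι, (if a.1 = b.1 then w b.1 b.2 else 0) +
          ∑ b : ι × ι, (if a.1 = b.2 then w b.1 b.2 else 0) +
          ∑ b : ι × ι, (if a.2 = b.1 then w b.1 b.2 else 0) +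
          ∑ b : ι × ι, (if a.2 = b.2 then w b.1 b.2 else 0)) ≤ w a.1 a.2 * (4 * ρ) :=
        mul_le_mul_of_nonneg_left (by linarith [r1 a.1, r2 a.1, r1 a.2, r2 a.2]) (hw0 _ _)
      have h3 := mul_le_mul_of_nonneg_left h2 (pow_nonneg hp0 3)
      linarith
    refine (Finset.sum_le_sum fun a _ => h1 a).trans (le_of_eq ?_)
    simp only [Finset.sum_add_distrib, ← Finset.mul_sum, ← Finset.sum_mul]
    rw [← hT]; ring
  rw [e1, integral_quadForm hX hi hp0 hp hw, ← hT]
  linarith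

/-- The mean is at most `c₁ (np)²`, so the event forces a deviation of at least `(np)²`, to which
Chebyshev's inequality applies. -/
lemma measure_quadForm_ge_le (hX : ∀ i, Measurable (X i)) (hi : iIndepFun X P)
    (hp0 : 0 < p) (hp1 : p ≤ 1) (hp : ∀ i, P {ω | X i ω = true} = ENNReal.ofReal p)
    {w : ι → ι → ℝ} (hw : ∀ i, w i i = 0) (hw0 : ∀ i j, 0 ≤ w i j) (hws : ∀ i j, w i j = w j i)
    [Nonempty ι] {c₁ c₂ : ℝ} (hc₁ : 0 ≤ c₁) (h1 : ∀ i, ∑ j, w i j ≤ Fintype.card ι * c₁)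
    (h2 : ∀ i, ∑ j, w i j ^ 2 ≤ Fintype.card ι * c₂) :
    P.real {ω | (c₁ + 1) * (Fintype.card ι * p) ^ 2 ≤ quadForm X w ω} ≤
      4 * c₁ ^ 2 / (Fintype.card ι * p) + 2 * c₂ / (Fintype.card ι * p) ^ 2 := by
  set n : ℝ := (Fintype.card ι : ℝ) with hn
  have hn0 : 0 < n := by rw [hn]; exact_mod_cast Fintype.card_pos
  set m := n * p with hm
  have hm0 : 0 < m := by positivity
  have hT : ∑ a : ι × ι, w a.1 a.2 ≤ n * (n * c₁) := by
    rw [Fintype.sum_prod_type]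
    exact (Finset.sum_le_card_nsmul _ _ _ fun i _ => h1 i).trans (by simp [hn])
  have hT2 : ∑ a : ι × ι, w a.1 a.2 ^ 2 ≤ n * (n * c₂) := by
    rw [Fintype.sum_prod_type]
    exact (Finset.sum_le_card_nsmul _ _ _ fun i _ => h2 i).trans (by simp [hn])
  have hmeas : Measurable (quadForm X w) := Finset.measurable_fun_sum _ fun a _ =>
    (Finset.measurable_fun_prod _ fun i _ => measurable_ind hX i).const_mul _
  have hL2 : MemLp (quadForm X w) 2 P := by
    rw [memLp_two_iff_integrable_sq hmeas.aestronglyMeasurable]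
    simp only [quadForm_sq]
    exact integrable_finsetSum _ fun a _ => integrable_finsetSum _ fun b _ =>
      (integrable_prod_ind hX _).const_mul _
  have hmean := integral_quadForm hX hi hp0.le hp hw
  have hvar := variance_quadForm_le hX hi hp0.le hp1 hp hw hw0 hws h1
  have hch := meas_ge_le_variance_div_sq hL2 (show 0 < m ^ 2 by positivity)
  have hsub : {ω | (c₁ + 1) * m ^ 2 ≤ quadForm X w ω} ⊆
      {ω | m ^ 2 ≤ |quadForm X w ω - P[quadForm X w]|} := by
    intro ω hω
    rw [Set.mem_ofPred_eq] at hω ⊢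
    refine le_trans ?_ (le_abs_self _)
    rw [hmean]
    have := mul_le_mul_of_nonneg_left hT (sq_nonneg p)
    have e : p ^ 2 * (n * (n * c₁)) = c₁ * m ^ 2 := by rw [hm]; ring
    linarith
  have h3 : P.real {ω | (c₁ + 1) * m ^ 2 ≤ quadForm X w ω} ≤ Var[quadForm X w; P] / (m ^ 2) ^ 2 := by
    refine (measureReal_mono hsub).trans ?_
    rw [measureReal_def]
    refine (ENNReal.toReal_mono ENNReal.ofReal_ne_top hch).trans (le_of_eq ?_)
    exact ENNReal.toReal_ofReal (div_nonneg (variance_nonneg _ _) (by positivity))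
  refine h3.trans ?_
  rw [div_le_iff₀ (by positivity)]
  have e1 : (4 * c₁ ^ 2 / m + 2 * c₂ / m ^ 2) * (m ^ 2) ^ 2 = 4 * c₁ ^ 2 * m ^ 3 + 2 * c₂ * m ^ 2 := by
    field_simp
  rw [e1]
  refine hvar.trans (add_le_add ?_ ?_)
  · calc _ ≤ 4 * p ^ 3 * (n * c₁) * (n * (n * c₁)) :=
          mul_le_mul_of_nonneg_left hT (by positivity)
      _ = _ := by rw [hm]; ring
  · calc _ ≤ 2 * p ^ 2 * (n * (n * c₂)) := mul_le_mul_of_nonneg_left hT2 (by positivity)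
      _ = _ := by rw [hm]; ring

end QuadraticForm

/-! ### Almost sure properties of the random cloud -/

/-- The first Borel–Cantelli lemma, which uses nothing about the dependence between different N. -/
lemma ae_eventually_notMem_of_summable {Ω : Type*} [MeasurableSpace Ω] {P : Measure Ω}
    [IsFiniteMeasure P] {s : ℕ → Set Ω} {b : ℕ → ℝ} (hb : Summable b)
    (h : ∀ᶠ N in atTop, P.real (s N) ≤ b N) : ∀ᵐ ω ∂P, ∀ᶠ N in atTop, ω ∉ s N := by
  obtain ⟨N₀, hN₀⟩ := eventually_atTop.1 h
  have h1 : ∑' N, P (if N₀ ≤ N then s N else ∅) ≠ ∞ := by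
    refine ne_top_of_le_ne_top hb.tsum_ofReal_ne_top (ENNReal.tsum_le_tsum fun N => ?_)
    split_ifs with hN
    · rw [← ofReal_measureReal (measure_ne_top P _)]
      exact ENNReal.ofReal_le_ofReal (hN₀ N hN)
    · simp
  filter_upwards [ae_eventually_notMem h1] with ω hω
  filter_upwards [hω, eventually_ge_atTop N₀] with N h2 h3
  rwa [if_pos h3] at h2

lemma summable_const_mul_inv_sq (C : ℝ) : Summable fun N : ℕ => C * ((N : ℝ) ^ 2)⁻¹ :=
  (Real.summable_nat_pow_inv.2 one_lt_two).mul_left C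

/-- The properties of a sequence of clouds which determine the limit of the point processes. -/
structure IsTypicalCloud (M : ℕ → ℝ) (a : ℝ) (x : (N : ℕ) → Spin N → Bool) : Prop where
  card : Tendsto (fun N => ((cloudSet (x N)).card : ℝ) * ((2 : ℝ) ^ M N)⁻¹) atTop (𝓝 1)
  offDiag : ∀ᶠ N in atTop, ∀ σ ∈ cloudSet (x N), ∀ τ ∈ (cloudSet (x N)).erase σ,
    |overlap τ σ| ≤ 4 / 5
  dense : ∃ C : ℝ, ∀ᶠ N : ℕ in atTop, (N : ℝ) ^ 2 ≤ (2 : ℝ) ^ M N →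
    ∑ σ ∈ cloudSet (x N), ∑ τ ∈ (cloudSet (x N)).erase σ,
      Real.exp (a * (N * overlap τ σ ^ 2)) ≤ C * ((2 : ℝ) ^ M N) ^ 2
  sparse : ∀ᶠ N : ℕ in atTop, (2 : ℝ) ^ M N < (N : ℝ) ^ 2 →
    ∀ σ ∈ cloudSet (x N), ∀ τ ∈ (cloudSet (x N)).erase σ,
      |overlap τ σ| ≤ √(12 * Real.log N / N)

lemma mem_cloudSet {N : ℕ} {x : Spin N → Bool} {σ : Spin N} : σ ∈ cloudSet x ↔ x σ = true := by
  simp [cloudSet]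

lemma card_cloudSet {Ω : Type*} {N : ℕ} (X : Spin N → Ω → Bool) (ω : Ω) :
    ((cloudSet fun σ => X σ ω).card : ℝ) = ∑ σ, ind X σ ω := by
  unfold cloudSet ind
  simp

lemma sum_cloudSet_eq_quadForm {Ω : Type*} {N : ℕ} (X : Spin N → Ω → Bool) (w : Spin N → Spin N → ℝ) (ω : Ω) :
    ∑ σ ∈ cloudSet (fun σ => X σ ω), ∑ τ ∈ (cloudSet fun σ => X σ ω).erase σ, w σ τ =
      quadForm X (fun σ τ => if σ = τ then 0 else w σ τ) ω := by
  unfold quadForm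
  rw [Fintype.sum_prod_type, cloudSet, Finset.sum_filter]
  refine Finset.sum_congr rfl fun σ _ => ?_
  simp only [prod_ind_eq]
  by_cases hσ : X σ ω = true
  · rw [if_pos hσ]
    have : (({σ | X σ ω = true} : Finset (Spin N)).erase σ) =
        ({τ | σ ≠ τ ∧ X τ ω = true} : Finset (Spin N)) := by
      ext τ
      rw [Finset.mem_erase, Finset.mem_filter, Finset.mem_filter]
      exact ⟨fun h => ⟨Finset.mem_univ _, h.1.symm, h.2.2⟩,
        fun h => ⟨h.2.1.symm, Finset.mem_univ _, h.2.2⟩⟩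
    rw [this, Finset.sum_filter]
    refine Finset.sum_congr rfl fun τ _ => ?_
    by_cases h1 : σ = τ <;> by_cases h2 : X τ ω = true <;> simp [h1, h2, hσ]
  · rw [if_neg hσ]
    exact (Finset.sum_eq_zero fun τ _ => by simp [hσ]).symm

section

variable {Ω : Type*} [MeasurableSpace Ω] {P : Measure Ω} [IsProbabilityMeasure P] {M : ℕ → ℝ}
  {X : (N : ℕ) → Spin N → Ω → Bool}

lemma IsRandomCloud.prob_le_one (hX : IsRandomCloud P M X) {N : ℕ} (hN : 0 < N) :
    (2 : ℝ) ^ M N / (2 : ℝ) ^ N ≤ 1 := by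
  have h := hX.prob N hN 1
  have h1 : ENNReal.ofReal ((2 : ℝ) ^ M N / (2 : ℝ) ^ N) ≤ 1 := h ▸ MeasureTheory.prob_le_one
  exact ENNReal.ofReal_le_one.1 h1

lemma card_mul_prob (M : ℕ → ℝ) (N : ℕ) :
    (Fintype.card (Spin N) : ℝ) * ((2 : ℝ) ^ M N / (2 : ℝ) ^ N) = (2 : ℝ) ^ M N := by
  rw [card_spin]; field_simp

lemma IsRandomCloud.ae_tendsto_card (hX : IsRandomCloud P M X)
    (hM : (fun N : ℕ => Real.log N) =o[atTop] fun N : ℕ => (2 : ℝ) ^ (M N)) :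
    ∀ᵐ ω ∂P, Tendsto (fun N => ((cloudSet fun σ => X N σ ω).card : ℝ) * ((2 : ℝ) ^ M N)⁻¹) atTop
      (𝓝 1) := by
  have h1 : ∀ k : ℕ, ∀ᵐ ω ∂P, ∀ᶠ N : ℕ in atTop,
      ω ∉ {ω | 1 / ((k : ℝ) + 1) * (Fintype.card (Spin N) * ((2 : ℝ) ^ M N / (2 : ℝ) ^ N)) ≤
        |∑ σ, ind (X N) σ ω - Fintype.card (Spin N) * ((2 : ℝ) ^ M N / (2 : ℝ) ^ N)|} := by
    intro k
    have hε : (0 : ℝ) < 1 / ((k : ℝ) + 1) := by positivity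
    set ε := 1 / ((k : ℝ) + 1) with hεdef
    have hε1 : ε ≤ 1 := by
      rw [hεdef, div_le_one (by positivity)]; linarith [(Nat.cast_nonneg k : (0 : ℝ) ≤ k)]
    refine ae_eventually_notMem_of_summable (summable_const_mul_inv_sq 2) ?_
    -- The constant `ε²/8` gives `(ε²/4) 2^M ≥ 2 log N`, so the Chernoff bound is at most `2/N²`.
    filter_upwards [hM.bound (show 0 < ε ^ 2 / 8 by positivity), eventually_ge_atTop 1] with N h2 hN
    have hN0 : (0 : ℝ) < N := by exact_mod_cast hN
    refine (measure_abs_sum_ind_sub_ge_le (hX.measurable N) (hX.indep N) (by positivity)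
      (hX.prob N hN) hε hε1).trans ?_
    refine mul_le_mul_of_nonneg_left ?_ two_pos.le
    rw [card_mul_prob, ← Real.exp_log (show 0 < ((N : ℝ) ^ 2)⁻¹ by positivity), Real.log_inv,
      Real.log_pow]
    refine Real.exp_le_exp.2 ?_
    rw [Real.norm_of_nonneg (Real.log_nonneg (by exact_mod_cast hN)),
      Real.norm_of_nonneg (by positivity)] at h2
    push_cast
    linarith
  filter_upwards [ae_all_iff.2 h1] with ω hω
  rw [Metric.tendsto_nhds]
  intro ε hε
  obtain ⟨k, hk⟩ := exists_nat_one_div_lt hε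
  filter_upwards [hω k] with N h2
  rw [not_le, card_mul_prob, ← card_cloudSet] at h2
  have h0 : (0 : ℝ) < (2 : ℝ) ^ M N := by positivity
  rw [Real.dist_eq]
  have e : ((cloudSet fun σ => X N σ ω).card : ℝ) * ((2 : ℝ) ^ M N)⁻¹ - 1 =
      (((cloudSet fun σ => X N σ ω).card : ℝ) - (2 : ℝ) ^ M N) / (2 : ℝ) ^ M N := by
    field_simp
  rw [e, abs_div, abs_of_pos h0, div_lt_iff₀ h0]
  exact h2.trans (mul_lt_mul_of_pos_right hk h0)

lemma IsRandomCloud.measure_exists_overlap_le (hX : IsRandomCloud P M X) {N : ℕ} (hN : 0 < N)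
    {t : ℝ} (ht : 0 ≤ t) :
    P.real {ω | ∃ σ τ, σ ≠ τ ∧ X N σ ω = true ∧ X N τ ω = true ∧ t ≤ |overlap σ τ|} ≤
      2 * (((2 : ℝ) ^ M N) ^ 2 * Real.exp (-(N * t ^ 2 / 2))) := by
  refine (measure_exists_pair_le (hX.measurable N) (hX.indep N) (by positivity)
    (hX.prob N hN) fun σ τ => t ≤ |overlap σ τ|).trans ?_
  have h1 : ∑ σ : Spin N, ∑ τ, (if t ≤ |overlap σ τ| then (1 : ℝ) else 0) ≤
      (2 : ℝ) ^ N * (2 * ((2 : ℝ) ^ N * Real.exp (-(N * t ^ 2 / 2)))) := by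
    refine (Finset.sum_le_card_nsmul _ _ _ fun σ _ => card_abs_overlap_ge_le hN σ ht).trans ?_
    rw [nsmul_eq_mul, Finset.card_univ, card_spin]
  refine (mul_le_mul_of_nonneg_left h1 (by positivity)).trans (le_of_eq ?_)
  field_simp

lemma IsRandomCloud.ae_offDiag (hX : IsRandomCloud P M X)
    (hMN : ∀ᶠ N : ℕ in atTop, 2 * M N * Real.log 2 ≤ N / 4) :
    ∀ᵐ ω ∂P, ∀ᶠ N in atTop, ∀ σ ∈ cloudSet (fun σ => X N σ ω),
      ∀ τ ∈ (cloudSet fun σ => X N σ ω).erase σ, |overlap τ σ| ≤ 4 / 5 := by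
  -- The union bound has exponent `2M log 2 - N(4/5)²/2`, which is at most `N/4 - 8N/25 = -7N/100`.
  have hsum : Summable fun N : ℕ => 2 * Real.exp (N * (-(7 / 100) : ℝ)) :=
    (Real.summable_exp_nat_mul_iff.2 (by norm_num)).mul_left 2
  have h := ae_eventually_notMem_of_summable (P := P) hsum
    (s := fun N => {ω | ∃ σ τ, σ ≠ τ ∧ X N σ ω = true ∧ X N τ ω = true ∧ 4 / 5 ≤ |overlap σ τ|}) (by
    filter_upwards [hMN, eventually_ge_atTop 1] with N h1 hN
    refine (hX.measure_exists_overlap_le hN (by norm_num)).trans ?_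
    refine mul_le_mul_of_nonneg_left ?_ two_pos.le
    rw [Real.rpow_def_of_pos two_pos, ← Real.exp_nat_mul, ← Real.exp_add]
    refine Real.exp_le_exp.2 ?_
    push_cast
    linarith)
  filter_upwards [h] with ω hω
  filter_upwards [hω] with N hN σ hσ τ hτ
  rw [Finset.mem_erase] at hτ
  by_contra hlt
  exact hN ⟨τ, σ, hτ.1, mem_cloudSet.1 hτ.2, mem_cloudSet.1 hσ, (not_le.1 hlt).le⟩

/-- There are on average fewer than `N⁴` pairs, and the threshold is chosen so that each is bad with
probability at most `2/N⁶`; the product is summable. -/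
lemma IsRandomCloud.ae_sparse (hX : IsRandomCloud P M X) :
    ∀ᵐ ω ∂P, ∀ᶠ N : ℕ in atTop, (2 : ℝ) ^ M N < (N : ℝ) ^ 2 →
      ∀ σ ∈ cloudSet (fun σ => X N σ ω), ∀ τ ∈ (cloudSet fun σ => X N σ ω).erase σ,
        |overlap τ σ| ≤ √(12 * Real.log N / N) := by
  have h := ae_eventually_notMem_of_summable (P := P) (summable_const_mul_inv_sq 2)
    (s := fun N : ℕ => {ω | (2 : ℝ) ^ M N < (N : ℝ) ^ 2 ∧ ∃ σ τ, σ ≠ τ ∧ X N σ ω = true ∧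
      X N τ ω = true ∧ √(12 * Real.log N / N) ≤ |overlap σ τ|}) (by
    filter_upwards [eventually_ge_atTop 1] with N hN
    have hN0 : (0 : ℝ) < N := by exact_mod_cast hN
    by_cases hs : (2 : ℝ) ^ M N < (N : ℝ) ^ 2
    · simp only [hs, true_and]
      refine (hX.measure_exists_overlap_le hN (Real.sqrt_nonneg _)).trans ?_
      refine mul_le_mul_of_nonneg_left ?_ two_pos.le
      have hlog : 0 ≤ Real.log N := Real.log_nonneg (by exact_mod_cast hN)
      rw [Real.sq_sqrt (by positivity)]
      have e : -((N : ℝ) * (12 * Real.log N / N) / 2) = Real.log (((N : ℝ) ^ 6)⁻¹) := by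
        rw [Real.log_inv, Real.log_pow]; field_simp; push_cast; ring
      rw [e, Real.exp_log (by positivity)]
      calc _ ≤ ((N : ℝ) ^ 2) ^ 2 * ((N : ℝ) ^ 6)⁻¹ := by gcongr
        _ = _ := by field_simp
    · simp only [hs, false_and, Set.ofPred_false, measureReal_empty]
      positivity)
  filter_upwards [h] with ω hω
  filter_upwards [hω] with N hN hs σ hσ τ hτ
  rw [Finset.mem_erase] at hτ
  by_contra hlt
  exact hN ⟨hs, τ, σ, hτ.1, mem_cloudSet.1 hτ.2, mem_cloudSet.1 hσ, (not_le.1 hlt).le⟩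

/-- Chebyshev's inequality squares the weights, so the exponential moment is needed at `2a < 1/2`.
Its bound is of order `2^(-M)`, summable because this regime has `2^M ≥ N²`. -/
lemma IsRandomCloud.ae_dense (hX : IsRandomCloud P M X) {a : ℝ} (ha0 : 0 ≤ a) (ha : a < 1 / 4) :
    ∀ᵐ ω ∂P, ∀ᶠ N : ℕ in atTop, (N : ℝ) ^ 2 ≤ (2 : ℝ) ^ M N →
      ∑ σ ∈ cloudSet (fun σ => X N σ ω), ∑ τ ∈ (cloudSet fun σ => X N σ ω).erase σ,
        Real.exp (a * (N * overlap τ σ ^ 2)) ≤ (gaussSqMoment a + 1) * ((2 : ℝ) ^ M N) ^ 2 := by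
  let w : (N : ℕ) → Spin N → Spin N → ℝ := fun N σ τ =>
    if σ = τ then 0 else Real.exp (a * (N * overlap τ σ ^ 2))
  have h := ae_eventually_notMem_of_summable (P := P)
    (summable_const_mul_inv_sq (4 * gaussSqMoment a ^ 2 + 2 * gaussSqMoment (2 * a)))
    (s := fun N : ℕ => {ω | (N : ℝ) ^ 2 ≤ (2 : ℝ) ^ M N ∧
      (gaussSqMoment a + 1) * (Fintype.card (Spin N) * ((2 : ℝ) ^ M N / (2 : ℝ) ^ N)) ^ 2 ≤
        quadForm (X N) (w N) ω}) (by
    filter_upwards [eventually_ge_atTop 1] with N hN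
    have hN1 : (1 : ℝ) ≤ N := by exact_mod_cast hN
    have hN0 : (0 : ℝ) < N := by linarith
    have g1 := gaussSqMoment_nonneg a
    have g2 := gaussSqMoment_nonneg (2 * a)
    by_cases hs : (N : ℝ) ^ 2 ≤ (2 : ℝ) ^ M N
    · simp only [hs, true_and]
      refine (measure_quadForm_ge_le (hX.measurable N) (hX.indep N) (by positivity)
        (hX.prob_le_one hN) (hX.prob N hN) (w := w N) (fun σ => if_pos rfl) (fun σ τ => ?_)
        (fun σ τ => ?_) (c₂ := gaussSqMoment (2 * a)) g1 (fun σ => ?_) fun σ => ?_).trans ?_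
      · simp only [w]; split_ifs
        · exact le_rfl
        · exact (Real.exp_pos _).le
      · simp only [w, eq_comm (a := σ), overlap_comm τ σ]
      · rw [card_spin]
        refine le_trans (Finset.sum_le_sum fun τ _ => ?_) (sum_exp_overlap_sq_le hN σ ha0 (by linarith))
        simp only [w, overlap_comm τ σ]; split_ifs
        · exact (Real.exp_pos _).le
        · exact le_rfl
      · rw [card_spin]
        refine le_trans (Finset.sum_le_sum fun τ _ => ?_)
          (sum_exp_overlap_sq_le hN σ (a := 2 * a) (by linarith) (by linarith))
        simp only [w, overlap_comm τ σ]; split_ifs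
        · rw [zero_pow two_ne_zero]; exact (Real.exp_pos _).le
        · rw [← Real.exp_nat_mul]; push_cast; rw [mul_assoc]
      · rw [card_mul_prob, add_mul, ← div_eq_mul_inv, ← div_eq_mul_inv]
        have h2 : (N : ℝ) ^ 2 ≤ ((2 : ℝ) ^ M N) ^ 2 := by
          refine hs.trans (le_self_pow₀ ?_ two_ne_zero)
          exact le_trans (one_le_pow₀ hN1) hs
        gcongr
    · simp only [hs, false_and, Set.ofPred_false, measureReal_empty]
      positivity)
  filter_upwards [h] with ω hω
  filter_upwards [hω] with N hN hs
  rw [sum_cloudSet_eq_quadForm (X N) fun σ τ => Real.exp (a * (N * overlap τ σ ^ 2))]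
  by_contra hlt
  exact hN ⟨hs, by rw [card_mul_prob]; exact (not_le.1 hlt).le⟩

theorem IsRandomCloud.ae_isTypicalCloud (hX : IsRandomCloud P M X)
    (hM : (fun N : ℕ => Real.log N) =o[atTop] fun N : ℕ => (2 : ℝ) ^ (M N))
    (hMN : ∀ᶠ N : ℕ in atTop, 2 * M N * Real.log 2 ≤ N / 4) {a : ℝ} (ha0 : 0 ≤ a)
    (ha : a < 1 / 4) : ∀ᵐ ω ∂P, IsTypicalCloud M a fun N σ => X N σ ω := by
  filter_upwards [hX.ae_tendsto_card hM, hX.ae_offDiag hMN, hX.ae_sparse, hX.ae_dense ha0 ha]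
    with ω h1 h2 h3 h4
  exact ⟨h1, h2, ⟨_, h4⟩, h3⟩

end

/-! ### Pair sums of typical clouds -/

lemma eventually_sparse_bound (K : ℝ) : ∀ᶠ N : ℕ in atTop,
    K * (4 * Real.log N * √(12 * Real.log N / N)) ≤ 1 := by
  have h1 := ((Real.isLittleO_pow_log_id_atTop (n := 3)).comp_tendsto
    (tendsto_natCast_atTop_atTop (R := ℝ))).bound (show 0 < 1 / (192 * K ^ 2 + 1) by positivity)
  filter_upwards [h1, eventually_ge_atTop 1] with N h2 hN
  have hN0 : (0 : ℝ) < N := by exact_mod_cast hN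
  have hlog : 0 ≤ Real.log N := Real.log_nonneg (by exact_mod_cast hN)
  simp only [Function.comp_apply, id] at h2
  rw [Real.norm_of_nonneg (by positivity), Real.norm_of_nonneg hN0.le, one_div,
    inv_mul_eq_div, le_div_iff₀ (by positivity)] at h2
  have h3 : (K * (4 * Real.log N * √(12 * Real.log N / N))) ^ 2 ≤ 1 ^ 2 := by
    rw [mul_pow, mul_pow, Real.sq_sqrt (by positivity)]
    have : K ^ 2 * ((4 * Real.log N) ^ 2 * (12 * Real.log N / N)) =
        192 * K ^ 2 * Real.log N ^ 3 / N := by ring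
    rw [this, one_pow, div_le_one hN0]
    nlinarith [pow_nonneg hlog 3]
  exact (abs_le_of_sq_le_sq' h3 zero_le_one).2

/-- For dense clouds the exponent is dominated by `a N R² + D` and the quadratic-form bound applies.
For sparse clouds `M` is `O(log N)` and the overlaps are `O(√(log N / N))`, so the exponents are
eventually at most one. The constant `C` is chosen before `K`, as `convergesToPoisson_of_pairSum`
demands. -/
lemma IsTypicalCloud.exists_pairSum_bound {M : ℕ → ℝ} {a : ℝ} {x : (N : ℕ) → Spin N → Bool}
    (h : IsTypicalCloud M a x) (hM : ∀ᶠ N in atTop, 0 ≤ M N) {ν : ℝ → ℝ}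
    (hν : ∀ r, |r| ≤ 1 → |ν r| ≤ |r|) :
    ∃ C : ℝ, ∀ K D : ℝ, 0 ≤ K →
      (∀ᶠ N in atTop, ∀ r : ℝ, |r| ≤ 1 → K * (M N * |ν r|) ≤ a * (N * r ^ 2) + D) →
      ∀ᶠ N in atTop, pairSum K (M N) (fun σ τ => ν (overlap σ τ)) (cloudSet (x N)) ≤
        Real.exp D * C + C := by
  obtain ⟨C, hC⟩ := h.dense
  -- The second entry serves the sparse regime: at most `(2 * 2^M)²` ordered pairs, each
  -- contributing at most `e`.
  refine ⟨max |C| (4 * Real.exp 1), fun K D hK hKD => ?_⟩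
  have hmax1 : C ≤ max |C| (4 * Real.exp 1) := (le_abs_self C).trans (le_max_left _ _)
  have hmax2 : 4 * Real.exp 1 ≤ max |C| (4 * Real.exp 1) := le_max_right _ _
  have hmax0 : 0 ≤ max |C| (4 * Real.exp 1) := (abs_nonneg C).trans (le_max_left _ _)
  filter_upwards [hC, hKD, h.sparse, eventually_sparse_bound K, hM, eventually_ge_atTop 1,
    h.card.eventually_le_const one_lt_two] with N h1 h2 h3 h4 h5 hN h6
  have hN0 : (0 : ℝ) < N := by exact_mod_cast hN
  have hq : (0 : ℝ) < (2 : ℝ) ^ M N := by positivity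
  have hD := Real.exp_pos D
  unfold pairSum
  rcases le_or_gt ((N : ℝ) ^ 2) ((2 : ℝ) ^ M N) with hd | hs
  · have e1 : ∑ σ ∈ cloudSet (x N), ∑ τ ∈ (cloudSet (x N)).erase σ,
        Real.exp (K * (M N * |ν (overlap τ σ)|)) ≤ Real.exp D * (C * ((2 : ℝ) ^ M N) ^ 2) := by
      refine le_trans ?_ (mul_le_mul_of_nonneg_left (h1 hd) hD.le)
      rw [Finset.mul_sum]
      refine Finset.sum_le_sum fun σ _ => ?_
      rw [Finset.mul_sum]
      refine Finset.sum_le_sum fun τ _ => ?_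
      rw [← Real.exp_add]
      refine Real.exp_le_exp.2 ((h2 _ (abs_overlap_le_one τ σ)).trans (le_of_eq (add_comm _ _)))
    refine (mul_le_mul_of_nonneg_left e1 (by positivity)).trans ?_
    have e2 : ((2 : ℝ) ^ M N)⁻¹ ^ 2 * (Real.exp D * (C * ((2 : ℝ) ^ M N) ^ 2)) = Real.exp D * C := by
      field_simp
    rw [e2]
    have := mul_le_mul_of_nonneg_left hmax1 hD.le
    linarith
  · have hMlog : M N ≤ 4 * Real.log N := by
      have e := Real.log_lt_log hq hs
      rw [Real.log_rpow two_pos, Real.log_pow] at e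
      push_cast at e
      have := Real.log_two_gt_d9
      nlinarith
    have e1 : ∀ σ ∈ cloudSet (x N), ∑ τ ∈ (cloudSet (x N)).erase σ,
        Real.exp (K * (M N * |ν (overlap τ σ)|)) ≤ (cloudSet (x N)).card * Real.exp 1 := by
      intro σ hσ
      have e2 : ∀ τ ∈ (cloudSet (x N)).erase σ,
          Real.exp (K * (M N * |ν (overlap τ σ)|)) ≤ Real.exp 1 := by
        intro τ hτ
        refine Real.exp_le_exp.2 (le_trans (mul_le_mul_of_nonneg_left ?_ hK) h4)
        exact mul_le_mul hMlog ((hν _ (abs_overlap_le_one τ σ)).trans (h3 hs σ hσ τ hτ))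
          (abs_nonneg _) (h5.trans hMlog)
      refine (Finset.sum_le_card_nsmul _ _ _ e2).trans ?_
      rw [nsmul_eq_mul]
      refine mul_le_mul_of_nonneg_right ?_ (Real.exp_pos _).le
      exact_mod_cast Finset.card_le_card (Finset.erase_subset _ _)
    have e3 := Finset.sum_le_card_nsmul _ _ _ e1
    rw [nsmul_eq_mul] at e3
    refine (mul_le_mul_of_nonneg_left e3 (by positivity)).trans ?_
    have e4 : ((2 : ℝ) ^ M N)⁻¹ ^ 2 * ((cloudSet (x N)).card * ((cloudSet (x N)).card * Real.exp 1)) =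
        ((cloudSet (x N)).card * ((2 : ℝ) ^ M N)⁻¹) ^ 2 * Real.exp 1 := by ring
    rw [e4]
    have e5 : ((cloudSet (x N)).card * ((2 : ℝ) ^ M N)⁻¹) ^ 2 ≤ (2 : ℝ) ^ 2 :=
      pow_le_pow_left₀ (by positivity) h6 2
    have e6 := mul_le_mul_of_nonneg_right e5 (Real.exp_pos 1).le
    have : 0 ≤ Real.exp D * max |C| (4 * Real.exp 1) := by positivity
    linarith

lemma tendsto_atTop_of_log_isLittleO {M : ℕ → ℝ}
    (hM : (fun N : ℕ => Real.log N) =o[atTop] fun N : ℕ => (2 : ℝ) ^ (M N)) :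
    Tendsto M atTop atTop := by
  rw [tendsto_atTop]
  intro B
  have h1 := (Real.tendsto_log_atTop.comp (tendsto_natCast_atTop_atTop (R := ℝ))).eventually_ge_atTop
    ((2 : ℝ) ^ B)
  filter_upwards [hM.bound one_pos, h1] with N h2 h3
  rw [one_mul, Real.norm_of_nonneg (by positivity : (0 : ℝ) ≤ (2 : ℝ) ^ M N)] at h2
  have h4 : (2 : ℝ) ^ B ≤ (2 : ℝ) ^ M N := h3.trans ((le_abs_self _).trans h2)
  exact (Real.rpow_le_rpow_left_iff one_lt_two).1 h4

lemma IsGaussianHamiltonian.isUnitGaussian {Ω : Type*} [MeasurableSpace Ω] {Pg : Measure Ω}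
    {ν : ℝ → ℝ} {H : (N : ℕ) → Spin N → Ω → ℝ} (h : IsGaussianHamiltonian Pg ν H) (hν : ν 1 = 1)
    {N : ℕ} (hN : 0 < N) : IsUnitGaussian Pg (fun σ τ => ν (overlap σ τ)) (H N) where
  gaussian := h.gaussian N
  centered := h.centered N
  cov_eq := h.cov_eq N
  unit σ := by simp only [overlap_self hN, hν]

section

variable {Ω : Type*} [MeasurableSpace Ω] {Pg : Measure Ω}
  {ν : ℝ → ℝ} {H : (N : ℕ) → Spin N → Ω → ℝ} {M : ℕ → ℝ} {a : ℝ} {x : (N : ℕ) → Spin N → Bool}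

lemma IsTypicalCloud.eventually_offDiag (h : IsTypicalCloud M a x)
    (hν : ∀ r, |r| ≤ 1 → |ν r| ≤ |r|) : ∀ᶠ N in atTop, ∀ σ ∈ cloudSet (x N),
      ∀ τ ∈ (cloudSet (x N)).erase σ, |ν (overlap τ σ)| ≤ 4 / 5 := by
  filter_upwards [h.offDiag] with N hN σ hσ τ hτ
  exact (hν _ (abs_overlap_le_one τ σ)).trans (hN σ hσ τ hτ)

theorem IsTypicalCloud.convergesToPoisson [IsProbabilityMeasure Pg] (h : IsTypicalCloud M a x)
    (hH : IsGaussianHamiltonian Pg ν H) (hM : Tendsto M atTop atTop) (hν1 : ν 1 = 1)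
    (hν : ∀ r, |r| ≤ 1 → |ν r| ≤ |r|)
    (hpair : ∀ K : ℕ, ∀ᶠ N in atTop, ∀ r : ℝ, |r| ≤ 1 →
      K * (M N * |ν r|) ≤ a * (N * r ^ 2) + 1) :
    ConvergesToPoisson Pg (fun N => pointProcess (M N) (x N) (H N)) intensity := by
  obtain ⟨C, hC⟩ := h.exists_pairSum_bound (hM.eventually_ge_atTop 0) hν
  refine convergesToPoisson_of_pairSum (c := fun N σ τ => ν (overlap σ τ)) hM ?_
    (fun N σ => (hH.gaussian N).aemeasurable σ) h.card (r₀ := 4 / 5) (by norm_num)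
    (h.eventually_offDiag hν) fun K => hC K 1 (Nat.cast_nonneg K) (hpair K)
  filter_upwards [eventually_gt_atTop 0] with N hN using hH.isUnitGaussian hν1 hN

theorem IsTypicalCloud.isModerateCloud (h : IsTypicalCloud M a x)
    (hH : IsGaussianHamiltonian Pg ν H) (hM : Tendsto M atTop atTop) (hν1 : ν 1 = 1)
    (hν : ∀ r, |r| ≤ 1 → |ν r| ≤ |r|) {D : ℝ}
    (hpair : ∀ᶠ N in atTop, ∀ r : ℝ, |r| ≤ 1 →
      2 * Real.log 2 * (M N * |ν r|) ≤ a * (N * r ^ 2) + D) :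
    IsModerateCloud Pg M (fun _ σ τ => ν (overlap σ τ)) H x where
  tendsto := hM
  unit := by filter_upwards [eventually_gt_atTop 0] with N hN using hH.isUnitGaussian hν1 hN
  aemeasurable N σ := (hH.gaussian N).aemeasurable σ
  card := h.card
  offDiag := ⟨4 / 5, by norm_num, h.eventually_offDiag hν⟩
  pairs := by
    obtain ⟨C, hC⟩ := h.exists_pairSum_bound (hM.eventually_ge_atTop 0) hν
    exact ⟨_, hC _ D (by have := Real.log_pos one_lt_two; positivity) hpair⟩

end

/-! ### The location of the extremes -/

/-- For large `M` one has `M log 2 / 2 ≤ a² ≤ 2M log 2` and `b s ≤ a/4`, so `y` lies between `3a/4`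
and `5a/4`. These bounds evaluate `q` on the windows. -/
lemma eventually_window_bounds (s : ℝ) : ∀ᶠ M : ℝ in atTop, ∀ y : ℝ,
    |(y - center M) / scale M| ≤ s →
      0 ≤ y ∧ M * Real.log 2 / 4 ≤ y ^ 2 ∧ y ^ 2 ≤ 4 * M * Real.log 2 := by
  have hlog : ∀ᶠ M : ℝ in atTop, Real.log M ≤ Real.log 2 / 2 * M := by
    have := Real.isLittleO_log_id_atTop.bound (show 0 < Real.log 2 / 2 by
      have := Real.log_pos one_lt_two; positivity)
    filter_upwards [this, eventually_ge_atTop 0] with M h1 h2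
    rw [id, Real.norm_of_nonneg h2] at h1
    exact (le_abs_self _).trans h1
  filter_upwards [eventually_scale_mul_le_center (4 * s), hlog, eventually_ge_atTop 2]
    with M h1 h2 h3 y hy
  have hM0 : 0 < M := by linarith
  have hb := scale_pos hM0
  have hl := Real.log_pos one_lt_two
  rw [abs_div, abs_of_pos hb, div_le_iff₀ hb] at hy
  obtain ⟨hy1, hy2⟩ := abs_le.1 hy
  have hc := center_nonneg M
  have hc2 := center_sq_le (show 1 ≤ M by linarith)
  have hc1 : M * Real.log 2 ≤ 2 * center M ^ 2 := by
    rw [center_sq hM0]; nlinarith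
  have hlo : 3 / 4 * center M ≤ y := by linarith
  have hhi : y ≤ 5 / 4 * center M := by linarith
  have hy0 : 0 ≤ y := by linarith
  refine ⟨hy0, ?_, ?_⟩
  · have := pow_le_pow_left₀ (by positivity) hlo 2
    nlinarith
  · have := pow_le_pow_left₀ hy0 hhi 2
    nlinarith

/-! ### Common factors of the two Hamiltonians -/

/-- The moments of the remainder follow from those of `V` and `q`, since `W = V - q(H i)`; the
factor 4 comes from `(u - v)² ≤ 2u² + 2v²`. -/
lemma IsUnitGaussian.isCommonFactor {ι Ω : Type*} [MeasurableSpace Ω] {P : Measure Ω}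
    {c : ι → ι → ℝ} {H : ι → Ω → ℝ} {V : Ω → ℝ} {q : ℝ → ℝ} {W : ι → Ω → ℝ} {A : ℝ}
    (h : IsUnitGaussian P c H) (hV : MemLp V 2 P) (hV0 : ∫ ω, V ω ∂P = 0)
    (hVA : ∫ ω, V ω ^ 2 ∂P ≤ A) (hqm : Measurable q) (hq : MemLp q 2 (gaussianReal 0 1))
    (hq0 : ∫ y, q y ∂(gaussianReal 0 1) = 0) (hqA : ∫ y, q y ^ 2 ∂(gaussianReal 0 1) ≤ A)
    (hVW : ∀ i, ∀ᵐ ω ∂P, V ω = q (H i ω) + W i ω) (hW : ∀ i, IndepFun (W i) (H i) P) :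
    IsCommonFactor P H V q W (4 * A) := by
  have := h.gaussian.isProbabilityMeasure
  have hA : 0 ≤ A := (integral_nonneg fun ω => sq_nonneg (V ω)).trans hVA
  have hqH : ∀ i, MemLp (fun ω => q (H i ω)) 2 P := fun i => by
    rw [← h.map_eq i] at hq
    exact hq.comp_of_map (h.aemeasurable i)
  have hWe : ∀ i, (fun ω => V ω - q (H i ω)) =ᵐ[P] W i := fun i => by
    filter_upwards [hVW i] with ω hω
    rw [hω]; ring
  have hWL : ∀ i, MemLp (W i) 2 P := fun i => (hV.sub (hqH i)).ae_eq (hWe i)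
  have e0 : ∀ i, ∫ ω, q (H i ω) ∂P = 0 := fun i => by
    rw [← hq0, ← h.map_eq i, integral_map (h.aemeasurable i) hqm.aestronglyMeasurable]
  have e1 : ∀ i, ∫ ω, q (H i ω) ^ 2 ∂P ≤ A := fun i => by
    refine le_trans (le_of_eq ?_) hqA
    rw [← h.map_eq i, integral_map (h.aemeasurable i) (hqm.pow_const 2).aestronglyMeasurable]
  refine ⟨hV, hV0, by linarith, hVW, hW, hWL, fun i => ?_, fun i => ?_⟩
  · rw [← integral_congr_ae (hWe i), integral_sub (hV.integrable one_le_two)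
      ((hqH i).integrable one_le_two), hV0, e0, sub_zero]
  · have i1 := hV.integrable_sq.const_mul 2
    have i2 := (hqH i).integrable_sq.const_mul 2
    have : ∫ ω, W i ω ^ 2 ∂P ≤ ∫ ω, (2 * V ω ^ 2 + 2 * q (H i ω) ^ 2) ∂P := by
      refine integral_mono_ae (hWL i).integrable_sq (i1.add i2) ?_
      filter_upwards [hWe i] with ω hω
      rw [← hω]
      change _ ≤ 2 * V ω ^ 2 + 2 * q (H i ω) ^ 2
      nlinarith [sq_nonneg (V ω + q (H i ω))]
    rw [integral_add i1 i2, integral_const_mul, integral_const_mul] at this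
    linarith [e1 i]

/-! ### Orthogonality relations of the spin coordinates -/

section Spins

variable {N : ℕ}

/-- For distinct sites, flipping the spin at `i` changes the sign of the summand. -/
lemma sum_spin_mul_spin (i j : Fin N) :
    ∑ τ : Spin N, (((τ i : ℤ) : ℝ) * ((τ j : ℤ) : ℝ)) = if i = j then (2 : ℝ) ^ N else 0 := by
  split_ifs with hij
  · subst hij
    simp only [spin_mul_self, Finset.sum_const, Finset.card_univ, nsmul_eq_mul, mul_one]
    exact card_spin N
  · have h := Equiv.sum_comp (Equiv.mulRight (Pi.mulSingle i (-1) : Spin N))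
      fun τ : Spin N => ((τ i : ℤ) : ℝ) * ((τ j : ℤ) : ℝ)
    have e : ∀ τ : Spin N, (((Equiv.mulRight (Pi.mulSingle i (-1) : Spin N) τ) i : ℤ) : ℝ) *
        (((Equiv.mulRight (Pi.mulSingle i (-1) : Spin N) τ) j : ℤ) : ℝ) =
        -(((τ i : ℤ) : ℝ) * ((τ j : ℤ) : ℝ)) := by
      intro τ
      simp [Ne.symm hij]
    simp only [e, Finset.sum_neg_distrib] at h
    linarith

lemma sum_spin_mul_overlap (hN : 0 < N) (i : Fin N) (σ : Spin N) :
    ∑ τ : Spin N, ((τ i : ℤ) : ℝ) * overlap τ σ = 2 ^ N / N * ((σ i : ℤ) : ℝ) := by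
  have h0 : (N : ℝ) ≠ 0 := by positivity
  have e : ∀ τ : Spin N, ((τ i : ℤ) : ℝ) * overlap τ σ =
      ∑ l, (1 / (N : ℝ) * ((σ l : ℤ) : ℝ)) * (((τ i : ℤ) : ℝ) * ((τ l : ℤ) : ℝ)) := by
    intro τ
    unfold overlap
    rw [Finset.mul_sum, Finset.mul_sum]
    exact Finset.sum_congr rfl fun l _ => by ring
  simp only [e]
  rw [Finset.sum_comm]
  simp only [← Finset.mul_sum, sum_spin_mul_spin, mul_ite, mul_zero, Finset.sum_ite_eq,
    Finset.mem_univ, if_true]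
  ring

lemma sum_overlap_sq (hN : 0 < N) (σ : Spin N) :
    ∑ τ : Spin N, overlap τ σ ^ 2 = 2 ^ N / N := by
  have h0 : (N : ℝ) ≠ 0 := by positivity
  have e : ∀ τ : Spin N, overlap τ σ ^ 2 =
      ∑ l, (1 / (N : ℝ) * ((σ l : ℤ) : ℝ)) * (((τ l : ℤ) : ℝ) * overlap τ σ) := by
    intro τ
    rw [sq]
    conv_lhs => enter [1]; unfold overlap
    rw [Finset.mul_sum, Finset.sum_mul]
    exact Finset.sum_congr rfl fun l _ => by ring
  simp only [e]
  rw [Finset.sum_comm]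
  simp only [← Finset.mul_sum, sum_spin_mul_overlap hN]
  have e2 : ∀ l, 1 / (N : ℝ) * ((σ l : ℤ) : ℝ) * (2 ^ N / N * ((σ l : ℤ) : ℝ)) =
      1 / N * (2 ^ N / N) := fun l => by
    rw [show 1 / (N : ℝ) * ((σ l : ℤ) : ℝ) * (2 ^ N / N * ((σ l : ℤ) : ℝ)) =
      1 / N * (2 ^ N / N) * (((σ l : ℤ) : ℝ) * ((σ l : ℤ) : ℝ)) by ring, spin_mul_self, mul_one]
  simp only [e2, Finset.sum_const, Finset.card_univ, Fintype.card_fin, nsmul_eq_mul]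
  field_simp

end Spins

/-! ### Construction of the common factors -/

section Factors

variable {Ω : Type*} [MeasurableSpace Ω] {P : Measure Ω} {N : ℕ} {H : Spin N → Ω → ℝ}

/-- The normalizing constant `√N / 2^N` of the linear statistics of the field. -/
def spinScale (N : ℕ) : ℝ := √N / 2 ^ N

lemma spinScale_mul (hN : 0 < N) : spinScale N * (2 ^ N / N) = 1 / √N := by
  have h0 : (0 : ℝ) < √N := Real.sqrt_pos.2 (by positivity)
  have h1 : (√N) * √N = (N : ℝ) := Real.mul_self_sqrt (by positivity)
  unfold spinScale
  rw [div_mul_div_comm, mul_comm (√(N : ℝ)), mul_div_mul_left _ _ (by positivity)]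
  rw [div_eq_div_iff (by positivity) h0.ne', h1, one_mul]

lemma memLp_pow_gaussian (k : ℕ) : MemLp (fun y : ℝ => y ^ k) 2 (gaussianReal 0 1) := by
  rcases Nat.eq_zero_or_pos k with rfl | hk
  · simpa using memLp_const (1 : ℝ)
  have h := memLp_id_gaussianReal' (μ := 0) (v := 1) ((k : ℝ≥0∞) * 2) (by finiteness)
  have h2 := h.norm_rpow_div (k : ℝ≥0∞)
  rw [mul_comm, ENNReal.mul_div_cancel_right (by positivity) (by finiteness)] at h2
  refine h2.mono (by fun_prop) (.of_forall fun y => ?_)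
  simp

lemma integral_sq_gaussian : ∫ y, y ^ 2 ∂(gaussianReal 0 1) = 1 := by
  have h := variance_fun_id_gaussianReal (μ := 0) (v := 1)
  rw [variance_eq_sub (by simpa using memLp_pow_gaussian 1)] at h
  simpa using h

/-- The empirical mean of the SK Hamiltonian is a common factor. -/
lemma IsUnitGaussian.isCommonFactor_sum
    (h : IsUnitGaussian P (fun σ τ => overlap σ τ ^ 2) H) (hN : 0 < N) :
    IsCommonFactor P H (fun ω => spinScale N * ∑ τ, H τ ω) (fun y => y / √N)
      (fun σ ω => spinScale N *
        ∑ τ, resid (fun σ τ => overlap σ τ ^ 2) H σ τ ω) 4 := by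
  have := h.gaussian.isProbabilityMeasure
  have h0 : (0 : ℝ) < √N := Real.sqrt_pos.2 (by positivity)
  have h1 : (√N) * √N = (N : ℝ) := Real.mul_self_sqrt (by positivity)
  have hN1 : (1 : ℝ) ≤ N := by exact_mod_cast hN
  have hS : MemLp (fun ω => ∑ τ, H τ ω) 2 P := memLp_finsetSum _ fun τ _ => h.memLp τ
  have hS0 : ∫ ω, ∑ τ, H τ ω ∂P = 0 := by
    rw [integral_finsetSum _ fun τ _ => (h.memLp τ).integrable one_le_two]
    simp [h.centered]
  have hV : MemLp (fun ω => spinScale N * ∑ τ, H τ ω) 2 P := hS.const_mul _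
  have hV0 : ∫ ω, spinScale N * ∑ τ, H τ ω ∂P = 0 := by rw [integral_const_mul, hS0, mul_zero]
  have key := h.isCommonFactor (A := 1) hV hV0 ?_ (q := fun y => y / √N) (by fun_prop) ?_ ?_ ?_
    (W := fun σ ω => spinScale N * ∑ τ, resid (fun σ τ => overlap σ τ ^ 2) H σ τ ω) ?_ ?_
  · simpa using key
  · refine le_of_eq ?_
    have e : ∫ ω, (spinScale N * ∑ τ, H τ ω) ^ 2 ∂P =
        cov[fun ω => spinScale N * ∑ τ, H τ ω, fun ω => spinScale N * ∑ τ, H τ ω; P] := by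
      rw [covariance_eq_sub hV hV, hV0]
      simp [sq]
    rw [e, covariance_const_mul_left, covariance_const_mul_right,
      covariance_fun_sum_fun_sum h.memLp h.memLp]
    simp only [h.cov_eq]
    rw [Finset.sum_comm]
    simp only [sum_overlap_sq hN, Finset.sum_const, Finset.card_univ, nsmul_eq_mul, card_spin]
    rw [mul_left_comm (spinScale N) (2 ^ N), spinScale_mul hN]
    unfold spinScale
    field_simp
  · simpa [div_eq_mul_inv] using (memLp_pow_gaussian 1).mul_const (√(N : ℝ))⁻¹
  · rw [integral_div, integral_id_gaussianReal, zero_div]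
  · simp only [div_pow]
    rw [integral_div, integral_sq_gaussian, Real.sq_sqrt (by positivity)]
    exact div_le_one_of_le₀ hN1 (by positivity)
  -- The row sum `∑ R²` equals `2^N/N` for every `σ`, so regressing the total on any `H σ` gives the
  -- same coefficient, which the normalization turns into `1/√N`.
  · refine fun σ => .of_forall fun ω => ?_
    have e : ∑ τ, H τ ω = ∑ τ, resid (fun σ τ => overlap σ τ ^ 2) H σ τ ω +
        (2 ^ N / N) * H σ ω := by
      rw [← sum_overlap_sq hN σ, Finset.sum_mul, ← Finset.sum_add_distrib]
      exact Finset.sum_congr rfl fun τ _ => eq_resid_add _ H σ τ ω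
    change spinScale N * ∑ τ, H τ ω = _
    rw [e, mul_add, ← mul_assoc, spinScale_mul hN]
    ring
  · intro σ
    exact (h.indepFun_resid σ).comp (φ := fun z : Spin N → ℝ => spinScale N * ∑ τ, z τ)
      ((Finset.measurable_fun_sum _ fun τ _ => measurable_pi_apply τ).const_mul _) measurable_id

/-- The coordinates `√N / 2^N ∑_τ τᵢ H(τ)` of the number partitioning Hamiltonian. -/
def coordField (H : Spin N → Ω → ℝ) (i : Fin N) (ω : Ω) : ℝ :=
  spinScale N * ∑ τ : Spin N, ((τ i : ℤ) : ℝ) * H τ ω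

lemma memLp_coordField (h : IsUnitGaussian P overlap H) (i : Fin N) :
    MemLp (coordField H i) 2 P :=
  (memLp_finsetSum _ fun τ _ => (h.memLp τ).const_mul _).const_mul _

lemma covariance_coordField_left (h : IsUnitGaussian P overlap H) (hN : 0 < N) (i : Fin N)
    (σ : Spin N) : cov[coordField H i, H σ; P] = ((σ i : ℤ) : ℝ) / √N := by
  have := h.gaussian.isProbabilityMeasure
  unfold coordField
  rw [covariance_const_mul_left,
    covariance_fun_sum_left (fun τ => (h.memLp τ).const_mul _) (h.memLp σ)]
  simp only [covariance_const_mul_left, h.cov_eq, sum_spin_mul_overlap hN]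
  rw [← mul_assoc, spinScale_mul hN]
  ring

/-- The overlap kernel has rank N: the coordinates form a standard Gaussian vector, recovered from
the field by inverting `H σ = ⟨G, σ⟩/√N`. -/
lemma isUnitGaussian_coordField (h : IsUnitGaussian P overlap H) (hN : 0 < N) :
    IsUnitGaussian P (fun i j => if i = j then (1 : ℝ) else 0) (coordField H) where
  gaussian := by
    refine IsGaussianProcess.of_isGaussianProcess h.gaussian fun i => ⟨Finset.univ, spinScale N •
      ∑ τ : (Finset.univ : Finset (Spin N)), ((τ.1 i : ℤ) : ℝ) • ContinuousLinearMap.proj τ,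
      fun ω => ?_⟩
    simp [coordField]
  centered i := by
    have := h.gaussian.isProbabilityMeasure
    unfold coordField
    rw [integral_const_mul,
      integral_finsetSum _ fun τ _ => ((h.memLp τ).integrable one_le_two).const_mul _]
    simp [integral_const_mul, h.centered]
  cov_eq i j := by
    have := h.gaussian.isProbabilityMeasure
    have h0 : (0 : ℝ) < √N := Real.sqrt_pos.2 (by positivity)
    conv_lhs => enter [2]; unfold coordField
    rw [covariance_const_mul_right, covariance_fun_sum_right (fun τ => (h.memLp τ).const_mul _)
      (memLp_coordField h i)]
    simp only [covariance_const_mul_right, covariance_coordField_left h hN, ← mul_div_assoc]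
    rw [← Finset.sum_div, sum_spin_mul_spin]
    by_cases hij : i = j
    · subst hij
      simp only [if_true, spinScale]
      field_simp
    · simp [hij, Ne.symm hij]
  unit i := by simp

/-- The two sides have equal variances and covariance, all `N`, so their centered difference has
variance zero. The identity is therefore only almost sure. -/
lemma ae_eq_sum_coordField (h : IsUnitGaussian P overlap H) (hN : 0 < N) (σ : Spin N) :
    ∀ᵐ ω ∂P, ∑ i, ((σ i : ℤ) : ℝ) * coordField H i ω = √N * H σ ω := by
  have := h.gaussian.isProbabilityMeasure
  have h0 : (0 : ℝ) < √N := Real.sqrt_pos.2 (by positivity)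
  have h1 : (√N) * √N = (N : ℝ) := Real.mul_self_sqrt (by positivity)
  have hg := isUnitGaussian_coordField h hN
  have hS : MemLp (fun ω => ∑ i, ((σ i : ℤ) : ℝ) * coordField H i ω) 2 P :=
    memLp_finsetSum _ fun i _ => (hg.memLp i).const_mul _
  have hT : MemLp (fun ω => √N * H σ ω) 2 P := (h.memLp σ).const_mul _
  have hD : MemLp (fun ω => ∑ i, ((σ i : ℤ) : ℝ) * coordField H i ω - √N * H σ ω) 2 P := hS.sub hT
  have hD0 : ∫ ω, (∑ i, ((σ i : ℤ) : ℝ) * coordField H i ω - √N * H σ ω) ∂P = 0 := by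
    rw [integral_sub (hS.integrable one_le_two) (hT.integrable one_le_two), integral_const_mul,
      integral_finsetSum _ fun i _ => ((hg.memLp i).integrable one_le_two).const_mul _]
    simp [integral_const_mul, h.centered, hg.centered]
  have c1 : cov[fun ω => ∑ i, ((σ i : ℤ) : ℝ) * coordField H i ω,
      fun ω => ∑ i, ((σ i : ℤ) : ℝ) * coordField H i ω; P] = N := by
    rw [covariance_fun_sum_fun_sum (fun i => (hg.memLp i).const_mul _)
      fun i => (hg.memLp i).const_mul _]
    simp [covariance_const_mul_left, covariance_const_mul_right, hg.cov_eq, spin_mul_self]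
  have c2 : cov[fun ω => ∑ i, ((σ i : ℤ) : ℝ) * coordField H i ω,
      fun ω => √N * H σ ω; P] = N := by
    rw [covariance_fun_sum_left (fun i => (hg.memLp i).const_mul _) hT]
    have e1 : ∀ i, cov[fun ω => ((σ i : ℤ) : ℝ) * coordField H i ω, fun ω => √N * H σ ω; P] =
        ((σ i : ℤ) : ℝ) * (√N * (((σ i : ℤ) : ℝ) / √N)) := fun i => by
      rw [covariance_const_mul_left, covariance_const_mul_right, covariance_coordField_left h hN]
    have : ∀ i, ((σ i : ℤ) : ℝ) * (√N * (((σ i : ℤ) : ℝ) / √N)) = 1 := fun i => by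
      rw [mul_div_cancel₀ _ h0.ne', spin_mul_self]
    simp [e1, this]
  have c3 : cov[fun ω => √N * H σ ω, fun ω => √N * H σ ω; P] = N := by
    rw [covariance_const_mul_left, covariance_const_mul_right, h.cov_eq, h.unit, mul_one, h1]
  have e : ∫ ω, (∑ i, ((σ i : ℤ) : ℝ) * coordField H i ω - √N * H σ ω) ^ 2 ∂P = 0 := by
    have e1 : ∫ ω, (∑ i, ((σ i : ℤ) : ℝ) * coordField H i ω - √N * H σ ω) ^ 2 ∂P =
        cov[fun ω => ∑ i, ((σ i : ℤ) : ℝ) * coordField H i ω - √N * H σ ω,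
          fun ω => ∑ i, ((σ i : ℤ) : ℝ) * coordField H i ω - √N * H σ ω; P] := by
      rw [covariance_eq_sub hD hD, hD0]
      simp [sq]
    rw [e1, covariance_fun_sub_fun_sub hS hT hS hT, c1, c2, c3, covariance_comm, c2]
    ring
  rw [integral_eq_zero_iff_of_nonneg (fun ω => sq_nonneg _) hD.integrable_sq] at e
  filter_upwards [e] with ω hω
  have := pow_eq_zero_iff (two_ne_zero) |>.1 hω
  linarith

/-- The normalized square norm of the coordinates is a common factor of the number partitioning
Hamiltonian. -/
lemma IsUnitGaussian.isCommonFactor_sq (h : IsUnitGaussian P overlap H) (hN : 0 < N) :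
    IsCommonFactor P H (fun ω => (∑ i, (coordField H i ω ^ 2 - 1)) / √N)
      (fun y => (y ^ 2 - 1) / √N)
      (fun σ ω => (∑ i : Fin N, (spinScale N * ∑ τ : Spin N, ((τ i : ℤ) : ℝ) *
        resid overlap H σ τ ω) ^ 2 - (N - 1)) / √N)
      (4 * ∫ y : ℝ, (y ^ 2 - 1) ^ 2 ∂(gaussianReal 0 1)) := by
  have := h.gaussian.isProbabilityMeasure
  have h0 : (0 : ℝ) < √N := Real.sqrt_pos.2 (by positivity)
  have h1 : (√N) * √N = (N : ℝ) := Real.mul_self_sqrt (by positivity)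
  have hN1 : (1 : ℝ) ≤ N := by exact_mod_cast hN
  have hg := isUnitGaussian_coordField h hN
  have hq : MemLp (fun y : ℝ => y ^ 2 - 1) 2 (gaussianReal 0 1) :=
    (memLp_pow_gaussian 2).sub (memLp_const 1)
  have hq0 : ∫ y : ℝ, (y ^ 2 - 1) ∂(gaussianReal 0 1) = 0 := by
    rw [integral_sub ((memLp_pow_gaussian 2).integrable one_le_two) (integrable_const _),
      integral_sq_gaussian]
    simp
  have hA : 0 ≤ ∫ y : ℝ, (y ^ 2 - 1) ^ 2 ∂(gaussianReal 0 1) := integral_nonneg fun y => sq_nonneg _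
  have hqm : Measurable fun y : ℝ => y ^ 2 - 1 := by fun_prop
  have hZ : ∀ i, MemLp (fun ω => coordField H i ω ^ 2 - 1) 2 P := fun i => by
    rw [← hg.map_eq i] at hq
    exact hq.comp_of_map (hg.aemeasurable i)
  have hZ0 : ∀ i, ∫ ω, (coordField H i ω ^ 2 - 1) ∂P = 0 := fun i => by
    rw [← hq0, ← hg.map_eq i, integral_map (hg.aemeasurable i) hqm.aestronglyMeasurable]
  have hZ2 : ∀ i, Var[fun ω => coordField H i ω ^ 2 - 1; P] =
      ∫ y : ℝ, (y ^ 2 - 1) ^ 2 ∂(gaussianReal 0 1) := fun i => by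
    rw [variance_of_integral_eq_zero (hZ i).1.aemeasurable (hZ0 i), ← hg.map_eq i,
      integral_map (hg.aemeasurable i) (hqm.pow_const 2).aestronglyMeasurable]
  have hS : MemLp (fun ω => ∑ i, (coordField H i ω ^ 2 - 1)) 2 P :=
    memLp_finsetSum _ fun i _ => hZ i
  have hS0 : ∫ ω, ∑ i, (coordField H i ω ^ 2 - 1) ∂P = 0 := by
    rw [integral_finsetSum _ fun i _ => (hZ i).integrable one_le_two]
    simp only [hZ0, Finset.sum_const_zero]
  have hind : Pairwise fun i j => IndepFun (fun ω => coordField H i ω ^ 2 - 1)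
      (fun ω => coordField H j ω ^ 2 - 1) P := by
    intro i j hij
    have h2 := (hg.indepFun_resid j).comp (φ := fun z : Fin N → ℝ => z i ^ 2 - 1)
      (by fun_prop) hqm
    have e : ((fun z : Fin N → ℝ => z i ^ 2 - 1) ∘ fun ω k =>
        resid (fun i j => if i = j then (1 : ℝ) else 0) (coordField H) j k ω) =
        fun ω => coordField H i ω ^ 2 - 1 := by
      funext ω
      simp [resid, hij]
    rw [e] at h2
    exact h2
  have hS2 : ∫ ω, (∑ i, (coordField H i ω ^ 2 - 1)) ^ 2 ∂P =
      (N : ℝ) * ∫ y : ℝ, (y ^ 2 - 1) ^ 2 ∂(gaussianReal 0 1) := by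
    rw [← variance_of_integral_eq_zero hS.1.aemeasurable hS0]
    have e := IndepFun.variance_sum (μ := P) (s := Finset.univ)
      (X := fun i ω => coordField H i ω ^ 2 - 1) (fun i _ => hZ i) fun i _ j _ hij => hind hij
    have e2 : (∑ i : Fin N, fun ω => coordField H i ω ^ 2 - 1) =
        fun ω => ∑ i, (coordField H i ω ^ 2 - 1) := by
      funext ω; simp
    rw [e2] at e
    rw [e]
    simp [hZ2]
  refine h.isCommonFactor ?_ ?_ ?_ ?_ ?_ ?_ ?_ ?_ ?_
  · simpa only [div_eq_mul_inv] using hS.mul_const (√(N : ℝ))⁻¹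
  · rw [integral_div, hS0, zero_div]
  · simp only [div_pow]
    rw [integral_div, hS2, Real.sq_sqrt (by positivity)]
    refine le_of_eq ?_
    field_simp
  · fun_prop
  · simpa only [div_eq_mul_inv] using hq.mul_const (√(N : ℝ))⁻¹
  · rw [integral_div, hq0, zero_div]
  · simp only [div_pow]
    rw [integral_div, Real.sq_sqrt (by positivity)]
    exact div_le_self hA hN1
  · intro σ
    -- Pythagoras: `|G|²` is `H σ ^ 2`, the square of its component along `σ/√N`, plus the squared
    -- norm of the orthogonal part, which is built from residuals alone.
    filter_upwards [ae_eq_sum_coordField h hN σ] with ω hω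
    have e : ∀ i, spinScale N * ∑ τ : Spin N, ((τ i : ℤ) : ℝ) * resid overlap H σ τ ω =
        coordField H i ω - ((σ i : ℤ) : ℝ) * (H σ ω / √N) := by
      intro i
      have e1 : ∑ τ : Spin N, ((τ i : ℤ) : ℝ) * resid overlap H σ τ ω =
          ∑ τ : Spin N, ((τ i : ℤ) : ℝ) * H τ ω -
            (∑ τ : Spin N, ((τ i : ℤ) : ℝ) * overlap τ σ) * H σ ω := by
        rw [Finset.sum_mul, ← Finset.sum_sub_distrib]
        exact Finset.sum_congr rfl fun τ _ => by unfold resid; ring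
      rw [e1, sum_spin_mul_overlap hN, mul_sub, ← mul_assoc, ← mul_assoc, spinScale_mul hN]
      unfold coordField
      ring
    have e2 : ∀ i, (coordField H i ω - ((σ i : ℤ) : ℝ) * (H σ ω / √N)) ^ 2 =
        coordField H i ω ^ 2 - 2 * (H σ ω / √N) * (((σ i : ℤ) : ℝ) * coordField H i ω) +
          (H σ ω / √N) ^ 2 := by
      intro i
      linear_combination (H σ ω / √N) ^ 2 * spin_mul_self (σ i)
    simp only [e, e2, Finset.sum_add_distrib, Finset.sum_sub_distrib, ← Finset.mul_sum, hω,
      Finset.sum_const, Finset.card_univ, Fintype.card_fin, nsmul_eq_mul, mul_one, div_pow,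
      Real.sq_sqrt (Nat.cast_nonneg N)]
    rw [← add_div]
    congr 1
    field_simp
    ring
  · intro σ
    exact (h.indepFun_resid σ).comp (φ := fun z : Spin N → ℝ => (∑ i : Fin N, (spinScale N *
      ∑ τ : Spin N, ((τ i : ℤ) : ℝ) * z τ) ^ 2 - (N - 1)) / √N) (by fun_prop) measurable_id

end Factors

/-! ### The two models -/

lemma exists_le_mul_of_limsup_lt {u v : ℕ → ℝ} (hv : ∀ᶠ N in atTop, 0 < v N) {b : EReal}
    (h : limsup (fun N => ((u N / v N : ℝ) : EReal)) atTop < b) :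
    ∃ C : ℝ, (C : EReal) < b ∧ ∀ᶠ N in atTop, u N ≤ C * v N := by
  obtain ⟨C, hC, hCb⟩ := EReal.lt_iff_exists_real_btwn.1 h
  refine ⟨C, hCb, ?_⟩
  filter_upwards [eventually_lt_of_limsup_lt hC, hv] with N h1 h2
  exact (div_le_iff₀ h2).1 (EReal.coe_lt_coe_iff.1 h1).le

lemma exists_frequently_lt_of_not_isLittleO {u v : ℕ → ℝ} (hu : ∀ᶠ N in atTop, 0 ≤ u N)
    (hv : ∀ᶠ N in atTop, 0 ≤ v N) (h : ¬ u =o[atTop] v) :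
    ∃ c : ℝ, 0 < c ∧ ∃ᶠ N in atTop, c * v N < u N := by
  rw [isLittleO_iff] at h
  push Not at h
  obtain ⟨c, hc, hf⟩ := h
  refine ⟨c, hc, (hf.and_eventually (hu.and hv)).mono ?_⟩
  rintro N ⟨h1, h2, h3⟩
  rwa [Real.norm_of_nonneg h2, Real.norm_of_nonneg h3] at h1

section

variable {Ω Ω' : Type*} [MeasurableSpace Ω] [MeasurableSpace Ω'] {P : Measure Ω}
  [IsProbabilityMeasure P] {Pg : Measure Ω'} [IsProbabilityMeasure Pg] {M : ℕ → ℝ}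
  {X : (N : ℕ) → Spin N → Ω → Bool} {H : (N : ℕ) → Spin N → Ω' → ℝ}

lemma tendsto_sqrt_natCast_atTop : Tendsto (fun N : ℕ => √(N : ℝ)) atTop atTop :=
  Real.tendsto_sqrt_atTop.comp tendsto_natCast_atTop_atTop

/-- Everything is expressed through `√N |r|`, whose square is controlled by the typical clouds. If
`M = o(√N)`, any multiple of `M|r|` is eventually at most `√N|r|/2`; if only `M ≤ C√N`, completing
the square costs an additive constant, harmless for second moments. The statement holds for all `Λ`
on one event because the cloud enters only through typicality. -/
theorem IsRandomCloud.ae_numberPartitioning (hX : IsRandomCloud P M X)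
    (hM : (fun N : ℕ => Real.log N) =o[atTop] fun N : ℕ => (2 : ℝ) ^ (M N))
    (hH : IsGaussianHamiltonian Pg (fun r => r) H)
    (hlim : limsup (fun N : ℕ => ((M N / √(N : ℝ) : ℝ) : EReal)) atTop < ⊤) :
    ∀ᵐ ω ∂P,
      (M =o[atTop] (fun N : ℕ => √(N : ℝ)) → ConvergesToPoisson Pg
        (fun N => pointProcess (M N) (fun σ => X N σ ω) (H N)) intensity) ∧
      ∀ Λ, ConvergesToPoisson Pg (fun N => pointProcess (M N) (fun σ => X N σ ω) (H N)) Λ →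
        M =o[atTop] fun N : ℕ => √(N : ℝ) := by
  have hl := Real.log_pos one_lt_two
  have hMt := tendsto_atTop_of_log_isLittleO hM
  have hs := tendsto_sqrt_natCast_atTop
  have hsq : ∀ N : ℕ, (N : ℝ) = √(N : ℝ) * √(N : ℝ) := fun N =>
    (Real.mul_self_sqrt (Nat.cast_nonneg N)).symm
  obtain ⟨C, -, hC⟩ := exists_le_mul_of_limsup_lt (hs.eventually_gt_atTop 0) hlim
  have hMN : ∀ᶠ N : ℕ in atTop, 2 * M N * Real.log 2 ≤ N / 4 := by
    filter_upwards [hC, hs.eventually_ge_atTop (8 * C * Real.log 2), hs.eventually_ge_atTop 0]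
      with N h1 h2 h3
    have h4 := mul_le_mul_of_nonneg_right h2 h3
    have h5 := mul_le_mul_of_nonneg_right h1 hl.le
    linarith [hsq N]
  filter_upwards [hX.ae_isTypicalCloud hM hMN (a := 1 / 8) (by norm_num) (by norm_num)] with ω hω
  refine ⟨fun ho => ?_, fun Λ hΛ => ?_⟩
  · refine hω.convergesToPoisson hH hMt rfl (fun r _ => le_rfl) fun K => ?_
    have hK : (0 : ℝ) < 1 / (2 * (K + 1)) := by positivity
    filter_upwards [ho.bound hK, hMt.eventually_ge_atTop 0] with N h1 h2 r _
    rw [Real.norm_of_nonneg h2, Real.norm_of_nonneg (Real.sqrt_nonneg _)] at h1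
    have h3 : K * M N ≤ √(N : ℝ) / 2 := by
      have h4 : (K : ℝ) * (1 / (2 * (K + 1))) ≤ 1 / 2 := by
        rw [mul_one_div, div_le_div_iff₀ (by positivity) two_pos]; linarith
      have h5 := mul_le_mul_of_nonneg_left h1 (Nat.cast_nonneg (α := ℝ) K)
      have h6 := mul_le_mul_of_nonneg_right h4 (Real.sqrt_nonneg (N : ℝ))
      linarith
    have h4 := mul_le_mul_of_nonneg_right h3 (abs_nonneg r)
    have h5 : (N : ℝ) * r ^ 2 = (√(N : ℝ) * |r|) ^ 2 := by
      rw [mul_pow, sq_abs, sq (√(N : ℝ)), ← hsq]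
    rw [h5]
    -- Completing the square gives `t/2 ≤ t²/8 + 1/2`.
    nlinarith [sq_nonneg (√(N : ℝ) * |r| - 2)]
  · by_contra hn
    obtain ⟨c, hc, hf⟩ := exists_frequently_lt_of_not_isLittleO (hMt.eventually_ge_atTop 0)
      (hs.eventually_ge_atTop 0) hn
    have hmod := hω.isModerateCloud hH hMt rfl (fun r _ => le_rfl)
      (D := 2 * (2 * Real.log 2 * C) ^ 2) ?_
    · refine hmod.not_convergesToPoisson
        (V := fun N ω => (∑ i, (coordField (H N) i ω ^ 2 - 1)) / √(N : ℝ))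
        (q := fun N y => (y ^ 2 - 1) / √(N : ℝ))
        (W := fun N σ ω => (∑ i : Fin N, (spinScale N * ∑ τ : Spin N, ((τ i : ℤ) : ℝ) *
          resid overlap (H N) σ τ ω) ^ 2 - (N - 1)) / √(N : ℝ))
        (C := 4 * ∫ y : ℝ, (y ^ 2 - 1) ^ 2 ∂(gaussianReal 0 1)) ?_ (κ := c * Real.log 2 / 8)
        (L := 4 * C * Real.log 2 + 1) (by positivity) (fun s => ?_) (fun s => ?_) hΛ
      · filter_upwards [eventually_gt_atTop 0] with N hN
        exact (hH.isUnitGaussian rfl hN).isCommonFactor_sq hN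
      · filter_upwards [hMt.eventually (eventually_window_bounds s), hC,
          hs.eventually_ge_atTop 1] with N h1 h2 h3 y hy
        obtain ⟨-, -, h4⟩ := h1 y hy
        have h5 : 0 < √(N : ℝ) := by linarith
        have h6 := mul_le_mul_of_nonneg_right h2 hl.le
        rw [abs_div, abs_of_pos h5, div_le_iff₀ h5]
        refine abs_le.2 ⟨?_, ?_⟩
        · linarith [sq_nonneg y]
        · linarith
      -- Here `y² ≥ M log 2 / 4`; once `M log 2 ≥ 8`, subtracting one leaves at least `M log 2 / 8`,
      -- and `M > c√N` along the subsequence.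
      · refine (hf.and_eventually ((hMt.eventually (eventually_window_bounds s)).and
          ((hMt.eventually_ge_atTop (8 / Real.log 2)).and (hs.eventually_gt_atTop 0)))).mono ?_
        rintro N ⟨h1, h2, h3, h4⟩ y hy
        obtain ⟨-, h5, -⟩ := h2 y hy
        rw [div_le_iff₀ hl] at h3
        have h6 := mul_le_mul_of_nonneg_right h1.le hl.le
        change _ ≤ (y ^ 2 - 1) / √(N : ℝ)
        rw [le_div_iff₀ h4]
        linarith
    · filter_upwards [hC] with N h1 r _
      have h3 := mul_le_mul_of_nonneg_right h1 (abs_nonneg r)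
      have h4 := mul_le_mul_of_nonneg_left h3 (show 0 ≤ 2 * Real.log 2 by positivity)
      have h5 : (N : ℝ) * r ^ 2 = (√(N : ℝ) * |r|) ^ 2 := by
        rw [mul_pow, sq_abs, sq (√(N : ℝ)), ← hsq]
      rw [h5]
      have h6 : 2 * Real.log 2 * C * (√(N : ℝ) * |r|) ≤
          1 / 8 * (√(N : ℝ) * |r|) ^ 2 + 2 * (2 * Real.log 2 * C) ^ 2 := by
        generalize 2 * Real.log 2 * C = k
        generalize √(N : ℝ) * |r| = s
        nlinarith [sq_nonneg (s - 4 * k)]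
      linarith

/-- The exponent `2 log 2 * M r²` has the form `a N r²` with no additive loss, but needs `a = 2C log
2 < 1/4`, which is the assumption `C < 1/(8 log 2)`. When `M = o(N)` every multiple of `M r²` is
eventually below `N r²/8`. -/
theorem IsRandomCloud.ae_sherringtonKirkpatrick (hX : IsRandomCloud P M X)
    (hM : (fun N : ℕ => Real.log N) =o[atTop] fun N : ℕ => (2 : ℝ) ^ (M N))
    (hH : IsGaussianHamiltonian Pg (fun r => r ^ 2) H)
    (hlim : limsup (fun N : ℕ => ((M N / (N : ℝ) : ℝ) : EReal)) atTop <
      ((1 / (8 * Real.log 2) : ℝ) : EReal)) :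
    ∀ᵐ ω ∂P,
      (M =o[atTop] (fun N : ℕ => (N : ℝ)) → ConvergesToPoisson Pg
        (fun N => pointProcess (M N) (fun σ => X N σ ω) (H N)) intensity) ∧
      ∀ Λ, ConvergesToPoisson Pg (fun N => pointProcess (M N) (fun σ => X N σ ω) (H N)) Λ →
        M =o[atTop] fun N : ℕ => (N : ℝ) := by
  have hl := Real.log_pos one_lt_two
  have hMt := tendsto_atTop_of_log_isLittleO hM
  have hs : Tendsto (fun N : ℕ => (N : ℝ)) atTop atTop := tendsto_natCast_atTop_atTop
  obtain ⟨C, hCb, hC⟩ := exists_le_mul_of_limsup_lt (hs.eventually_gt_atTop 0) hlim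
  have hC8 : C * Real.log 2 < 1 / 8 := by
    have := EReal.coe_lt_coe_iff.1 hCb
    rw [lt_div_iff₀ (by positivity)] at this
    linarith
  have hMC : ∀ᶠ N : ℕ in atTop, M N * Real.log 2 ≤ C * Real.log 2 * N := by
    filter_upwards [hC] with N h1
    linarith [mul_le_mul_of_nonneg_right h1 hl.le]
  have hM8 : ∀ᶠ N : ℕ in atTop, M N * Real.log 2 ≤ N / 8 := by
    filter_upwards [hMC] with N h1
    linarith [mul_le_mul_of_nonneg_right hC8.le (Nat.cast_nonneg (α := ℝ) N)]
  have hMN : ∀ᶠ N : ℕ in atTop, 2 * M N * Real.log 2 ≤ N / 4 := by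
    filter_upwards [hM8] with N h1
    linarith
  have hν : ∀ r : ℝ, |r| ≤ 1 → |r ^ 2| ≤ |r| := fun r hr => by
    rw [abs_pow, sq]
    exact mul_le_of_le_one_left (abs_nonneg r) hr
  filter_upwards [hX.ae_isTypicalCloud hM hMN (a := max (1 / 8) (2 * (C * Real.log 2)))
    (le_max_of_le_left (by norm_num)) (max_lt (by norm_num) (by linarith))] with ω hω
  refine ⟨fun ho => ?_, fun Λ hΛ => ?_⟩
  · refine hω.convergesToPoisson hH hMt (one_pow 2) hν fun K => ?_
    have hK : (0 : ℝ) < 1 / (8 * (K + 1)) := by positivity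
    filter_upwards [ho.bound hK, hMt.eventually_ge_atTop 0] with N h1 h2 r _
    have hN : (0 : ℝ) ≤ N := Nat.cast_nonneg N
    rw [Real.norm_of_nonneg h2, Real.norm_of_nonneg hN] at h1
    have h4 : (K : ℝ) * (1 / (8 * (K + 1))) ≤ 1 / 8 := by
      rw [mul_one_div, div_le_div_iff₀ (by positivity) (by norm_num)]; linarith
    have h5 := mul_le_mul_of_nonneg_left h1 (Nat.cast_nonneg (α := ℝ) K)
    have h6 := mul_le_mul_of_nonneg_right h4 hN
    have h7 : K * M N ≤ 1 / 8 * N := by linarith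
    have h8 := mul_le_mul_of_nonneg_right h7 (sq_nonneg r)
    have h9 := mul_le_mul_of_nonneg_right (le_max_left (1 / 8) (2 * (C * Real.log 2)))
      (mul_nonneg hN (sq_nonneg r))
    rw [abs_of_nonneg (sq_nonneg r)]
    linarith
  · by_contra hn
    obtain ⟨c, hc, hf⟩ := exists_frequently_lt_of_not_isLittleO (hMt.eventually_ge_atTop 0)
      (hs.eventually_ge_atTop 0) hn
    have hmod := hω.isModerateCloud hH hMt (one_pow 2) hν (D := 0) ?_
    · refine hmod.not_convergesToPoisson
        (V := fun N ω => spinScale N * ∑ τ, H N τ ω) (q := fun N y => y / √(N : ℝ))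
        (W := fun N σ ω => spinScale N * ∑ τ, resid (fun σ τ => overlap σ τ ^ 2) (H N) σ τ ω)
        (C := 4) ?_ (κ := √(c * Real.log 2 / 4))
        (L := 1) (Real.sqrt_pos.2 (by positivity)) (fun s => ?_) (fun s => ?_) hΛ
      · filter_upwards [eventually_gt_atTop 0] with N hN
        exact (hH.isUnitGaussian (one_pow 2) hN).isCommonFactor_sum hN
      -- On the window `y² ≤ 4M log 2 ≤ N/2`, so `q` is at most one.
      · filter_upwards [hMt.eventually (eventually_window_bounds s), hM8,
          eventually_gt_atTop 0] with N h1 h2 hN y hy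
        obtain ⟨h3, -, h4⟩ := h1 y hy
        have h5 : 0 < √(N : ℝ) := Real.sqrt_pos.2 (by positivity)
        rw [abs_div, abs_of_pos h5, div_le_one h5, abs_of_nonneg h3]
        refine Real.le_sqrt_of_sq_le ?_
        linarith [Nat.cast_nonneg (α := ℝ) N]
      · refine (hf.and_eventually ((hMt.eventually (eventually_window_bounds s)).and
          (eventually_gt_atTop 0))).mono ?_
        rintro N ⟨h1, h2, hN⟩ y hy
        obtain ⟨h3, h4, -⟩ := h2 y hy
        have h5 : 0 < √(N : ℝ) := Real.sqrt_pos.2 (by positivity)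
        have h6 := mul_le_mul_of_nonneg_right h1.le hl.le
        change _ ≤ y / √(N : ℝ)
        rw [le_div_iff₀ h5, ← Real.sqrt_mul (by positivity)]
        refine (Real.sqrt_le_left h3).2 ?_
        linarith
    · filter_upwards [hMC] with N h1 r _
      have h2 := mul_le_mul_of_nonneg_right h1 (sq_nonneg r)
      have h9 := mul_le_mul_of_nonneg_right (le_max_right (1 / 8) (2 * (C * Real.log 2)))
        (mul_nonneg (Nat.cast_nonneg (α := ℝ) N) (sq_nonneg r))
      rw [abs_of_nonneg (sq_nonneg r)]
      linarith

end

end RandomCloud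

end

/-! ### The breakdown of universality -/

theorem theorem2
    {Ω Ω' : Type*} [MeasurableSpace Ω] [MeasurableSpace Ω']
    (P : Measure Ω) [IsProbabilityMeasure P] (Pg : Measure Ω') [IsProbabilityMeasure Pg]
    (M : ℕ → ℝ) (X : (N : ℕ) → RandomCloud.Spin N → Ω → Bool)
    (hX : RandomCloud.IsRandomCloud P M X)
    (hM : (fun N : ℕ => Real.log N) =o[atTop] fun N : ℕ => (2 : ℝ) ^ (M N))
    (H : (N : ℕ) → RandomCloud.Spin N → Ω' → ℝ) :
    -- (i) number partitioning
    (RandomCloud.IsGaussianHamiltonian Pg (fun r => r) H →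
      limsup (fun N : ℕ => ((M N / √(N : ℝ) : ℝ) : EReal)) atTop < ⊤ →
      ∀ᵐ ω ∂P,
        (RandomCloud.ConvergesToPoisson Pg
            (fun N => RandomCloud.pointProcess (M N) (fun σ => X N σ ω) (H N))
            RandomCloud.intensity ↔
          M =o[atTop] fun N : ℕ => √(N : ℝ)) ∧
        ((∃ Λ : Measure ℝ, RandomCloud.ConvergesToPoisson Pg
            (fun N => RandomCloud.pointProcess (M N) (fun σ => X N σ ω) (H N)) Λ) ↔
          M =o[atTop] fun N : ℕ => √(N : ℝ))) ∧
    -- (ii) the Sherrington-Kirkpatrick model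
    (RandomCloud.IsGaussianHamiltonian Pg (fun r => r ^ 2) H →
      limsup (fun N : ℕ => ((M N / (N : ℝ) : ℝ) : EReal)) atTop <
        ((1 / (8 * Real.log 2) : ℝ) : EReal) →
      ∀ᵐ ω ∂P,
        (RandomCloud.ConvergesToPoisson Pg
            (fun N => RandomCloud.pointProcess (M N) (fun σ => X N σ ω) (H N))
            RandomCloud.intensity ↔
          M =o[atTop] fun N : ℕ => (N : ℝ)) ∧
        ((∃ Λ : Measure ℝ, RandomCloud.ConvergesToPoisson Pg
            (fun N => RandomCloud.pointProcess (M N) (fun σ => X N σ ω) (H N)) Λ) ↔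
          M =o[atTop] fun N : ℕ => (N : ℝ))) := by
  refine ⟨fun hH hlim => ?_, fun hH hlim => ?_⟩
  · filter_upwards [hX.ae_numberPartitioning hM hH hlim] with ω h
    exact ⟨⟨h.2 _, h.1⟩, fun ⟨Λ, hΛ⟩ => h.2 Λ hΛ, fun ho => ⟨_, h.1 ho⟩⟩
  · filter_upwards [hX.ae_sherringtonKirkpatrick hM hH hlim] with ω h
    exact ⟨⟨h.2 _, h.1⟩, fun ⟨Λ, hΛ⟩ => h.2 Λ hΛ, fun ho => ⟨_, h.1 ho⟩⟩
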